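/- Let $G$ be a finite simple graph, let $D\subseteq V(G)$ (a defense) and let $A\subseteq V(G)$ (an attack). A vertex $v\in V(G)\setminus A$ *survives* if the graph $G-A$ contains a path from $v$ to some vertex of $D$; every vertex of $G$ that does not survive (in particular every vertex of $A$) is *disabled*. Let $\overline{\mathrm{payoff}}(G,D,A)$ denote the number of disabled vertices. For a positive integer $\ell$, an $\ell$-attack is a set of at most $\ell$ vertices. The decision problem CP(Fixed Defense, Pure Attack) is the following: given a finite graph $G$, a set $D\subseteq V(G)$ and positive integers $\ell$ and $\alpha$, is there an $\ell$-attack $A$ such that $\overline{\mathrm{payoff}}(G,D,A)\ge\alpha$? An *interval graph* is a graph whose vertices can be assigned nonempty closed bounded intervals of the real line such that two distinct vertices are adjacent if and only if their intervals intersect. **Theorem.** CP(Fixed Defense, Pure Attack) is polynomial-time solvable on interval graphs: there are a deterministic Turing machine and a polynomial $p$ such that, on every input $\langle G,D,\ell,\alpha\rangle$ in which $G$ is an interval graph, the machine outputs the correct answer after at most $p(N)$ steps, where $N$ is the length of the input. Here $G$ is given by its adjacency matrix, $D$ by its indicator vector, and $\ell$ and $\alpha$ in binary; no interval representation of $G$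 is given. -/

import Mathlib

namespace ControllerPlacement

/-- Interval graphs: every vertex is assigned a (nonempty, closed, bounded) interval of the real
line, and two distinct vertices are adjacent if and only if their intervals intersect. -/
def IsIntervalGraph {V : Type*} (G : SimpleGraph V) : Prop :=
  ∃ a b : V → ℝ, (∀ v, a v ≤ b v) ∧
    ∀ u v, u ≠ v → (G.Adj u v ↔ (Set.Icc (a u) (b u) ∩ Set.Icc (a v) (b v)).Nonempty)

/-- The vertex `v` survives under defense `D` and attack `A`: it is not attacked, and `G - A`
contains a path from `v` to some vertex of `D`. -/
def Survives {V : Type*} (G : SimpleGraph V) (D A : Finset V) (v : V) : Prop :=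
  ∃ (hv : v ∉ A) (d : V) (hd : d ∉ A), d ∈ D ∧
    (G.induce {w : V | w ∉ A}).Reachable ⟨v, hv⟩ ⟨d, hd⟩

open Classical in
/-- The payoff of the attacker: the number of disabled (that is, not surviving) vertices. -/
noncomputable def payoffAtt {V : Type*} [Fintype V] (G : SimpleGraph V) (D A : Finset V) : ℕ :=
  (Finset.univ.filter fun v => ¬ Survives G D A v).card

/-- An instance of CP(Fixed Defense, Pure Attack): a finite graph `G` (on the vertices
`0, …, n - 1`), a defense `D`, and positive integers `ℓ` and `α`. -/
@[ext]
structure Instance where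
  n : ℕ
  G : SimpleGraph (Fin n)
  D : Finset (Fin n)
  l : ℕ
  α : ℕ
  l_pos : 0 < l
  α_pos : 0 < α

/-- The question of CP(Fixed Defense, Pure Attack): is there an `ℓ`-attack, i.e. a set `A` of at
most `ℓ` vertices, with attacker's payoff at least `α`? -/
def Instance.IsYes (I : Instance) : Prop :=
  ∃ A : Finset (Fin I.n), A.card ≤ I.l ∧ I.α ≤ payoffAtt I.G I.D A

open Computability (Γ' encodeNat encodeBool)

open Classical in
/-- The block of the input string that describes the vertex `v`: an opening bracket, the bit
that tells whether `v` lies in `D`, and the row of `v` in the adjacency matrix. -/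
noncomputable def Instance.row (I : Instance) (v : Fin I.n) : List Γ' :=
  Γ'.bra :: Γ'.bit (decide (v ∈ I.D)) :: List.ofFn fun w => Γ'.bit (decide (I.G.Adj v w))

/-- The input string of an instance: the blocks of all vertices in order, a comma, `ℓ` in binary,
a comma, and `α` in binary. -/
noncomputable def Instance.encode (I : Instance) : List Γ' :=
  (List.ofFn I.row).flatten ++
    Γ'.comma :: ((encodeNat I.l).map Γ'.bit ++ Γ'.comma :: (encodeNat I.α).map Γ'.bit)

/-- Different instances have different input strings. -/
theorem Instance.encode_injective : Function.Injective Instance.encode := by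
  classical
  have split : ∀ {s s' t t' : List Γ'}, Γ'.comma ∉ s → Γ'.comma ∉ s' →
      s ++ Γ'.comma :: t = s' ++ Γ'.comma :: t' → s = s' ∧ t = t' := by
    intro s
    induction s with
    | nil =>
      intro s' t t' _ h' h
      cases s' with
      | nil => simpa using h
      | cons x s' => simp_all
    | cons x s ih =>
      intro s' t t' h0 h' h
      cases s' with
      | nil => simp_all
      | cons y s' =>
        simp only [List.cons_append, List.cons.injEq, List.mem_cons, not_or] at *
        obtain ⟨h1, h2⟩ := ih h0.2 h'.2 h.2
        exact ⟨⟨h.1, h1⟩, h2⟩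
  have hbits : ∀ m : ℕ, Γ'.comma ∉ (encodeNat m).map Γ'.bit := by simp
  have hnat : ∀ m m' : ℕ, (encodeNat m).map Γ'.bit = (encodeNat m').map Γ'.bit → m = m' := by
    intro m m' h
    have hb : Function.Injective Γ'.bit := fun _ _ h => by injection h
    have := hb.list_map h
    rw [← Computability.decode_encodeNat m, this, Computability.decode_encodeNat]
  have hrows : ∀ I : Instance, Γ'.comma ∉ (List.ofFn I.row).flatten := by
    simp [Instance.row, List.mem_flatten, List.mem_ofFn]
  have hlen : ∀ (I : Instance) v, (I.row v).length = I.n + 2 := by simp [Instance.row]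
  have hcount : ∀ I : Instance, (List.ofFn I.row).flatten.count Γ'.bra = I.n := by
    intro I
    have h0 : ∀ v, (I.row v).count Γ'.bra = 1 := by
      intro v
      simp [Instance.row, List.count_eq_zero, List.mem_ofFn]
    simp [List.count_flatten, List.map_ofFn, Function.comp_def, h0]
  intro I I' h
  obtain ⟨h1, h2⟩ := split (hrows I) (hrows I') h
  obtain ⟨h2, h3⟩ := split (hbits _) (hbits _) h2
  have hn : I.n = I'.n := by rw [← hcount I, h1, hcount I']
  have hl := hnat _ _ h2
  have hα := hnat _ _ h3
  obtain ⟨n, G, D, l, α, p, q⟩ := I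
  obtain ⟨n', G', D', l', α', p', q'⟩ := I'
  dsimp only at hn hl hα
  subst hn hl hα
  have h4 := List.eq_iff_flatten_eq.2 ⟨h1, by simp [List.map_ofFn, Function.comp_def, hlen]⟩
  have h5 := congrFun (List.ofFn_injective h4)
  simp only [Instance.row, List.cons.injEq, Γ'.bit.injEq, decide_eq_decide, true_and] at h5
  have hD : D = D' := Finset.ext fun v => (h5 v).1
  have hG : G = G' := by
    ext v w
    simpa using congrFun (List.ofFn_injective (h5 v).2) w
  subst hD hG
  rfl

open Classical in
/-- The decision problem `P` is solvable in polynomial time on the class `C` of instances, which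
are given to the machine as strings by `enc`: one deterministic (multi-stack) Turing machine
outputs, for every instance `x` in `C`, the correct answer to `P x`, within a number of steps
bounded by a fixed polynomial in the length of the input string `enc x`. -/
def PolyTimeSolvableOn {ι Γ : Type} (enc : ι → List Γ) (P C : ι → Prop) : Prop :=
  Nonempty (Turing.TM2ComputableInPolyTime (fun x : {x : ι // C x} => enc x.1) encodeBool
    (fun x => decide (P x.1)))

end ControllerPlacement

/-!
The algorithm does not need an interval representation of the graph; it computes an integral one.

*Reduction.* An optimal attack disables a set `U` of vertices without defenders by removing the
boundary of `U`, and spends what is left of the budget on arbitrary vertices. Hence the answer is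
positive if and only if `α ≤ n` and some set `U` without defenders has a boundary of at most `ℓ`
vertices and satisfies `α ≤ |U| + ℓ` (`ControllerPlacement.Instance.isYes_iff`).

*Interval order.* For a pair of nonadjacent vertices `a`, `b`, each of `a`, `b` may be replaced by a
neighbour of it that is nonadjacent to the other one, without changing which of the two intervals is
on the left. Orienting each class of the resulting equivalence relation such that its
lexicographically first pair is increasing gives a transitive relation on an interval graph
(`IntervalOrder.Before.trans`); it is an interval order, since interval graphs contain no induced
four-cycle. The number of predecessors of a vertex and the smallest left end of a successor
yield intervals with ends among `0, …, n - 1` (`IntervalOrder.eq_or_adj_iff`).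

*Sweep.* Let `t` be the set of points covered by the intervals of `U`. One may replace `U` by the set
of all nondefenders whose intervals consist of points of `t`; its boundary consists of the other
vertices whose intervals meet `t`. These two sets can be counted from left to right if one remembers
the last point in `t` and the last point outside `t`, which gives a dynamic programme with
polynomially many states (`ControllerPlacement.Instance.isYes_iff_sweep`).

*Machine.* Everything above is expressible by first-order formulas and inductive definitions over the
positions of the input string. Formulas and inductive definitions are evaluated by programs that
compute tables of relations, and such programs are translated, by way of structured programs on
stacks, to multi-stack Turing machines that run in polynomial time
(`StackCode.polyTimeSolvableOn_of_prog`). It remains to write down the program (`ControllerPlacement.Tab.prog`) and to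
check the contents of its tables (`ControllerPlacement.Tab.done_prog`).
-/


namespace StackCode

open Computability (Γ')
open Turing

/-! ### Structured programs on stacks -/

/-- Structured programs that operate on stacks indexed by `K`, over the alphabet `Γ'`.
`pop k P` removes the top symbol of stack `k` and continues with the program that `P` assigns to it
(to `none` if the stack was empty). `loop k f P` keeps popping the stack `k`; as long as the popped
symbol `c` passes the test `f` it runs `P c`, and it ends (with the symbol removed) at the first
symbol that fails the test, or when the stack is empty. -/
inductive Code (K : Type) : Type
  | nop : Code K
  | push (k : K) (c : Γ') : Code K
  | pop (k : K) (P : Option Γ' → Code K) : Code K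
  | loop (k : K) (f : Γ' → Bool) (P : Γ' → Code K) : Code K
  | seq (P Q : Code K) : Code K

/-- The contents of the stacks, the head of a list being the top of the stack. -/
abbrev Store (K : Type) := K → List Γ'

variable {K : Type} [DecidableEq K]

open Function (update)

/-- `Exec P s s' t`: the program `P` leads from the store `s` to the store `s'` in exactly
`t` machine steps. -/
inductive Exec : Code K → Store K → Store K → ℕ → Prop
  | nop (s) : Exec .nop s s 1
  | push (k c s) : Exec (.push k c) s (update s k (c :: s k)) 1
  | pop {k P s s' t} (h : Exec (P (s k).head?) (update s k (s k).tail) s' t) :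
      Exec (.pop k P) s s' (t + 1)
  | loop_exit {k f P s} (h : ∀ c ∈ (s k).head?, f c = false) :
      Exec (.loop k f P) s (update s k (s k).tail) 1
  | loop_step {k f P s s₁ s₂ t₁ t₂ c} (hc : (s k).head? = some c) (hf : f c = true)
      (h₁ : Exec (P c) (update s k (s k).tail) s₁ t₁) (h₂ : Exec (.loop k f P) s₁ s₂ t₂) :
      Exec (.loop k f P) s s₂ (t₁ + t₂ + 1)
  | seq {P Q s s₁ s₂ t₁ t₂} (h₁ : Exec P s s₁ t₁) (h₂ : Exec Q s₁ s₂ t₂) :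
      Exec (.seq P Q) s s₂ (t₁ + t₂)

/-! ### Translation to Turing machines -/

/-- The labels of the machine code of a program. A branching statement has one label of its own
(`none`) besides the labels of its branches. -/
def Lab : Code K → Type
  | .nop => Unit
  | .push _ _ => Unit
  | .pop _ P => Option (Σ c : Option Γ', Lab (P c))
  | .loop _ _ P => Option (Σ c : Γ', Lab (P c))
  | .seq P Q => Lab P ⊕ Lab Q

/-- There are finitely many labels. -/
@[reducible]
def Lab.fintype : (P : Code K) → Fintype (Lab P)
  | .nop => inferInstanceAs (Fintype Unit)
  | .push _ _ => inferInstanceAs (Fintype Unit)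
  | .pop _ P =>
    letI := fun c => Lab.fintype (P c)
    inferInstanceAs (Fintype (Option (Σ c : Option Γ', Lab (P c))))
  | .loop _ _ P =>
    letI := fun c => Lab.fintype (P c)
    inferInstanceAs (Fintype (Option (Σ c : Γ', Lab (P c))))
  | .seq P Q =>
    letI := Lab.fintype P
    letI := Lab.fintype Q
    inferInstanceAs (Fintype (Lab P ⊕ Lab Q))

/-- The label at which the execution of a program starts. -/
def entry : (P : Code K) → Lab P
  | .nop => ()
  | .push _ _ => ()
  | .pop _ _ => none
  | .loop _ _ _ => none
  | .seq P _ => .inl (entry P)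

/-- The stack alphabets of the machine: `none` is the output stack. -/
abbrev Sym (K : Type) : Option K → Type
  | none => Bool
  | some _ => Γ'

/-- The machine code of a program, inside a larger machine with labels `Λ`: the labels of the
program are embedded by `emb`, and control leaves the program to the label `exit`. -/
def stmt {Λ : Type} : (P : Code K) → (Lab P → Λ) → Λ → Lab P → TM2.Stmt (Sym K) Λ (Option Γ')
  | .nop, _, exit, _ => .goto fun _ => exit
  | .push k c, _, exit, _ => .push (some k) (fun _ => c) (.goto fun _ => exit)
  | .pop k P, emb, _, none =>
    .pop (some k) (fun _ c => c) (.goto fun c => emb (some ⟨c, entry (P c)⟩))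
  | .pop _ P, emb, exit, some ⟨c, l⟩ => stmt (P c) (fun l => emb (some ⟨c, l⟩)) exit l
  | .loop k f P, emb, exit, none =>
    .pop (some k) (fun _ c => c) (.goto fun c =>
      match c with
      | none => exit
      | some c => if f c then emb (some ⟨c, entry (P c)⟩) else exit)
  | .loop _ _ P, emb, _, some ⟨c, l⟩ => stmt (P c) (fun l => emb (some ⟨c, l⟩)) (emb none) l
  | .seq P Q, emb, _, .inl l => stmt P (fun l => emb (.inl l)) (emb (.inr (entry Q))) l
  | .seq _ Q, emb, exit, .inr l => stmt Q (fun l => emb (.inr l)) exit l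

/-- The stacks of the machine for a given store; the output stack is empty. -/
def full (s : Store K) : ∀ k, List (Sym K k)
  | none => []
  | some k => s k

theorem update_full (s : Store K) (k : K) (l : List Γ') :
    update (full s) (some k) l = full (update s k l) := by
  funext k'
  cases k' with
  | none => simp [full]
  | some k' =>
    by_cases h : k' = k
    · subst h; simp [full]
    · have : (some k' : Option K) ≠ some k := by simpa using h
      simp [full, h, this]

/-- `Steps m t c c'`: the machine `m` takes exactly `t` steps from `c` to `c'`. -/
def Steps {Λ : Type} (m : Λ → TM2.Stmt (Sym K) Λ (Option Γ')) (t : ℕ)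
    (c c' : TM2.Cfg (Sym K) Λ (Option Γ')) : Prop :=
  (flip bind (TM2.step m))^[t] (some c) = some c'

theorem Steps.one {Λ : Type} {m : Λ → TM2.Stmt (Sym K) Λ (Option Γ')}
    {c c' : TM2.Cfg (Sym K) Λ (Option Γ')} (h : TM2.step m c = some c') : Steps m 1 c c' := by
  simp [Steps, flip, h]

theorem Steps.trans {Λ : Type} {m : Λ → TM2.Stmt (Sym K) Λ (Option Γ')} {t₁ t₂ : ℕ}
    {c c' c'' : TM2.Cfg (Sym K) Λ (Option Γ')} (h₁ : Steps m t₁ c c') (h₂ : Steps m t₂ c' c'') :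
    Steps m (t₁ + t₂) c c'' := by
  unfold Steps at *
  rw [add_comm, Function.iterate_add_apply, h₁, h₂]

/-- The machine code of a program does what the program does, in the same number of steps. -/
theorem Exec.steps {P : Code K} {s s' : Store K} {t : ℕ} (h : Exec P s s' t) {Λ : Type}
    (m : Λ → TM2.Stmt (Sym K) Λ (Option Γ')) (emb : Lab P → Λ) (exit : Λ)
    (hm : ∀ l, m (emb l) = stmt P emb exit l) (v : Option Γ') :
    ∃ v', Steps m t ⟨some (emb (entry P)), v, full s⟩ ⟨some exit, v', full s'⟩ := by
  induction h generalizing Λ exit v with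
  | nop s =>
    refine ⟨v, Steps.one ?_⟩
    rw [TM2.step, hm]
    simp [stmt]
  | push k c s =>
    refine ⟨v, Steps.one ?_⟩
    rw [TM2.step, hm]
    simp [stmt, ← update_full, full]
  | @pop k P s s' t h ih =>
    obtain ⟨v', h'⟩ := ih m (fun l => emb (some ⟨_, l⟩)) exit (fun l => hm (some ⟨_, l⟩))
      (s k).head?
    refine ⟨v', ?_⟩
    rw [add_comm]
    refine Steps.trans (Steps.one ?_) h'
    rw [TM2.step, hm]
    simp [stmt, entry, ← update_full, full]
  | @loop_exit k f P s h =>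
    refine ⟨(s k).head?, Steps.one ?_⟩
    rw [TM2.step, hm]
    rcases hc : (s k).head? with _ | c
    · simp [stmt, entry, ← update_full, full, hc]
    · simp [stmt, entry, ← update_full, full, hc, h c hc]
  | @loop_step k f P s s₁ s₂ t₁ t₂ c hc hf h₁ h₂ ih₁ ih₂ =>
    obtain ⟨v₁, h₁'⟩ := ih₁ m (fun l => emb (some ⟨c, l⟩)) (emb none) (fun l => hm (some ⟨c, l⟩))
      (s k).head?
    obtain ⟨v₂, h₂'⟩ := ih₂ m emb exit hm v₁
    refine ⟨v₂, ?_⟩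
    rw [add_comm]
    refine Steps.trans (Steps.one ?_) (Steps.trans h₁' h₂')
    rw [TM2.step, hm]
    simp [stmt, entry, ← update_full, full, hc, hf]
  | @seq P Q s s₁ s₂ t₁ t₂ h₁ h₂ ih₁ ih₂ =>
    obtain ⟨v₁, h₁'⟩ := ih₁ m (fun l => emb (.inl l)) (emb (.inr (entry Q)))
      (fun l => hm (.inl l)) v
    obtain ⟨v₂, h₂'⟩ := ih₂ m (fun l => emb (.inr l)) exit (fun l => hm (.inr l)) v₁
    exact ⟨v₂, Steps.trans h₁' h₂'⟩

/-- The machine that reads its input from the stack `inp`, runs `P` and answers by the bit that `P`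
has left on the stack `res`. -/
def machine [Fintype K] (P : Code K) (inp res : K) : FinTM2 :=
  letI := Lab.fintype P
  { K := Option K
    k₀ := some inp
    k₁ := none
    Γ := Sym K
    Λ := Option (Lab P)
    main := some (entry P)
    σ := Option Γ'
    initialState := none
    Γk₀Fin := inferInstanceAs (Fintype Γ')
    m := fun l => match l with
      | some l => stmt P some none l
      | none => .pop (some res) (fun _ c => c)
          (.push none (fun c => decide (c = some (Γ'.bit true))) (.load (fun _ => none) .halt)) }

/-- A decision problem is solved in polynomial time if there is a structured program which, on
every input in the class, empties all stacks except for the correct answer on the stack `res`,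
in polynomial time. -/
theorem polyTimeSolvableOn_of_exec [Fintype K] {ι : Type} (enc : ι → List Γ') (Q C : ι → Prop)
    (P : Code K) (inp res : K) (time : Polynomial ℕ)
    (h : ∀ x, C x → ∃ t ≤ time.eval (enc x).length, ∃ b : Bool, (b = true ↔ Q x) ∧
      Exec P (update (fun _ => []) inp (enc x)) (update (fun _ => []) res [Γ'.bit b]) t) :
    ControllerPlacement.PolyTimeSolvableOn enc Q C := by
  classical
  refine ⟨⟨⟨machine P inp res, Equiv.refl _, Equiv.refl _⟩, time + 1, fun x => ?_⟩⟩
  apply Classical.choice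
  obtain ⟨t, ht, b, hb, hex⟩ := h x.1 x.2
  obtain ⟨v', hs⟩ := hex.steps (machine P inp res).m some none (fun l => rfl) none
  have hfin : Steps (machine P inp res).m 1
      ⟨some none, v', full (update (fun _ => []) res [Γ'.bit b])⟩
      (haltList (machine P inp res) [b]) := by
    refine Steps.one ?_
    refine (TM2.step.eq_2 _ _ _ _).trans (congrArg some ?_)
    have h1 : update (full (update (fun _ => []) res [Γ'.bit b])) (some res) []
        = full (fun _ : K => []) := by
      rw [update_full]; simp
    have h2 : full (update (fun _ => []) res [Γ'.bit b]) (some res) = [Γ'.bit b] := by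
      simp [full]
    simp only [machine, TM2.stepAux, h2, List.tail_cons, h1, List.head?_cons]
    congr 2
    funext k
    cases k with
    | none => cases b <;> simp [full]
    | some k => simp [full]
  have hall := Steps.trans hs hfin
  have hinit : initList (machine P inp res) (enc x.1) =
      ⟨some (some (entry P)), none, full (update (fun _ => []) inp (enc x.1))⟩ := by
    unfold initList
    congr 1
    funext k
    cases k with
    | none => rfl
    | some k =>
      by_cases hk : k = inp
      · subst hk
        exact dif_pos rfl |>.trans (by simp [full]; rfl)
      · have : (some k : Option K) ≠ some inp := by simpa using hk
        simp [full, machine, hk]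
  have hans : decide (Q x.1) = b := by
    cases b <;> simp_all
  refine ⟨⟨⟨t + 1, ?_⟩, by simpa using ht⟩⟩
  refine (congrArg (fun l => (flip bind (machine P inp res).step)^[t + 1]
    (some (initList (machine P inp res) l))) (List.map_id (enc x.1))).trans ?_
  rw [hinit, hans]
  exact hall

end StackCode

namespace StackCode

open Computability (Γ')
open Function (update)

/-! ### Execution with a time bound -/

section Run

variable {K : Type} [DecidableEq K]

/-- `Run P s s' T`: the program `P` leads from `s` to `s'` in at most `T` machine steps. -/
def Run (P : Code K) (s s' : Store K) (T : ℕ) : Prop := ∃ t ≤ T, Exec P s s' t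

/-- The mark of which unary counters consist. -/
abbrev mark : Γ' := Γ'.bit true

variable {P Q : Code K} {s s₁ s₂ : Store K} {T T₁ T₂ : ℕ} {k : K}

theorem Run.mono (h : Run P s s₁ T₁) (hT : T₁ ≤ T₂) : Run P s s₁ T₂ :=
  let ⟨t, ht, h⟩ := h
  ⟨t, ht.trans hT, h⟩

theorem Run.congr (h : Run P s s₁ T) {s' s₁' : Store K} (e : s = s') (e₁ : s₁ = s₁') :
    Run P s' s₁' T := e ▸ e₁ ▸ h

theorem Run.nop : Run .nop s s 1 := ⟨1, le_rfl, .nop s⟩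

theorem Run.push {c : Γ'} : Run (.push k c) s (update s k (c :: s k)) 1 :=
  ⟨1, le_rfl, .push k c s⟩

theorem Run.pop {P : Option Γ' → Code K}
    (h : Run (P (s k).head?) (update s k (s k).tail) s₁ T) : Run (.pop k P) s s₁ (T + 1) :=
  let ⟨t, ht, h⟩ := h
  ⟨t + 1, by lia, .pop h⟩

theorem Run.seq (h₁ : Run P s s₁ T₁) (h₂ : Run Q s₁ s₂ T₂) :
    Run (.seq P Q) s s₂ (T₁ + T₂) :=
  let ⟨t₁, ht₁, h₁⟩ := h₁
  let ⟨t₂, ht₂, h₂⟩ := h₂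
  ⟨t₁ + t₂, by lia, .seq h₁ h₂⟩

/-- A loop that consumes the symbols `l` on top of the stack `k`; the store is `σ l'` when the
symbols `l'` are left. -/
theorem Run.loop {f : Γ' → Bool} {P : Γ' → Code K} {r : List Γ'} (σ : List Γ' → Store K)
    (l : List Γ') (hk : ∀ l', σ l' k = l' ++ r) (hl : ∀ c ∈ l, f c = true)
    (hr : ∀ c ∈ r.head?, f c = false)
    (h : ∀ c l', (c :: l') <:+ l → Run (P c) (update (σ (c :: l')) k (l' ++ r)) (σ l') T) :
    Run (.loop k f P) (σ l) (update (σ []) k r.tail) (l.length * (T + 1) + 1) := by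
  induction l with
  | nil =>
    refine ⟨1, by simp, ?_⟩
    have h0 : σ [] k = r := by simp [hk]
    rw [← h0]
    exact .loop_exit (by rwa [h0])
  | cons c l ih =>
    obtain ⟨t₁, ht₁, h₁⟩ := h c l (List.suffix_refl _)
    obtain ⟨t₂, ht₂, h₂⟩ := ih (fun c hc => hl c (List.mem_cons_of_mem _ hc))
      (fun c l' h' => h c l' (h'.trans (List.suffix_cons _ _)))
    refine ⟨t₁ + t₂ + 1, ?_, .loop_step (c := c) (by simp [hk]) (hl c List.mem_cons_self) ?_ h₂⟩
    · simp only [List.length_cons]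
      linarith [Nat.add_mul l.length 1 (T + 1)]
    · simpa [hk] using h₁

/-- A loop that counts down the `n` marks on top of the stack `k`; the store is `σ i` when `i` marks
are left. -/
theorem Run.count {f : Γ' → Bool} {P : Γ' → Code K} {r : List Γ'} (σ : ℕ → Store K)
    (n : ℕ) (hf : f mark = true) (hk : ∀ i, σ i k = List.replicate i mark ++ r)
    (hr : ∀ c ∈ r.head?, f c = false)
    (h : ∀ i < n, Run (P mark) (update (σ (i + 1)) k (List.replicate i mark ++ r)) (σ i) T) :
    Run (.loop k f P) (σ n) (update (σ 0) k r.tail) (n * (T + 1) + 1) := by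
  induction n with
  | zero =>
    refine ⟨1, by simp, ?_⟩
    have h0 : σ 0 k = r := by simp [hk]
    rw [← h0]
    exact .loop_exit (by rwa [h0])
  | succ n ih =>
    obtain ⟨t₁, ht₁, h₁⟩ := h n (Nat.lt_succ_self n)
    obtain ⟨t₂, ht₂, h₂⟩ := ih (fun i hi => h i (hi.trans (Nat.lt_succ_self n)))
    refine ⟨t₁ + t₂ + 1, ?_, .loop_step (c := mark) (by simp [hk, List.replicate_succ]) hf ?_ h₂⟩
    · linarith [Nat.add_mul n 1 (T + 1)]
    · simpa [hk, List.replicate_succ] using h₁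

/-- The test that every symbol passes. -/
abbrev yes : Γ' → Bool := fun _ => true

/-- Empty the stack `k`. -/
def clear (k : K) : Code K := .loop k yes fun _ => .nop

theorem Run.clear : Run (clear k) s (update s k []) (2 * (s k).length + 1) := by
  have := Run.loop (k := k) (f := yes) (P := fun _ => .nop) (r := []) (T := 1)
    (fun l => update s k l) (s k) (by simp) (by simp) (by simp)
    (fun c l' _ => by simpa using Run.nop)
  simpa [StackCode.clear, mul_comm] using this

/-- Put a copy of the counter `src` on top of the stack `dst`; the empty stack `aux` is used
as a scratch pad. -/
def add (src dst aux : K) : Code K :=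
  .seq (.loop src yes fun _ => .seq (.push aux mark) (.push dst mark))
    (.loop aux yes fun _ => .push src mark)

theorem Run.add {src dst aux : K} (h₁ : src ≠ dst) (h₂ : src ≠ aux) (h₃ : dst ≠ aux) {m : ℕ}
    (hs : s src = List.replicate m mark) (ha : s aux = []) :
    Run (add src dst aux) s (update s dst (List.replicate m mark ++ s dst)) (5 * m + 2) := by
  have e₁ : ∀ i < m, List.replicate (m - i) mark = mark :: List.replicate (m - (i + 1)) mark := by
    intro i hi
    rw [← List.replicate_succ]
    congr 1
    lia
  have a₁ := Run.count (k := src) (f := yes) (T := 2) (r := [])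
    (P := fun _ => .seq (.push aux mark) (.push dst mark))
    (fun i => update (update (update s src (List.replicate i mark)) aux (List.replicate (m - i) mark))
      dst (List.replicate (m - i) mark ++ s dst)) m rfl (by intro i; simp [h₁, h₂]) (by simp) (by
      intro i hi
      refine (Run.seq Run.push Run.push).congr rfl ?_
      funext k
      simp only [Function.update_apply, e₁ i hi]
      grind)
  have a₂ := Run.count (k := aux) (f := yes) (T := 1) (r := []) (P := fun _ => .push src mark)
    (fun i => update (update (update s src (List.replicate (m - i) mark)) aux (List.replicate i mark))
      dst (List.replicate m mark ++ s dst)) m rfl (by intro i; simp [h₃.symm]) (by simp) (by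
      intro i hi
      refine Run.push.congr rfl ?_
      funext k
      simp only [Function.update_apply, e₁ i hi]
      grind)
  refine ((a₁.congr ?_ rfl).seq (a₂.congr ?_ ?_)).mono
    (T₁ := m * 3 + 1 + (m * 2 + 1)) (by lia)
  all_goals
    funext k
    simp only [Function.update_apply]
    grind

end Run

end StackCode

namespace StackCode

open Computability (Γ')
open Function (update)

/-! ### First-order formulas over tables, and their evaluation -/

/-- The stacks of the evaluator: a counter for each variable, a table of bits for each relation
symbol, the domain size `bnd`, the counters `idx` and `aux`, the scratch pad `tmp`, the control
stack `lp`, the buffer `buf` for new tables, the stack `res` of truth values, and the input. -/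
inductive Reg (V A : Type) : Type
  | var (x : V) | arr (a : A) | bnd | idx | aux | tmp | lp | buf | res | inp
  deriving DecidableEq, Fintype

/-- The contents of the stacks of the evaluator, with counters given by their values. -/
structure Mem (V A : Type) where
  var : V → ℕ
  arr : A → List Bool
  bnd : ℕ
  idx : ℕ
  tmp : List Γ'
  lp : List Γ'
  buf : List Bool
  res : List Bool

variable {V A : Type}

/-- The stacks described by a `Mem`; the stacks `aux` and `inp` are empty. -/
def Mem.store (m : Mem V A) : Store (Reg V A)
  | .var x => List.replicate (m.var x) mark
  | .arr a => (m.arr a).map Γ'.bit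
  | .bnd => List.replicate m.bnd mark
  | .idx => List.replicate m.idx mark
  | .aux => []
  | .tmp => m.tmp
  | .lp => m.lp
  | .buf => m.buf.map Γ'.bit
  | .res => m.res.map Γ'.bit
  | .inp => []

/-- First-order formulas with variables in `V` and relation symbols in `A`: the atoms
`c + ∑ xs < ∑ ys` and `a(xs)`, negation, conjunction and quantification over the finite domain. -/
inductive Fml (V A : Type) : Type
  | lt (c : ℕ) (xs ys : List V) : Fml V A
  | rd (a : A) (xs : List V) : Fml V A
  | neg (φ : Fml V A) : Fml V A
  | and (φ ψ : Fml V A) : Fml V A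
  | ex (x : V) (φ : Fml V A) : Fml V A

/-- The position of the entry `xs` in a table over the domain `{0, …, B - 1}`: tuples are ordered
lexicographically. -/
def index (B : ℕ) (xs : List ℕ) : ℕ := xs.foldl (fun t x => t * B + x) 0

/-- The table `l` has the bit `true` at the entry `xs`. -/
def Holds (B : ℕ) (l : List Bool) (xs : List ℕ) : Prop := l.getD (index B xs) false = true

theorem replicate_cons_mark (n : ℕ) : mark :: List.replicate n mark = List.replicate (n + 1) mark :=
  List.replicate_succ.symm

namespace Mem

variable (m : Mem V A)

@[simp] theorem store_var (x : V) : m.store (.var x) = List.replicate (m.var x) mark := rfl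
@[simp] theorem store_arr (a : A) : m.store (.arr a) = (m.arr a).map Γ'.bit := rfl
@[simp] theorem store_bnd : m.store .bnd = List.replicate m.bnd mark := rfl
@[simp] theorem store_idx : m.store .idx = List.replicate m.idx mark := rfl
@[simp] theorem store_aux : m.store .aux = [] := rfl
@[simp] theorem store_tmp : m.store .tmp = m.tmp := rfl
@[simp] theorem store_lp : m.store .lp = m.lp := rfl
@[simp] theorem store_buf : m.store .buf = m.buf.map Γ'.bit := rfl
@[simp] theorem store_res : m.store .res = m.res.map Γ'.bit := rfl

variable [DecidableEq V] [DecidableEq A]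

theorem update_var (x : V) (n : ℕ) :
    update m.store (.var x) (List.replicate n mark) = { m with var := update m.var x n }.store := by
  funext k
  cases k with
  | var y => by_cases h : y = x <;> simp [store, h]
  | _ => simp [store]

theorem update_arr (a : A) (l : List Bool) :
    update m.store (.arr a) (l.map Γ'.bit) = { m with arr := update m.arr a l }.store := by
  funext k
  cases k with
  | arr y => by_cases h : y = a <;> simp [store, h]
  | _ => simp [store]

theorem update_idx (n : ℕ) :
    update m.store .idx (List.replicate n mark) = { m with idx := n }.store := by
  funext k; cases k <;> simp [store]

theorem update_bnd (n : ℕ) :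
    update m.store .bnd (List.replicate n mark) = { m with bnd := n }.store := by
  funext k; cases k <;> simp [store]

theorem update_tmp (l : List Γ') : update m.store .tmp l = { m with tmp := l }.store := by
  funext k; cases k <;> simp [store]

theorem update_lp (l : List Γ') : update m.store .lp l = { m with lp := l }.store := by
  funext k; cases k <;> simp [store]

theorem update_buf (l : List Bool) :
    update m.store .buf (l.map Γ'.bit) = { m with buf := l }.store := by
  funext k; cases k <;> simp [store]

theorem update_res (l : List Bool) :
    update m.store .res (l.map Γ'.bit) = { m with res := l }.store := by
  funext k; cases k <;> simp [store]

theorem update_arr_cons (a : A) (b : Bool) (l : List Bool) :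
    update m.store (.arr a) (Γ'.bit b :: l.map Γ'.bit) =
      { m with arr := update m.arr a (b :: l) }.store := update_arr m a (b :: l)

theorem update_buf_cons (b : Bool) (l : List Bool) :
    update m.store .buf (Γ'.bit b :: l.map Γ'.bit) = { m with buf := b :: l }.store :=
  update_buf m (b :: l)

theorem update_res_cons (b : Bool) (l : List Bool) :
    update m.store .res (Γ'.bit b :: l.map Γ'.bit) = { m with res := b :: l }.store :=
  update_res m (b :: l)

end Mem

variable [DecidableEq V] [DecidableEq A]

/-- Truth of a formula over the domain `{0, …, B - 1}`. -/
def Fml.Sat (B : ℕ) (s : A → List Bool) : Fml V A → (V → ℕ) → Prop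
  | .lt c xs ys, v => c + (xs.map v).sum < (ys.map v).sum
  | .rd a xs, v => Holds B (s a) (xs.map v)
  | .neg φ, v => ¬ φ.Sat B s v
  | .and φ ψ, v => φ.Sat B s v ∧ ψ.Sat B s v
  | .ex x φ, v => ∃ i < B, φ.Sat B s (update v x i)

/-- Push the sum of the counters `xs` on the counter `dst`. -/
def addAll (dst : Reg V A) : List V → Code (Reg V A)
  | [] => .nop
  | x :: xs => .seq (add (.var x) dst .aux) (addAll dst xs)

/-- Multiply the counter `idx` by the domain size. -/
def mulBnd : Code (Reg V A) :=
  .seq (.loop .idx yes fun _ => .push .tmp mark)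
    (.loop .tmp yes fun _ => add .bnd .idx .aux)

/-- Compute the position of a table entry on the counter `idx`. -/
def idxCode : List V → Code (Reg V A)
  | [] => .nop
  | x :: xs => .seq mulBnd (.seq (add (.var x) .idx .aux) (idxCode xs))

/-- Push `c` marks on the stack `k`. -/
def pushMarks {K : Type} (k : K) : ℕ → Code K
  | 0 => .nop
  | c + 1 => .seq (.push k mark) (pushMarks k c)

/-- Push the truth value of `c + ∑ xs < ∑ ys` on `res`: the two sides are built up on `idx` and `tmp`,
and marks are removed from both of them until `idx` is empty. -/
def ltCode (c : ℕ) (xs ys : List V) : Code (Reg V A) :=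
  .seq (pushMarks .idx c) <| .seq (addAll .idx xs) <| .seq (addAll .tmp ys) <|
  .seq (.loop .idx yes fun _ => .pop .tmp fun _ => .nop) <|
  .pop .tmp fun
    | none => .push .res (.bit false)
    | some _ => .seq (clear .tmp) (.push .res (.bit true))

/-- Push the entry `a(xs)` on `res`: as many entries as the index of `xs` says are moved from the
table to `tmp`, the next one is copied, and the entries on `tmp` are moved back. -/
def rdCode (a : A) (xs : List V) : Code (Reg V A) :=
  .seq (idxCode xs) <|
  .seq (.loop .idx yes fun _ => .pop (.arr a) fun
    | none => .nop
    | some c => .push .tmp c) <|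
  .seq (.pop (.arr a) fun
    | none => .push .res (.bit false)
    | some c => .seq (.push (.arr a) c) (.push .res c)) <|
  .loop .tmp yes fun c => .push (.arr a) c

/-- The test that recognizes the marks on the control stack. -/
abbrev notComma : Γ' → Bool := fun c => decide (c ≠ Γ'.comma)

/-- Run `P` once for each element of the domain. -/
def repeatCode (P : Code (Reg V A)) : Code (Reg V A) :=
  .seq (.push .lp .comma) <| .seq (add .bnd .lp .aux) <| .loop .lp notComma fun _ => P

/-- Run `P` with the values `0, …, B - 1` of the variable `x`; afterwards `x` is zero. -/
def forCode (x : V) (P : Code (Reg V A)) : Code (Reg V A) :=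
  .seq (repeatCode (.seq P (.push (.var x) mark))) (clear (.var x))

/-- The Boolean value of a symbol. -/
def bitVal : Option Γ' → Bool
  | some (.bit b) => b
  | _ => false

/-- Replace the topmost truth value by its image under `f`. -/
def mapRes (f : Bool → Bool) : Code (Reg V A) :=
  .pop .res fun c => .push .res (.bit (f (bitVal c)))

/-- Combine the two topmost truth values. -/
def map₂Res (f : Bool → Bool → Bool) : Code (Reg V A) :=
  .pop .res fun c => .pop .res fun c' => .push .res (.bit (f (bitVal c') (bitVal c)))

/-- Push the truth value of a formula on `res`. A quantifier saves the value of its variable on the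
control stack. -/
def Fml.code : Fml V A → Code (Reg V A)
  | .lt c xs ys => ltCode c xs ys
  | .rd a xs => rdCode a xs
  | .neg φ => .seq φ.code (mapRes Bool.not)
  | .and φ ψ => .seq φ.code (.seq ψ.code (map₂Res Bool.and))
  | .ex x φ =>
    .seq (.push .lp .comma) <| .seq (.loop (.var x) yes fun _ => .push .lp mark) <|
    .seq (.push .res (.bit false)) <|
    .seq (forCode x (.seq φ.code (map₂Res Bool.or))) <|
    .loop .lp notComma fun _ => .push (.var x) mark

/-! #### Correctness of the building blocks -/

theorem run_mapRes (f : Bool → Bool) (m : Mem V A) (b : Bool) (r : List Bool) :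
    Run (mapRes f) { m with res := b :: r }.store { m with res := f b :: r }.store 2 := by
  refine Run.pop (Run.push.congr rfl ?_)
  simp [bitVal, Mem.update_res_cons]

theorem run_map₂Res (f : Bool → Bool → Bool) (m : Mem V A) (b b' : Bool) (r : List Bool) :
    Run (map₂Res f) { m with res := b' :: b :: r }.store { m with res := f b b' :: r }.store 3 := by
  refine Run.pop (Run.pop (Run.push.congr rfl ?_))
  simp [bitVal, Mem.update_res_cons]

theorem run_pushMarks (m : Mem V A) (c : ℕ) :
    Run (pushMarks .idx c) m.store { m with idx := m.idx + c }.store (c + 1) := by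
  induction c generalizing m with
  | zero => exact Run.nop
  | succ c ih =>
    have h1 : Run (.push .idx mark) m.store { m with idx := m.idx + 1 }.store 1 := by
      refine Run.push.congr rfl ?_
      simp [replicate_cons_mark, Mem.update_idx]
    refine ((h1.seq (ih _)).congr rfl ?_).mono (by lia)
    simp [add_assoc, add_comm 1 c]

theorem run_add_idx (m : Mem V A) (x : V) :
    Run (add (.var x) .idx .aux) m.store { m with idx := m.idx + m.var x }.store
      (5 * m.var x + 2) := by
  refine (Run.add (by simp) (by simp) (by simp) (m.store_var x) m.store_aux).congr rfl ?_
  simp [Mem.update_idx, add_comm]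

theorem run_add_bnd_idx (m : Mem V A) :
    Run (add .bnd .idx .aux) m.store { m with idx := m.idx + m.bnd }.store (5 * m.bnd + 2) := by
  refine (Run.add (by simp) (by simp) (by simp) m.store_bnd m.store_aux).congr rfl ?_
  simp [Mem.update_idx, add_comm]

theorem run_add_tmp (m : Mem V A) (x : V) :
    Run (add (.var x) .tmp .aux) m.store
      { m with tmp := List.replicate (m.var x) mark ++ m.tmp }.store (5 * m.var x + 2) := by
  refine (Run.add (by simp) (by simp) (by simp) (m.store_var x) m.store_aux).congr rfl ?_
  simp [Mem.update_tmp]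

theorem run_addAll_idx (m : Mem V A) (B : ℕ) (hB : ∀ x, m.var x ≤ B) (xs : List V) :
    Run (addAll .idx xs) m.store { m with idx := m.idx + (xs.map m.var).sum }.store
      (xs.length * (5 * B + 2) + 1) := by
  induction xs generalizing m with
  | nil => simpa [addAll] using Run.nop
  | cons x xs ih =>
    have := (run_add_idx m x).seq (ih _ (by simpa using hB))
    refine (this.congr rfl ?_).mono ?_
    · simp [add_assoc]
    · have := hB x
      simp only [List.length_cons]
      linarith [Nat.add_mul xs.length 1 (5 * B + 2)]

theorem run_addAll_tmp (m : Mem V A) (B : ℕ) (hB : ∀ x, m.var x ≤ B) (xs : List V) (n : ℕ)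
    (hm : m.tmp = List.replicate n mark) :
    Run (addAll .tmp xs) m.store
      { m with tmp := List.replicate (n + (xs.map m.var).sum) mark }.store
      (xs.length * (5 * B + 2) + 1) := by
  induction xs generalizing m n with
  | nil => simpa [addAll, ← hm] using Run.nop
  | cons x xs ih =>
    have := (run_add_tmp m x).seq (ih { m with tmp := List.replicate (m.var x) mark ++ m.tmp }
      (by simpa using hB) (m.var x + n) (by simp [hm]))
    refine (this.congr rfl ?_).mono ?_
    · simp [add_assoc, add_left_comm]
    · have := hB x
      simp only [List.length_cons]
      linarith [Nat.add_mul xs.length 1 (5 * B + 2)]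

theorem run_ltCode (m : Mem V A) (hi : m.idx = 0) (ht : m.tmp = []) (B : ℕ)
    (hB : ∀ x, m.var x ≤ B) (c : ℕ) (xs ys : List V) :
    Run (ltCode c xs ys) m.store
      { m with res := decide (c + (xs.map m.var).sum < (ys.map m.var).sum) :: m.res }.store
      (4 * c + 30 * (xs.length + ys.length + 1) * (B + 1)) := by
  have a₁ := run_pushMarks m c
  have a₂ := run_addAll_idx { m with idx := m.idx + c } B hB xs
  have a₃ := run_addAll_tmp { m with idx := m.idx + c + (xs.map m.var).sum } B hB ys 0 ht
  have sum_le : ∀ l : List V, (l.map m.var).sum ≤ l.length * B := by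
    intro l
    induction l with
    | nil => simp
    | cons x l ih =>
      have := hB x
      simp only [List.map_cons, List.sum_cons, List.length_cons]
      linarith [Nat.add_mul l.length 1 B]
  have hx := sum_le xs
  have hy := sum_le ys
  generalize hX : c + (xs.map m.var).sum = X at *
  generalize hY : (ys.map m.var).sum = Y at *
  have e₁ : m.idx + c + (xs.map m.var).sum = X := by lia
  simp only [e₁, zero_add] at a₂ a₃
  have a₄ := Run.count (k := Reg.idx) (f := yes) (T := 2) (r := [])
    (P := fun _ => .pop .tmp fun _ => .nop)
    (fun i => { m with idx := i, tmp := List.replicate (Y - (X - i)) mark }.store) X rfl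
    (by simp) (by simp) (by
      intro i hi
      refine Run.pop (Run.nop.congr rfl ?_)
      simp only [List.append_nil, Mem.update_idx, Mem.update_tmp, Mem.store_tmp,
        List.tail_replicate]
      congr 3
      lia)
  have a₅ : Run (Code.pop Reg.tmp fun
      | none => .push .res (.bit false)
      | some _ => .seq (clear .tmp) (.push .res (.bit true)))
      { m with idx := 0, tmp := List.replicate (Y - X) mark }.store
      { m with res := decide (X < Y) :: m.res }.store (2 * Y + 4) := by
    by_cases h : X < Y
    · obtain ⟨d, hd⟩ : ∃ d, Y - X = d + 1 := ⟨Y - X - 1, by lia⟩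
      refine (Run.pop ?_ (T := 2 * Y + 3))
      simp only [hd, Mem.store_tmp, List.replicate_succ, List.head?_cons, List.tail_cons]
      refine ((Run.clear.seq Run.push).mono ?_).congr rfl ?_
      · simp; lia
      · simp only [Mem.update_tmp, Mem.store_res, Mem.update_res_cons]
        simp [h, hi, ht]
    · refine (Run.pop ?_ (T := 1)).mono (by lia)
      have : Y - X = 0 := by lia
      simp only [this, Mem.store_tmp, List.replicate_zero, List.head?_nil, List.tail_nil]
      refine Run.push.congr rfl ?_
      simp only [Mem.update_tmp, Mem.store_res, Mem.update_res_cons]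
      simp [h, hi, ht]
  refine (a₁.seq (a₂.seq (a₃.seq ((a₄.congr ?_ ?_).seq a₅)))).mono ?_
  · simp
  · simp
  · nlinarith

end StackCode

namespace StackCode

open Computability (Γ')
open Function (update)

variable {V A : Type} [DecidableEq V] [DecidableEq A]

theorem pow_add_pow_le {N : ℕ} (hN : 2 ≤ N) (a b : ℕ) : N ^ a + N ^ b ≤ N ^ (a + b + 1) := by
  have h1 : N ^ a ≤ N ^ (a + b) := Nat.pow_le_pow_right (by lia) (by lia)
  have h2 : N ^ b ≤ N ^ (a + b) := Nat.pow_le_pow_right (by lia) (by lia)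
  calc N ^ a + N ^ b ≤ N ^ (a + b) * 2 := by lia
    _ ≤ N ^ (a + b) * N := Nat.mul_le_mul_left _ hN
    _ = _ := (pow_succ _ _).symm

theorem le_pow_self' {N : ℕ} (hN : 2 ≤ N) (c : ℕ) : c ≤ N ^ c := (Nat.lt_pow_self hN).le

theorem run_mulBnd (m : Mem V A) (ht : m.tmp = []) :
    Run mulBnd m.store { m with idx := m.idx * m.bnd }.store (m.idx * (5 * m.bnd + 5) + 2) := by
  have a₁ := Run.count (k := Reg.idx) (f := yes) (T := 1) (r := [])
    (P := fun _ => Code.push .tmp mark)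
    (fun i => { m with idx := i, tmp := List.replicate (m.idx - i) mark }.store) m.idx rfl
    (by intro i; simp) (by simp) (by
      intro i hi
      refine Run.push.congr rfl ?_
      simp only [List.append_nil, Mem.update_idx, Mem.store_tmp, Mem.update_tmp,
        replicate_cons_mark]
      congr 3
      lia)
  have a₂ := Run.count (k := Reg.tmp) (f := yes) (T := 5 * m.bnd + 2) (r := [])
    (P := fun _ => add .bnd .idx .aux)
    (fun i => { m with idx := (m.idx - i) * m.bnd, tmp := List.replicate i mark }.store) m.idx rfl
    (by intro i; simp) (by simp) (by
      intro i hi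
      simp only [List.append_nil, Mem.update_tmp]
      refine (run_add_bnd_idx { m with
        idx := (m.idx - (i + 1)) * m.bnd
        tmp := List.replicate i mark }).congr rfl ?_
      congr 2
      simp only
      obtain ⟨j, hj⟩ : ∃ j, m.idx - i = j + 1 := ⟨m.idx - i - 1, by lia⟩
      rw [hj, Nat.add_mul, one_mul]
      congr 2
      lia)
  refine ((a₁.congr ?_ ?_).seq (a₂.congr rfl ?_)).mono ?_
  · simp [← ht]
  · simp
  · simp [Mem.update_tmp, ht]
  · nlinarith

theorem run_idxCode (N : ℕ) (xs : List V) (m : Mem V A) (ht : m.tmp = []) (hN : m.bnd + 2 ≤ N)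
    (hv : ∀ x, m.var x ≤ m.bnd) (j : ℕ) (hj : m.idx + 1 ≤ N ^ j) :
    Run (idxCode xs) m.store
      { m with idx := (xs.map m.var).foldl (fun t x => t * m.bnd + x) m.idx }.store
      (xs.length * (20 * N ^ (j + xs.length + 1)) + 1) ∧
    (xs.map m.var).foldl (fun t x => t * m.bnd + x) m.idx + 1 ≤ N ^ (j + xs.length) := by
  induction xs generalizing m j with
  | nil => exact ⟨by simpa [idxCode] using Run.nop, by simpa using hj⟩
  | cons x xs ih =>
    have hx := hv x
    have hj' : m.idx * m.bnd + m.var x + 1 ≤ N ^ (j + 1) := by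
      rw [pow_succ]
      nlinarith
    obtain ⟨h1, h2⟩ := ih { m with idx := m.idx * m.bnd + m.var x } ht hN hv (j + 1) hj'
    refine ⟨((run_mulBnd m ht).seq ((run_add_idx _ x).seq h1)).mono ?_, ?_⟩
    · simp only [List.length_cons]
      have e : j + 1 + xs.length + 1 = j + (xs.length + 1) + 1 := by lia
      rw [e, add_mul, one_mul]
      have h3 : N ^ (j + 1) ≤ N ^ (j + (xs.length + 1) + 1) :=
        Nat.pow_le_pow_right (by lia) (by lia)
      have h4 : m.idx * (5 * m.bnd + 5) + 2 + (5 * m.var x + 2) ≤ 20 * N ^ (j + 1) := by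
        rw [pow_succ]
        nlinarith
      lia
    · simp only [List.length_cons, List.map_cons, List.foldl_cons]
      rwa [show j + (xs.length + 1) = j + 1 + xs.length by lia]

theorem run_rdCode (N : ℕ) (a : A) (xs : List V) (m : Mem V A) (hi : m.idx = 0)
    (ht : m.tmp = []) (hN : m.bnd + 2 ≤ N) (hv : ∀ x, m.var x ≤ m.bnd) :
    Run (rdCode a xs) m.store
      { m with res := (m.arr a).getD (index m.bnd (xs.map m.var)) false :: m.res }.store
      ((20 * xs.length + 20) * N ^ (xs.length + 1)) := by
  obtain ⟨h1, h2⟩ := run_idxCode N xs m ht hN hv 0 (by simp [hi])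
  rw [hi] at h1 h2
  change (index m.bnd (xs.map m.var)) + 1 ≤ _ at h2
  change Run _ _ { m with idx := (index m.bnd (xs.map m.var)) }.store _ at h1
  generalize index m.bnd (xs.map m.var) = n at *
  set L := m.arr a with hL
  -- `a₁` moves the first `n` entries to `tmp`, `a₂` copies the next entry, `a₃` moves them back.
  have a₁ := Run.count (k := Reg.idx) (f := yes) (T := 2) (r := [])
    (P := fun _ => Code.pop (.arr a) fun | none => .nop | some c => .push .tmp c)
    (fun i => { m with
      idx := i
      arr := update m.arr a (L.drop (n - i))
      tmp := (L.take (n - i)).reverse.map Γ'.bit }.store) n rfl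
    (by intro i; simp) (by simp) (by
      intro i hi
      simp only [List.append_nil, Mem.update_idx]
      refine Run.pop ?_
      obtain ⟨j, hj, hj'⟩ : ∃ j, n - i = j + 1 ∧ n - (i + 1) = j := ⟨n - i - 1, by lia, by lia⟩
      simp only [hj, hj', Mem.store_arr, Function.update_self]
      rcases hd : L[j]? with _ | b
      · have hlen : L.length ≤ j := by simpa using hd
        simp only [List.drop_eq_nil_of_le hlen, List.drop_eq_nil_of_le (hlen.trans (Nat.le_succ j)),
          List.take_of_length_le hlen, List.take_of_length_le (hlen.trans (Nat.le_succ j))]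
        refine Run.nop.congr rfl ?_
        simp
      · have hlen : j < L.length := by
          by_contra h
          simp [List.getElem?_eq_none (not_lt.mp h)] at hd
        have hb : L[j] = b := by simpa [List.getElem?_eq_getElem hlen] using hd
        simp only [List.drop_eq_getElem_cons hlen, hb, List.map_cons, List.head?_cons,
          List.tail_cons]
        refine Run.push.congr rfl ?_
        simp only [Mem.update_arr, Mem.store_tmp, Mem.update_tmp, Function.update_idem]
        simp [List.take_add_one, hd])
  have a₂ : Run (Code.pop (Reg.arr a) fun
      | none => .push .res (.bit false)
      | some c => .seq (.push (.arr a) c) (.push .res c))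
      { m with
        arr := update m.arr a (L.drop n)
        tmp := (L.take n).reverse.map Γ'.bit }.store
      { m with
        res := L.getD n false :: m.res
        arr := update m.arr a (L.drop n)
        tmp := (L.take n).reverse.map Γ'.bit }.store 3 := by
    refine Run.pop ?_
    simp only [Mem.store_arr, Function.update_self]
    rcases hd : L[n]? with _ | b
    · have hlen : L.length ≤ n := by simpa using hd
      simp only [List.drop_eq_nil_of_le hlen]
      refine (Run.push.congr rfl ?_).mono one_le_two
      have := Mem.update_arr { m with
          arr := update m.arr a []
          tmp := (L.take n).reverse.map Γ'.bit } a []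
      rw [List.map_nil] at this
      simp only [List.map_nil, List.tail_nil, this, Mem.store_res, Mem.update_res_cons,
        Function.update_idem]
      simp [hlen]
    · have hlen : n < L.length := by
        by_contra h
        simp [List.getElem?_eq_none (not_lt.mp h)] at hd
      have hb : L[n] = b := by simpa [List.getElem?_eq_getElem hlen] using hd
      simp only [List.drop_eq_getElem_cons hlen, hb, List.map_cons, List.head?_cons,
          List.tail_cons]
      refine (Run.push.seq Run.push).congr rfl ?_
      simp only [Mem.update_arr, Mem.update_arr_cons, Mem.store_res,
        Mem.update_res_cons, Function.update_self, Function.update_idem]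
      simp [hlen, hb]
  have a₃ := Run.loop (k := Reg.tmp) (f := yes) (T := 1) (r := [])
    (P := fun c => Code.push (.arr a) c)
    (fun l => update (update { m with res := L.getD n false :: m.res }.store .tmp l) (.arr a)
      ((((L.take n).reverse.map Γ'.bit).take (n ⊓ L.length - l.length)).reverse ++
        (L.drop n).map Γ'.bit))
    ((L.take n).reverse.map Γ'.bit) (by simp) (by simp) (by simp) (by
      rintro c l' ⟨l'', h⟩
      refine Run.push.congr rfl ?_
      have hl := congrArg List.length h
      simp only [List.length_append, List.length_cons, List.length_map, List.length_reverse,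
        List.length_take] at hl
      rw [← h]
      have e1 : n ⊓ L.length - (c :: l').length = l''.length := by
        simp only [List.length_cons]; lia
      have e2 : n ⊓ L.length - l'.length = (l'' ++ [c]).length := by
        simp only [List.length_append, List.length_cons, List.length_nil]; lia
      rw [e1, e2, List.take_left, show l'' ++ c :: l' = (l'' ++ [c]) ++ l' by simp, List.take_left]
      funext k
      simp only [Function.update_apply]
      grind)
  refine (h1.seq ((a₁.congr ?_ ?_).seq (a₂.seq (a₃.congr ?_ ?_)))).mono ?_
  · simp [hL, ← ht]
  · simp [hi]
  · simp only [List.length_map, List.length_reverse, List.length_take, Nat.sub_self, List.take_zero,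
      List.reverse_nil, List.nil_append, Mem.update_tmp, Mem.update_arr]
  · have e : ((((L.take n).reverse.map Γ'.bit).take (n ⊓ L.length - 0)).reverse ++
        (L.drop n).map Γ'.bit) = L.map Γ'.bit := by
      rw [List.take_of_length_le (by simp), ← List.map_reverse, List.reverse_reverse,
        ← List.map_append, List.take_append_drop]
    simp only [List.length_nil, e, List.tail_nil, Mem.update_tmp, Mem.update_arr]
    simp [hL, ← ht]
  · simp only [List.length_map, List.length_reverse, List.length_take]
    have h3 : n + 1 ≤ N ^ (xs.length + 1) :=
      (by simpa using h2 : n + 1 ≤ N ^ xs.length).trans (Nat.pow_le_pow_right (by lia) (by lia))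
    have : min n L.length ≤ n := min_le_left _ _
    simp only [zero_add]
    nlinarith

theorem run_repeatCode {P : Code (Reg V A)} {B T : ℕ} {w : List Γ'} (μ : ℕ → Mem V A)
    (hB : ∀ i, (μ i).bnd = B) (hw : ∀ i, (μ i).lp = w)
    (h : ∀ i < B, ∀ w', Run P { μ i with lp := w' }.store { μ (i + 1) with lp := w' }.store T) :
    Run (repeatCode P) (μ 0).store (μ B).store (B * (T + 6) + 4) := by
  have a₁ : Run (.push .lp Γ'.comma) (μ 0).store { μ 0 with lp := Γ'.comma :: w }.store 1 := by
    refine Run.push.congr rfl ?_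
    simp [Mem.update_lp, hw]
  have a₂ : Run (add .bnd .lp .aux) { μ 0 with lp := Γ'.comma :: w }.store
      { μ 0 with lp := List.replicate B mark ++ Γ'.comma :: w }.store (5 * B + 2) := by
    refine (Run.add (by simp) (by simp) (by simp) (m := B) (by simp [hB]) rfl).congr rfl ?_
    simp [Mem.update_lp]
  have a₃ := Run.count (k := Reg.lp) (f := notComma) (T := T) (r := Γ'.comma :: w)
    (P := fun _ => P)
    (fun i => { μ (B - i) with lp := List.replicate i mark ++ Γ'.comma :: w }.store) B rfl
    (by simp) (by simp) (by
      intro i hi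
      simp only [Mem.update_lp]
      have := h (B - (i + 1)) (by lia) (List.replicate i mark ++ Γ'.comma :: w)
      rwa [show B - (i + 1) + 1 = B - i by lia] at this)
  refine (a₁.seq (a₂.seq (a₃.congr ?_ ?_))).mono (by lia)
  · simp
  · simp [Mem.update_lp, ← hw B]

theorem run_forCode {x : V} {P : Code (Reg V A)} {B T : ℕ} {w : List Γ'} (μ : ℕ → Mem V A)
    (hB : ∀ i, (μ i).bnd = B) (hw : ∀ i, (μ i).lp = w) (hx : ∀ i, (μ i).var x = i)
    (h : ∀ i < B, ∀ w', Run P { μ i with lp := w' }.store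
      { μ (i + 1) with lp := w', var := update (μ (i + 1)).var x i }.store T) :
    Run (forCode x P) (μ 0).store { μ B with var := update (μ B).var x 0 }.store
      (B * (T + 9) + 5) := by
  have a₁ := run_repeatCode (P := .seq P (.push (.var x) mark)) (T := T + 1) μ hB hw (by
    intro i hi w'
    refine (h i hi w').seq (Run.push.congr rfl ?_)
    simp only [Mem.store_var, Function.update_self, replicate_cons_mark, Mem.update_var,
      Function.update_idem]
    congr 2
    funext y
    by_cases hy : y = x
    · subst hy; simp [hx]
    · simp [hy])
  refine (a₁.seq (Run.clear.congr rfl ?_)).mono ?_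
  · exact Mem.update_var _ x 0
  · simp only [Mem.store_var, List.length_replicate, hx]
    lia

open Classical in
/-- A formula is evaluated in polynomial time. -/
theorem Fml.run (φ : Fml V A) : ∃ d, ∀ (N : ℕ) (m : Mem V A), m.idx = 0 → m.tmp = [] →
    m.bnd + 2 ≤ N → (∀ x, m.var x ≤ m.bnd) →
    Run φ.code m.store { m with res := decide (φ.Sat m.bnd m.arr m.var) :: m.res }.store
      (N ^ d) := by
  induction φ with
  | lt c xs ys =>
    refine ⟨4 * c + (30 * (xs.length + ys.length + 1) + 1) + 1, fun N m hi ht hN hv => ?_⟩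
    refine ((run_ltCode m hi ht m.bnd hv c xs ys).congr rfl ?_).mono ?_
    · simp only [Fml.Sat]
      congr!
      exact decide_eq_decide.2 Iff.rfl
    · refine le_trans ?_ (pow_add_pow_le (by lia) _ _)
      have h1 := le_pow_self' (N := N) (by lia) (4 * c)
      have h2 := le_pow_self' (N := N) (by lia) (30 * (xs.length + ys.length + 1))
      rw [pow_succ N (30 * _)]
      gcongr
      lia
  | rd a xs =>
    refine ⟨(20 * xs.length + 20) + (xs.length + 1), fun N m hi ht hN hv => ?_⟩
    refine ((run_rdCode N a xs m hi ht hN hv).congr rfl ?_).mono ?_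
    · simp only [Fml.Sat, Holds]
      simp
    · have h1 := le_pow_self' (N := N) (by lia) (20 * xs.length + 20)
      rw [pow_add N (20 * _ + 20)]
      gcongr
  | neg φ ih =>
    obtain ⟨d, ih⟩ := ih
    refine ⟨d + 2 + 1, fun N m hi ht hN hv => ?_⟩
    refine (((ih N m hi ht hN hv).seq (run_mapRes _ _ _ _)).congr rfl ?_).mono ?_
    · by_cases h : φ.Sat m.bnd m.arr m.var <;> simp [Fml.Sat, h]
    · exact le_trans (by gcongr; exact le_pow_self' (by lia) 2) (pow_add_pow_le (by lia) d 2)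
  | and φ ψ ih₁ ih₂ =>
    obtain ⟨d₁, ih₁⟩ := ih₁
    obtain ⟨d₂, ih₂⟩ := ih₂
    refine ⟨d₁ + (d₂ + 3 + 1) + 1, fun N m hi ht hN hv => ?_⟩
    refine (((ih₁ N m hi ht hN hv).seq ((ih₂ N { m with
      res := decide (φ.Sat m.bnd m.arr m.var) :: m.res } hi ht hN hv).seq (run_map₂Res _ _ _ _ _))).congr
      rfl ?_).mono ?_
    · by_cases h : φ.Sat m.bnd m.arr m.var <;> by_cases h' : ψ.Sat m.bnd m.arr m.var <;>
        simp [Fml.Sat, h, h']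
    · exact le_trans (by
        gcongr
        exact le_trans (by gcongr; exact le_pow_self' (by lia) 3) (pow_add_pow_le (by lia) d₂ 3))
        (pow_add_pow_le (by lia) d₁ (d₂ + 3 + 1))
  | ex x φ ih =>
    obtain ⟨d, ih⟩ := ih
    refine ⟨d + 30, fun N m hi ht hN hv => ?_⟩
    have hvx : ∀ i ≤ m.bnd, ∀ y, update m.var x i y ≤ m.bnd := by
      intro i hi y
      by_cases hy : y = x
      · subst hy; simpa
      · simpa [hy] using hv y
    have a₁ : Run (.push .lp Γ'.comma) m.store { m with lp := Γ'.comma :: m.lp }.store 1 := by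
      refine Run.push.congr rfl ?_
      simp [Mem.update_lp]
    have a₂ := Run.count (k := Reg.var x) (f := yes) (T := 1) (r := [])
      (P := fun _ => Code.push (Reg.lp : Reg V A) mark)
      (fun i => { m with
        var := update m.var x i
        lp := List.replicate (m.var x - i) mark ++ Γ'.comma :: m.lp }.store) (m.var x) rfl
      (by simp) (by simp) (by
        intro i hi
        refine Run.push.congr rfl ?_
        simp only [List.append_nil, Mem.update_var, Mem.store_lp, Mem.update_lp,
          Function.update_idem, ← List.cons_append, replicate_cons_mark]
        congr 4
        lia)
    set w := List.replicate (m.var x) mark ++ Γ'.comma :: m.lp with hw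
    have a₃ : Run (.push .res (Γ'.bit false)) { m with var := update m.var x 0, lp := w }.store
        { m with var := update m.var x 0, lp := w, res := false :: m.res }.store 1 := by
      refine Run.push.congr rfl ?_
      simp [Mem.update_res_cons]
    have a₄ := run_forCode (x := x) (P := .seq φ.code (map₂Res Bool.or)) (B := m.bnd)
      (T := N ^ d + 3) (w := w) (fun i => { m with
        var := update m.var x i
        lp := w
        res := decide (∃ j < i, φ.Sat m.bnd m.arr (update m.var x j)) :: m.res })
      (fun _ => rfl) (fun _ => rfl) (by simp) (by
        intro i hi' w'
        have b := ih N { m with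
          var := update m.var x i
          lp := w'
          res := decide (∃ j < i, φ.Sat m.bnd m.arr (update m.var x j)) :: m.res } hi ht hN
          (hvx i hi'.le)
        refine (b.seq (run_map₂Res _ _ _ _ _)).congr rfl ?_
        simp only [Function.update_idem]
        congr 3
        rw [← Bool.decide_or]
        congr 1
        simp only [Nat.lt_succ_iff_lt_or_eq, or_and_right, exists_or, exists_eq_left])
    have a₅ := Run.count (k := Reg.lp) (f := notComma) (T := 1) (r := Γ'.comma :: m.lp)
      (P := fun _ => Code.push (Reg.var x : Reg V A) mark)
      (fun i => { m with
        var := update m.var x (m.var x - i)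
        lp := List.replicate i mark ++ Γ'.comma :: m.lp
        res := decide ((Fml.ex x φ).Sat m.bnd m.arr m.var) :: m.res }.store) (m.var x) rfl
      (by simp) (by simp) (by
        intro i hi
        refine Run.push.congr rfl ?_
        simp only [Mem.update_lp, Mem.store_var, Function.update_self, replicate_cons_mark,
          Mem.update_var, Function.update_idem]
        congr 3
        lia)
    refine (a₁.seq ((a₂.congr ?_ ?_).seq (a₃.seq ((a₄.congr ?_ rfl).seq (a₅.congr ?_ ?_))))).mono ?_
    · simp
    · simp [hw]
    · simp
    · simp only [Fml.Sat, Nat.sub_self, Function.update_idem, hw]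
      congr!
      exact decide_eq_decide.2 Iff.rfl
    · simp [Mem.update_lp]
    · have h1 := hv x
      have h2 : 1 ≤ N ^ d := Nat.one_le_pow _ _ (by lia)
      have h3 : N * N ^ d ≤ N ^ (d + 1) := by rw [pow_succ, mul_comm]
      have h4 : 1 + (m.var x * (1 + 1) + 1 + (1 + (m.bnd * (N ^ d + 3 + 9) + 5 +
          (m.var x * (1 + 1) + 1)))) ≤ 29 * N ^ (d + 1) := by
        have h5 : m.bnd * N ^ d ≤ N * N ^ d := Nat.mul_le_mul_right _ (by lia)
        have h6 : N ≤ N * N ^ d := Nat.le_mul_of_pos_right _ (by lia)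
        lia
      refine h4.trans ?_
      rw [show d + 30 = 29 + (d + 1) by lia, pow_add N 29]
      exact Nat.mul_le_mul_right _ (le_pow_self' (by lia) 29)

end StackCode

namespace StackCode

open Computability (Γ')
open Function (update)

variable {V A : Type} [DecidableEq V]

/-! ### Programs that compute tables -/

/-- Programs on tables: `defn a xs φ` replaces the table `a` by the relation
`{xs | φ}`, and `rep P` runs `P` as often as the domain has elements. -/
inductive Prog (V A : Type) : Type
  | defn (a : A) (xs : List V) (φ : Fml V A) : Prog V A
  | seq (P Q : Prog V A) : Prog V A
  | rep (P : Prog V A) : Prog V A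

open Classical in
/-- The table of the relation `{xs | φ}`, the other variables having the values `v`. -/
noncomputable def table (B : ℕ) (s : A → List Bool) (φ : Fml V A) :
    List V → (V → ℕ) → List Bool
  | [], v => [decide (φ.Sat B s v)]
  | x :: xs, v => (List.range B).flatMap fun i => table B s φ xs (update v x i)

/-- The effect of a program on the tables. -/
noncomputable def Prog.run [DecidableEq A] (B : ℕ) : Prog V A → (A → List Bool) → (A → List Bool)
  | .defn a xs φ, s => update s a (table B s φ xs fun _ => 0)
  | .seq P Q, s => Q.run B (P.run B s)
  | .rep P, s => (P.run B)^[B] s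

/-- The variables in the head of each definition are distinct. -/
def Prog.Ok : Prog V A → Prop
  | .defn _ xs _ => xs.Nodup
  | .seq P Q => P.Ok ∧ Q.Ok
  | .rep P => P.Ok

/-- Push the entries of a table on `buf`, in lexicographic order. -/
def tableCode (φ : Fml V A) : List V → Code (Reg V A)
  | [] => .seq φ.code (.pop .res fun c => .push .buf (.bit (bitVal c)))
  | x :: xs => forCode x (tableCode φ xs)

/-- The implementation of a program on tables. -/
def Prog.code : Prog V A → Code (Reg V A)
  | .defn a xs φ =>
    .seq (tableCode φ xs) (.seq (clear (.arr a)) (.loop .buf yes fun c => .push (.arr a) c))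
  | .seq P Q => .seq P.code Q.code
  | .rep P => repeatCode P.code

theorem length_flatMap_const {α β : Type*} (l : List α) (f : α → List β) (n : ℕ)
    (h : ∀ x ∈ l, (f x).length = n) : (l.flatMap f).length = l.length * n := by
  induction l with
  | nil => simp
  | cons x l ih =>
    rw [List.flatMap_cons, List.length_append, h x List.mem_cons_self,
      ih fun y hy => h y (List.mem_cons_of_mem _ hy), List.length_cons]
    lia

theorem length_table (B : ℕ) (s : A → List Bool) (φ : Fml V A) (xs : List V) (v : V → ℕ) :
    (table B s φ xs v).length = B ^ xs.length := by
  induction xs generalizing v with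
  | nil => simp [table]
  | cons x xs ih =>
    rw [table, length_flatMap_const _ _ (B ^ xs.length) fun i _ => ih _]
    simp [pow_succ, mul_comm]

variable [DecidableEq A]

theorem run_tableCode (φ : Fml V A) (xs : List V) : ∃ d, ∀ (N : ℕ) (m : Mem V A), m.idx = 0 →
    m.tmp = [] → m.bnd + 2 ≤ N → (∀ x, m.var x ≤ m.bnd) → (∀ x ∈ xs, m.var x = 0) → xs.Nodup →
    Run (tableCode φ xs) m.store
      { m with buf := (table m.bnd m.arr φ xs m.var).reverse ++ m.buf }.store (N ^ d) := by
  classical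
  induction xs with
  | nil =>
    obtain ⟨d, h⟩ := φ.run
    refine ⟨d + 2 + 1, fun N m hi ht hN hv _ _ => ?_⟩
    have a : Run (Code.pop Reg.res fun c => .push .buf (.bit (bitVal c)))
        { m with res := decide (φ.Sat m.bnd m.arr m.var) :: m.res }.store
        { m with buf := (table m.bnd m.arr φ [] m.var).reverse ++ m.buf }.store 2 := by
      refine Run.pop (Run.push.congr rfl ?_)
      simp [bitVal, table, Mem.update_res, Mem.update_buf_cons]
    exact ((h N m hi ht hN hv).seq a).mono
      (le_trans (by gcongr; exact le_pow_self' (by lia) 2) (pow_add_pow_le (by lia) d 2))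
  | cons x xs ih =>
    obtain ⟨d, ih⟩ := ih
    refine ⟨d + 20, fun N m hi ht hN hv hz hnd => ?_⟩
    have hx : m.var x = 0 := hz x List.mem_cons_self
    have hux : update m.var x 0 = m.var := by
      rw [← hx]; simp
    have a := run_forCode (x := x) (P := tableCode φ xs) (B := m.bnd)
      (T := N ^ d) (w := m.lp) (fun i => { m with
        var := update m.var x i
        buf := ((List.range i).flatMap fun j => table m.bnd m.arr φ xs (update m.var x j)).reverse
          ++ m.buf })
      (fun _ => rfl) (fun _ => rfl) (by simp) (by
        intro i hi' w'
        have b := ih N { m with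
          var := update m.var x i
          buf := ((List.range i).flatMap fun j =>
            table m.bnd m.arr φ xs (update m.var x j)).reverse ++ m.buf
          lp := w' } hi ht hN (by
            intro y
            by_cases hy : y = x
            · subst hy; simpa using hi'.le
            · simpa [hy] using hv y) (by
            intro y hy
            have hyx : y ≠ x := fun h => (List.nodup_cons.1 hnd).1 (h ▸ hy)
            simpa [hyx] using hz y (List.mem_cons_of_mem _ hy)) (List.nodup_cons.1 hnd).2
        refine b.congr rfl ?_
        simp [List.range_succ])
    refine (a.congr ?_ ?_).mono ?_
    · simp [hux]
    · simp [hux, table]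
    · have h2 : 1 ≤ N ^ d := Nat.one_le_pow _ _ (by lia)
      have h3 : N * N ^ d = N ^ (d + 1) := by rw [pow_succ, mul_comm]
      have h4 : m.bnd * (N ^ d + 9) + 5 ≤ 19 * N ^ (d + 1) := by nlinarith
      refine h4.trans ?_
      rw [show d + 20 = 19 + (d + 1) by lia, pow_add N 19]
      exact Nat.mul_le_mul_right _ (le_pow_self' (by lia) 19)

/-- The memory between two statements of a program. -/
def base (B : ℕ) (s : A → List Bool) (w : List Γ') : Mem V A where
  var _ := 0
  arr := s
  bnd := B
  idx := 0
  tmp := []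
  lp := w
  buf := []
  res := []

/-- A program on tables is executed in polynomial time, and the tables remain of polynomial size. -/
theorem Prog.run_code (P : Prog V A) (hP : P.Ok) : ∃ D₀, ∀ D ≥ D₀, ∃ d,
    ∀ (N B : ℕ) (s : A → List Bool) (w : List Γ'), B + 2 ≤ N → (∀ a, (s a).length ≤ N ^ D) →
      Run P.code (base B s w).store (base B (P.run B s) w).store (N ^ d) ∧
        ∀ a, (P.run B s a).length ≤ N ^ D := by
  induction P with
  | defn a xs φ =>
    obtain ⟨d, h⟩ := run_tableCode φ xs
    refine ⟨xs.length, fun D hD => ⟨d + (D + 10) + 1, fun N B s w hN hs => ⟨?_, ?_⟩⟩⟩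
    · set L := table B s φ xs fun _ => 0 with hL
      have hlen : L.length ≤ N ^ D := by
        rw [hL, length_table]
        exact (Nat.pow_le_pow_left (by lia) _).trans (Nat.pow_le_pow_right (by lia) hD)
      have a₁ := h N (base B s w) rfl rfl hN (fun _ => Nat.zero_le _) (fun _ _ => rfl) hP
      have a₂ : Run (clear (.arr a)) { (base B s w : Mem V A) with buf := L.reverse }.store
          { (base B s w : Mem V A) with buf := L.reverse, arr := update s a [] }.store
          (2 * N ^ D + 1) := by
        refine (Run.clear.congr rfl ?_).mono ?_
        · exact Mem.update_arr _ a []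
        · have := hs a
          simpa [base] using this
      have a₃ := Run.loop (k := Reg.buf) (f := yes) (T := 1) (r := [])
        (P := fun c => Code.push (.arr a) c)
        (fun l => update (update (base B s w : Mem V A).store .buf l) (.arr a)
          ((L.drop l.length).map Γ'.bit)) (L.reverse.map Γ'.bit) (by simp) (by simp) (by simp) (by
          rintro c l' ⟨l'', h⟩
          refine Run.push.congr rfl ?_
          have h' : L.map Γ'.bit = l'.reverse ++ (c :: l''.reverse) := by
            have := congrArg List.reverse h
            simpa using this.symm
          have e1 : (L.drop (c :: l').length).map Γ'.bit = l''.reverse := by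
            rw [List.map_drop, h', show l'.reverse ++ (c :: l''.reverse) =
              (l'.reverse ++ [c]) ++ l''.reverse by simp, List.drop_left' (by simp)]
          have e2 : (L.drop l'.length).map Γ'.bit = c :: l''.reverse := by
            rw [List.map_drop, h', List.drop_left' (by simp)]
          rw [e1, e2]
          funext k
          simp only [Function.update_apply]
          grind)
      refine ((a₁.congr rfl ?_).seq (a₂.seq (a₃.congr ?_ ?_))).mono ?_
      · simp [base, hL]
      · have e := Mem.update_arr { (base B s w : Mem V A) with buf := L.reverse } a []
        have e' : update (base B s w : Mem V A).store .buf (List.map Γ'.bit L.reverse) =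
          { (base B s w : Mem V A) with buf := L.reverse }.store := Mem.update_buf _ _
        rw [e']
        simp only [List.length_map, List.length_reverse, List.drop_length]
        exact e
      · have e' : update (base B s w : Mem V A).store .buf [] = (base B s w : Mem V A).store :=
          Mem.update_buf _ []
        simp only [List.length_nil, List.drop_zero, e', List.tail_nil, Mem.update_arr]
        exact Mem.update_buf { (base B s w : Mem V A) with arr := update s a L } []
      · refine le_trans ?_ (pow_add_pow_le (by lia) _ _)
        gcongr
        simp only [List.length_map, List.length_reverse]
        have h1 : 1 ≤ N ^ D := Nat.one_le_pow _ _ (by lia)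
        have h2 := Nat.mul_le_mul_right (N ^ D) (le_pow_self' (N := N) (by lia) 10)
        rw [add_comm D 10, pow_add N 10]
        lia
    · intro b
      simp only [Prog.run]
      by_cases hb : b = a
      · subst hb
        rw [Function.update_self, length_table]
        exact (Nat.pow_le_pow_left (by lia) _).trans (Nat.pow_le_pow_right (by lia) hD)
      · simpa [hb] using hs b
  | seq P Q ih₁ ih₂ =>
    obtain ⟨D₁, ih₁⟩ := ih₁ hP.1
    obtain ⟨D₂, ih₂⟩ := ih₂ hP.2
    refine ⟨D₁ + D₂, fun D hD => ?_⟩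
    obtain ⟨d₁, ih₁⟩ := ih₁ D (by lia)
    obtain ⟨d₂, ih₂⟩ := ih₂ D (by lia)
    refine ⟨d₁ + d₂ + 1, fun N B s w hN hs => ?_⟩
    obtain ⟨h₁, h₁'⟩ := ih₁ N B s w hN hs
    obtain ⟨h₂, h₂'⟩ := ih₂ N B _ w hN h₁'
    exact ⟨(h₁.seq h₂).mono (pow_add_pow_le (by lia) _ _), h₂'⟩
  | rep P ih =>
    obtain ⟨D₁, ih⟩ := ih hP
    refine ⟨D₁, fun D hD => ?_⟩
    obtain ⟨d, ih⟩ := ih D hD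
    refine ⟨d + 20, fun N B s w hN hs => ?_⟩
    have hlen : ∀ i a, ((P.run B)^[i] s a).length ≤ N ^ D := by
      intro i
      induction i with
      | zero => exact hs
      | succ i ihi =>
        intro a
        rw [Function.iterate_succ_apply']
        exact (ih N B _ w hN ihi).2 a
    refine ⟨?_, hlen B⟩
    have := run_repeatCode (P := P.code) (B := B) (T := N ^ d) (w := w)
      (fun i => base B ((P.run B)^[i] s) w) (fun _ => rfl) (fun _ => rfl) (by
        intro i _ w'
        have := (ih N B _ w' hN (hlen i)).1
        rwa [← Function.iterate_succ_apply' (P.run B)] at this)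
    refine this.mono ?_
    have h2 : 1 ≤ N ^ d := Nat.one_le_pow _ _ (by lia)
    have h3 : N * N ^ d = N ^ (d + 1) := by rw [pow_succ, mul_comm]
    have h4 : B * (N ^ d + 6) + 4 ≤ 19 * N ^ (d + 1) := by nlinarith
    refine h4.trans ?_
    rw [show d + 20 = 19 + (d + 1) by lia, pow_add N 19]
    exact Nat.mul_le_mul_right _ (le_pow_self' (by lia) 19)

/-! ### Reading the input and cleaning up -/

/-- Push the bits `f a c` on the tables `a` in the list. -/
def pushAll (f : A → Γ' → Bool) (c : Γ') : List A → Code (Reg V A)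
  | [] => .nop
  | a :: l => .seq (.push (.arr a) (.bit (f a c))) (pushAll f c l)

/-- Read the input: the table `a` becomes the unary relation that consists of the positions whose
symbol satisfies `f a`; the domain consists of the positions and one more element. -/
noncomputable def loadCode [Fintype A] (f : A → Γ' → Bool) : Code (Reg V A) :=
  .seq (.loop .inp yes fun c => .push .tmp c) <| .seq (.push .bnd mark) <|
  .loop .tmp yes fun c => .seq (.push .bnd mark) (pushAll f c Finset.univ.toList)

theorem run_pushAll (f : A → Γ' → Bool) (c : Γ') (l : List A) (hl : l.Nodup) (m : Mem V A) :
    Run (pushAll f c l) m.store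
      { m with arr := fun a => if a ∈ l then f a c :: m.arr a else m.arr a }.store
      (l.length + 1) := by
  induction l generalizing m with
  | nil => simpa [pushAll] using Run.nop
  | cons a l ih =>
    have h1 : Run (.push (.arr a) (.bit (f a c))) m.store
        { m with arr := update m.arr a (f a c :: m.arr a) }.store 1 :=
      Run.push.congr rfl (by simp [Mem.update_arr_cons])
    refine ((h1.seq (ih (List.nodup_cons.1 hl).2 _)).congr rfl ?_).mono ?_
    · congr 2
      funext b
      by_cases hb : b = a
      · subst hb
        simp [(List.nodup_cons.1 hl).1]
      · simp [hb]
    · simp only [List.length_cons]; lia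

theorem run_loadCode [Fintype A] (f : A → Γ' → Bool) (x : List Γ') :
    Run (loadCode f) (update (fun _ => []) (Reg.inp : Reg V A) x)
      (base (x.length + 1) (fun a => x.map (f a)) []).store
      ((x.length + 1) * (Fintype.card A + 10)) := by
  have a₁ := Run.loop (k := (Reg.inp : Reg V A)) (f := yes) (T := 1) (r := [])
    (P := fun c => Code.push .tmp c)
    (fun l => update (update (fun _ => []) Reg.inp l) .tmp (x.take (x.length - l.length)).reverse)
    x (by simp) (by simp) (by simp) (by
      rintro c l' ⟨l'', h⟩
      refine Run.push.congr rfl ?_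
      have e1 : x.take (x.length - (c :: l').length) = l'' := by
        rw [← h, List.length_append, Nat.add_sub_cancel, List.take_left]
      have e2 : x.take (x.length - l'.length) = l'' ++ [c] := by
        rw [← h, show l'' ++ c :: l' = (l'' ++ [c]) ++ l' by simp, List.length_append,
          Nat.add_sub_cancel, List.take_left]
      rw [e1, e2]
      funext k
      simp only [Function.update_apply]
      grind)
  have a₂ : Run (.push .bnd mark) { (base 0 (fun _ => []) [] : Mem V A) with tmp := x.reverse }.store
      { (base 1 (fun _ => []) [] : Mem V A) with tmp := x.reverse }.store 1 := by
    refine Run.push.congr rfl ?_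
    exact Mem.update_bnd { (base 0 (fun _ => []) [] : Mem V A) with tmp := x.reverse } 1
  have a₃ := Run.loop (k := (Reg.tmp : Reg V A)) (f := yes) (T := Fintype.card A + 2) (r := [])
    (P := fun c => .seq (.push .bnd mark) (pushAll f c Finset.univ.toList))
    (fun l => { (base (x.length - l.length + 1) (fun a => (x.drop l.length).map (f a)) [] :
      Mem V A) with tmp := l }.store)
    x.reverse (by simp) (by simp) (by simp) (by
      rintro c l' ⟨l'', h⟩
      have h' : x = l'.reverse ++ (c :: l''.reverse) := by
        have := congrArg List.reverse h
        simpa using this.symm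
      have e1 : x.drop (c :: l').length = l''.reverse := by
        rw [h', show l'.reverse ++ (c :: l''.reverse) =
          (l'.reverse ++ [c]) ++ l''.reverse by simp, List.drop_left' (by simp)]
      have e2 : x.drop l'.length = c :: l''.reverse := by
        rw [h', List.drop_left' (by simp)]
      have e3 : x.length - (c :: l').length + 1 = x.length - l'.length := by
        have := congrArg List.length h'
        simp only [List.length_append, List.length_reverse, List.length_cons] at this ⊢
        lia
      have b := run_pushAll f c Finset.univ.toList (Finset.nodup_toList _)
        { (base (x.length - l'.length + 1) (fun a => (x.drop (c :: l').length).map (f a)) [] :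
          Mem V A) with tmp := l' }
      refine ((Run.push.congr rfl ?_).seq b).congr rfl ?_ |>.mono ?_
      · simp only [List.append_nil, Mem.update_tmp]
        rw [Mem.store_bnd, replicate_cons_mark, Mem.update_bnd]
        simp only [base, e3]
      · simp only [e1, e2, Finset.mem_toList, Finset.mem_univ, if_true, base, List.map_cons]
      · simp; lia)
  refine ((a₁.congr (s₁' := { (base 0 (fun _ => []) [] : Mem V A) with tmp := x.reverse }.store)
    ?_ ?_).seq (a₂.seq (a₃.congr ?_ ?_))).mono ?_
  · funext k
    simp only [Function.update_apply]
    grind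
  · funext k
    cases k <;> simp [base, Mem.store]
  · simp [base]
  · simp [base, Mem.update_tmp]
  · simp only [List.length_reverse]
    lia

/-- Empty all stacks in the list. -/
def clearAll {K : Type} : List K → Code K
  | [] => .nop
  | k :: l => .seq (clear k) (clearAll l)

theorem run_clearAll {K : Type} [DecidableEq K] (l : List K) (s : Store K) (M : ℕ)
    (h : ∀ k, (s k).length ≤ M) :
    Run (clearAll l) s (fun k => if k ∈ l then [] else s k) (l.length * (2 * M + 1) + 1) := by
  induction l generalizing s with
  | nil => simpa [clearAll] using Run.nop
  | cons k l ih =>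
    have hk := h k
    refine ((Run.clear.seq (ih _ ?_)).congr rfl ?_).mono ?_
    · intro k'
      by_cases hk' : k' = k
      · subst hk'; simp
      · simpa [hk'] using h k'
    · funext k'
      by_cases hk' : k' = k
      · subst hk'; simp
      · simp [hk']
    · simp only [List.length_cons]
      lia

/-- A decision problem is solved in polynomial time if it is defined, over the positions of the
input string, by a first-order formula in terms of the tables that some program computes. -/
theorem polyTimeSolvableOn_of_prog [Fintype V] [Fintype A] {ι : Type} (enc : ι → List Γ')
    (Q C : ι → Prop) (f : A → Γ' → Bool) (P : Prog V A) (hP : P.Ok) (φ : Fml V A)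
    (h : ∀ x, C x → (φ.Sat ((enc x).length + 1)
      (P.run ((enc x).length + 1) fun a => (enc x).map (f a)) (fun _ => 0) ↔ Q x)) :
    ControllerPlacement.PolyTimeSolvableOn enc Q C := by
  classical
  obtain ⟨D₀, hrun⟩ := P.run_code hP
  obtain ⟨d, hrun⟩ := hrun (D₀ + 1) (by lia)
  obtain ⟨e, hφ⟩ := φ.run
  set regs : List (Reg V A) := (Finset.univ.erase Reg.res).toList with hregs
  refine polyTimeSolvableOn_of_exec enc Q C
    (.seq (loadCode f) (.seq P.code (.seq φ.code (clearAll regs)))) .inp .res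
    ((Polynomial.X + 3) * Polynomial.C (Fintype.card A + 10) + ((Polynomial.X + 3) ^ d +
      ((Polynomial.X + 3) ^ e +
        (Polynomial.C regs.length * (2 * (Polynomial.X + 3) ^ (D₀ + 1) + 1) + 1)))) ?_
  intro x hx
  set B := (enc x).length + 1 with hB
  set N := (enc x).length + 3 with hN
  have hNpos : 1 ≤ N ^ (D₀ + 1) := Nat.one_le_pow _ _ (by lia)
  have hNle : N ≤ N ^ (D₀ + 1) := Nat.le_self_pow (by lia) _
  obtain ⟨h₂, hlen⟩ := hrun N B (fun a => (enc x).map (f a)) [] (by lia) (by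
    intro a
    simp only [List.length_map]
    lia)
  have h₁ := run_loadCode (V := V) f (enc x)
  set s := P.run B fun a => (enc x).map (f a) with hs
  have h₃ := hφ N (base B s []) rfl rfl (by simp [base]; lia) (fun _ => Nat.zero_le _)
  set b := decide (φ.Sat B s fun _ => 0) with hb
  have h₄ := run_clearAll regs { (base B s [] : Mem V A) with res := [b] }.store (N ^ (D₀ + 1)) (by
    intro k
    cases k with
    | arr a => simpa [base] using hlen a
    | bnd => simp [base]; lia
    | _ => simp [base, Mem.store] <;> lia)
  obtain ⟨t, ht, hex⟩ := h₁.seq (h₂.seq (h₃.seq h₄))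
  refine ⟨t, ht.trans ?_, b, by rw [hb, decide_eq_true_iff]; exact h x hx, ?_⟩
  · simp only [Polynomial.eval_add, Polynomial.eval_mul, Polynomial.eval_pow, Polynomial.eval_X,
      Polynomial.eval_C, Polynomial.eval_ofNat, Polynomial.eval_one, ← hN]
    gcongr
    lia
  · convert hex using 1
    funext k
    cases k <;> simp [hregs, Mem.store]

end StackCode

namespace StackCode

open Function (update)

variable {V A : Type} [DecidableEq V]

/-! ### Semantics of definitions and of inductive definitions -/

/-- A tuple of `k` elements of the domain. -/
def Valid (B k : ℕ) (vs : List ℕ) : Prop := vs.length = k ∧ ∀ v ∈ vs, v < B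

theorem forall_valid_zero {B : ℕ} {p : List ℕ → Prop} :
    (∀ vs, Valid B 0 vs → p vs) ↔ p [] := by
  constructor
  · intro h
    exact h [] ⟨rfl, by simp⟩
  · rintro h vs ⟨hl, -⟩
    rwa [List.length_eq_zero_iff.1 hl]

theorem forall_valid_succ {B k : ℕ} {p : List ℕ → Prop} :
    (∀ vs, Valid B (k + 1) vs → p vs) ↔ ∀ x < B, ∀ vs, Valid B k vs → p (x :: vs) := by
  constructor
  · rintro h x hx vs ⟨hl, hv⟩
    exact h _ ⟨by simp [hl], by simpa [hx] using hv⟩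
  · rintro h vs ⟨hl, hv⟩
    obtain ⟨x, vs, rfl⟩ := List.exists_cons_of_length_eq_add_one hl
    exact h x (hv x List.mem_cons_self) vs
      ⟨by simpa using hl, fun v hv' => hv v (List.mem_cons_of_mem _ hv')⟩

theorem foldl_index (B : ℕ) (vs : List ℕ) (t : ℕ) :
    vs.foldl (fun t x => t * B + x) t = t * B ^ vs.length + index B vs := by
  unfold index
  induction vs generalizing t with
  | nil => simp
  | cons x vs ih =>
    simp only [List.foldl_cons, List.length_cons]
    rw [ih (t * B + x), ih (0 * B + x)]
    ring

theorem index_cons (B x : ℕ) (vs : List ℕ) :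
    index B (x :: vs) = x * B ^ vs.length + index B vs := by
  rw [← foldl_index]
  simp [index]

theorem index_lt {B k : ℕ} {vs : List ℕ} (h : Valid B k vs) : index B vs < B ^ k := by
  induction vs generalizing k with
  | nil =>
    obtain ⟨rfl, -⟩ := h
    simp [index]
  | cons x vs ih =>
    obtain ⟨rfl, hv⟩ := h
    have h1 := ih (k := vs.length) ⟨rfl, fun v hv' => hv v (List.mem_cons_of_mem _ hv')⟩
    have h2 := hv x List.mem_cons_self
    rw [index_cons, List.length_cons, pow_succ, mul_comm _ B]
    have := Nat.mul_le_mul_right (B ^ vs.length) (Nat.succ_le_of_lt h2)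
    rw [Nat.succ_mul] at this
    lia

theorem exists_index_eq {B k p : ℕ} (h : p < B ^ k) : ∃ vs, Valid B k vs ∧ index B vs = p := by
  induction k generalizing p with
  | zero => exact ⟨[], ⟨rfl, by simp⟩, by simp at h; simp [index, h]⟩
  | succ k ih =>
    have hB : 0 < B ^ k := by
      rcases Nat.eq_zero_or_pos (B ^ k) with h0 | h0
      · rw [pow_succ, h0] at h; simp at h
      · exact h0
    obtain ⟨vs, ⟨hl, hv⟩, hi⟩ := ih (p := p % B ^ k) (Nat.mod_lt _ hB)
    refine ⟨p / B ^ k :: vs, ⟨by simp [hl], ?_⟩, ?_⟩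
    · intro v hv'
      rcases List.mem_cons.1 hv' with rfl | hv'
      · rw [Nat.div_lt_iff_lt_mul hB, mul_comm]
        rwa [pow_succ] at h
      · exact hv v hv'
    · rw [index_cons, hl, hi, mul_comm]
      exact Nat.div_add_mod _ _

/-- Give the variables `xs` the values `vs`, and the other variables the values `v`. -/
def assign (v : V → ℕ) : List V → List ℕ → V → ℕ
  | x :: xs, i :: vs => assign (update v x i) xs vs
  | _, _ => v

theorem getD_flatMap_range {α : Type*} (d : α) (f : ℕ → List α) (B n : ℕ)
    (h : ∀ i < B, (f i).length = n) {i j : ℕ} (hi : i < B) (hj : j < n) :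
    ((List.range B).flatMap f).getD (i * n + j) d = (f i).getD j d := by
  induction B with
  | zero => lia
  | succ B ih =>
    have hl : ((List.range B).flatMap f).length = B * n := by
      rw [length_flatMap_const _ f n fun x hx => h x (by have := List.mem_range.1 hx; lia)]
      simp
    rw [List.range_succ, List.flatMap_append]
    rcases Nat.lt_succ_iff_lt_or_eq.1 hi with hi | rfl
    · rw [List.getD_append, ih (fun i hi => h i (by lia)) hi]
      rw [hl]
      have := Nat.mul_le_mul_right n (Nat.succ_le_of_lt hi)
      rw [Nat.succ_mul] at this
      lia
    · rw [List.getD_append_right _ _ _ _ (by rw [hl]; lia), hl]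
      simp

theorem holds_table {B : ℕ} {s : A → List Bool} {φ : Fml V A} {xs : List V} {v : V → ℕ}
    {vs : List ℕ} (h : Valid B xs.length vs) :
    Holds B (table B s φ xs v) vs ↔ φ.Sat B s (assign v xs vs) := by
  induction xs generalizing v vs with
  | nil =>
    rw [List.length_eq_zero_iff.1 h.1]
    simp [Holds, table, index, assign]
  | cons x xs ih =>
    obtain ⟨i, vs, rfl⟩ := List.exists_cons_of_length_eq_add_one h.1
    have hv : Valid B xs.length vs :=
      ⟨by simpa using h.1, fun v hv' => h.2 v (List.mem_cons_of_mem _ hv')⟩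
    have hi := h.2 i List.mem_cons_self
    rw [assign, ← ih hv, Holds, table, index_cons, hv.1,
      getD_flatMap_range _ _ _ _ (fun i _ => length_table _ _ _ _ _) hi (index_lt hv), Holds]

namespace Fml

/-- Disjunction. -/
def or (φ ψ : Fml V A) : Fml V A := .neg (.and (.neg φ) (.neg ψ))

/-- Universal quantification. -/
def all (x : V) (φ : Fml V A) : Fml V A := .neg (.ex x (.neg φ))

/-- Implication. -/
def imp (φ ψ : Fml V A) : Fml V A := .neg (.and φ (.neg ψ))

/-- The formula `c + ∑ xs = ∑ ys`. -/
def eq : ℕ → List V → List V → Fml V A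
  | 0, xs, ys => .and (.neg (.lt 0 xs ys)) (.neg (.lt 0 ys xs))
  | c + 1, xs, ys => .and (.neg (.lt (c + 1) xs ys)) (.lt c xs ys)

/-- Existential quantification over a list of variables. -/
def exs : List V → Fml V A → Fml V A
  | [], φ => φ
  | x :: xs, φ => .ex x (exs xs φ)

/-- Conjunction of a list of formulas. -/
def conj : List (Fml V A) → Fml V A
  | [] => .neg (.lt 0 [] [])
  | φ :: l => .and φ (conj l)

/-- Disjunction of a list of formulas. -/
def disj : List (Fml V A) → Fml V A
  | [] => .lt 0 [] []
  | φ :: l => .or φ (disj l)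

variable {B : ℕ} {s : A → List Bool} {v : V → ℕ} {φ ψ : Fml V A}

@[simp] theorem sat_lt {c : ℕ} {xs ys : List V} :
    (lt c xs ys : Fml V A).Sat B s v ↔ c + (xs.map v).sum < (ys.map v).sum := Iff.rfl

@[simp] theorem sat_rd {a : A} {xs : List V} :
    (rd a xs : Fml V A).Sat B s v ↔ Holds B (s a) (xs.map v) := Iff.rfl

@[simp] theorem sat_neg : φ.neg.Sat B s v ↔ ¬ φ.Sat B s v := Iff.rfl

@[simp] theorem sat_and : (φ.and ψ).Sat B s v ↔ φ.Sat B s v ∧ ψ.Sat B s v := Iff.rfl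

@[simp] theorem sat_ex {x : V} : (φ.ex x).Sat B s v ↔ ∃ i < B, φ.Sat B s (update v x i) := Iff.rfl

@[simp] theorem sat_or : (φ.or ψ).Sat B s v ↔ φ.Sat B s v ∨ ψ.Sat B s v := by
  simp only [or, sat_neg, sat_and]
  tauto

@[simp] theorem sat_all {x : V} : (φ.all x).Sat B s v ↔ ∀ i < B, φ.Sat B s (update v x i) := by
  simp [all]

@[simp] theorem sat_imp : (φ.imp ψ).Sat B s v ↔ (φ.Sat B s v → ψ.Sat B s v) := by
  simp [imp]

@[simp] theorem sat_eq {c : ℕ} {xs ys : List V} :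
    (eq c xs ys : Fml V A).Sat B s v ↔ c + (xs.map v).sum = (ys.map v).sum := by
  cases c <;> simp only [eq, sat_neg, sat_and, sat_lt] <;> lia

@[simp] theorem sat_conj {l : List (Fml V A)} : (conj l).Sat B s v ↔ ∀ φ ∈ l, φ.Sat B s v := by
  induction l with
  | nil => simp [conj]
  | cons φ l ih => simp [conj, ih]

@[simp] theorem sat_disj {l : List (Fml V A)} : (disj l).Sat B s v ↔ ∃ φ ∈ l, φ.Sat B s v := by
  induction l with
  | nil => simp [disj]
  | cons φ l ih => simp [disj, ih]

end Fml

theorem Fml.sat_congr {B : ℕ} {s s' : A → List Bool}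
    (h : ∀ a p, (s a).getD p false = (s' a).getD p false) (φ : Fml V A) (v : V → ℕ) :
    φ.Sat B s v ↔ φ.Sat B s' v := by
  induction φ generalizing v with
  | lt c xs ys => rfl
  | rd a xs => simp [Holds, -List.getD_eq_getElem?_getD, h]
  | neg φ ih => simp [ih]
  | and φ ψ ih₁ ih₂ => simp [ih₁, ih₂]
  | ex x φ ih => simp [ih]

variable [DecidableEq A]

/-- The effect of a definition. -/
theorem Prog.exists_run_defn (B : ℕ) (s : A → List Bool) (a : A) (xs : List V) (φ : Fml V A) :
    ∃ l, (Prog.defn a xs φ).run B s = update s a l ∧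
      ∀ vs, Valid B xs.length vs → (Holds B l vs ↔ φ.Sat B s (assign (fun _ => 0) xs vs)) :=
  ⟨_, rfl, fun _ h => holds_table h⟩

/-- The `k`-fold nested loop. -/
def Prog.reps {V A : Type} : ℕ → Prog V A → Prog V A
  | 0, P => P
  | k + 1, P => .rep (reps k P)

theorem Prog.run_reps (B k : ℕ) (P : Prog V A) : (P.reps k).run B = (P.run B)^[B ^ k] := by
  induction k with
  | zero => simp [reps]
  | succ k ih =>
    funext s
    rw [reps, run, ih, ← Function.iterate_mul, pow_succ]

theorem Prog.ok_reps {V A : Type} (k : ℕ) (P : Prog V A) : (P.reps k).Ok ↔ P.Ok := by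
  induction k with
  | zero => rfl
  | succ k ih => exact ih

/-- The inductive definition of the relation `a` by the clause `a(xs) ← φ`: the clause is applied to
all tuples simultaneously, as often as there are tuples. -/
def Prog.lfp {V A : Type} (a : A) (xs : List V) (φ : Fml V A) : Prog V A :=
  (Prog.defn a xs (.or (.rd a xs) φ)).reps xs.length

/-- An increasing sequence of subsets of an `M`-element set is stationary after `M` steps. -/
theorem stationary {M : ℕ} (F : ℕ → Finset ℕ) (hF : ∀ i, F i ⊆ Finset.range M)
    (hmono : ∀ i, F i ⊆ F (i + 1)) (hst : ∀ i, F i = F (i + 1) → F (i + 1) = F (i + 2)) :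
    F M = F (M + 1) := by
  by_contra hne
  have h1 : ∀ i ≤ M, F i ≠ F (i + 1) := by
    intro i hi heq
    have : ∀ j, F (i + j) = F (i + j + 1) := by
      intro j
      induction j with
      | zero => exact heq
      | succ j ih => exact hst _ ih
    obtain ⟨j, rfl⟩ := Nat.exists_eq_add_of_le hi
    exact hne (this j)
  have h2 : ∀ i ≤ M + 1, i ≤ (F i).card := by
    intro i
    induction i with
    | zero => simp
    | succ i ih =>
      intro hi
      have := Finset.card_lt_card (Finset.ssubset_iff_subset_ne.2 ⟨hmono i, h1 i (by lia)⟩)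
      have := ih (by lia)
      lia
  have := Finset.card_le_card (hF (M + 1))
  rw [Finset.card_range] at this
  have := h2 (M + 1) le_rfl
  lia

theorem assign_map {xs : List V} (hxs : xs.Nodup) {vs : List ℕ} (h : vs.length = xs.length)
    (v : V → ℕ) : xs.map (assign v xs vs) = vs := by
  have aux : ∀ (xs : List V) (vs : List ℕ) (v : V → ℕ), ∀ y ∉ xs, assign v xs vs y = v y := by
    intro xs
    induction xs with
    | nil => intro vs v y _; simp [assign]
    | cons x xs ih =>
      intro vs v y hy
      cases vs with
      | nil => simp [assign]
      | cons i vs =>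
        simp only [List.mem_cons, not_or] at hy
        rw [assign, ih _ _ _ hy.2, Function.update_of_ne hy.1]
  induction xs generalizing vs v with
  | nil => simpa [eq_comm] using h
  | cons x xs ih =>
    obtain ⟨i, vs, rfl⟩ := List.exists_cons_of_length_eq_add_one h
    have hx := List.nodup_cons.1 hxs
    rw [List.map_cons, assign, ih hx.2 (by simpa using h), aux _ _ _ _ hx.1]
    simp

/-- The effect of an inductive definition of a relation that is empty at the outset: the result
is the relation `S` if the clause leads from elements of `S` to elements of `S` only, and if every
relation that is closed under the clause contains `S`. -/
theorem Prog.exists_run_lfp (B : ℕ) (s : A → List Bool) (a : A) (xs : List V) (φ : Fml V A)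
    (hxs : xs.Nodup) (h0 : ∀ p, (s a).getD p false = false) (S : List ℕ → Prop)
    (sound : ∀ l, (∀ vs, Valid B xs.length vs → Holds B l vs → S vs) →
      ∀ vs, Valid B xs.length vs → φ.Sat B (update s a l) (assign (fun _ => 0) xs vs) → S vs)
    (complete : ∀ l, (∀ vs, Valid B xs.length vs →
        φ.Sat B (update s a l) (assign (fun _ => 0) xs vs) → Holds B l vs) →
      ∀ vs, Valid B xs.length vs → S vs → Holds B l vs) :
    ∃ l, (Prog.lfp a xs φ).run B s = update s a l ∧
      ∀ vs, Valid B xs.length vs → (Holds B l vs ↔ S vs) := by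
  set ψ : Fml V A := .or (.rd a xs) φ with hψ
  set T : List Bool → List Bool := fun l => table B (update s a l) ψ xs fun _ => 0 with hT
  have hrun : ∀ l, (Prog.defn a xs ψ).run B (update s a l) = update s a (T l) := by
    intro l
    rw [Prog.run, Function.update_idem]
  have hiter : ∀ i, ((Prog.defn a xs ψ).run B)^[i] s = update s a (T^[i] (s a)) := by
    intro i
    induction i with
    | zero => simp
    | succ i ih => rw [Function.iterate_succ_apply', ih, hrun, Function.iterate_succ_apply']
  have hTholds : ∀ l vs, Valid B xs.length vs → (Holds B (T l) vs ↔ Holds B l vs ∨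
      φ.Sat B (update s a l) (assign (fun _ => 0) xs vs)) := by
    intro l vs hvs
    rw [hT, holds_table hvs, hψ, Fml.sat_or, Fml.sat_rd, assign_map hxs hvs.1,
      Function.update_self]
  have hTlen : ∀ l, (T l).length = B ^ xs.length := fun l => length_table _ _ _ _ _
  set F : ℕ → Finset ℕ := fun i =>
    (Finset.range (B ^ xs.length)).filter fun p => (T^[i] (s a)).getD p false = true with hF
  have hFmem : ∀ i p, p ∈ F i ↔ (T^[i] (s a)).getD p false = true := by
    intro i p
    simp only [hF, Finset.mem_filter, Finset.mem_range, and_iff_right_iff_imp]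
    intro hp
    cases i with
    | zero => simp only [Function.iterate_zero, id, h0] at hp; cases hp
    | succ i =>
      by_contra hlt
      rw [Function.iterate_succ_apply', List.getD_eq_default _ _ (by rw [hTlen]; lia)] at hp
      cases hp
  have hFeq : ∀ i j, F i = F j → ∀ p, (T^[i] (s a)).getD p false = (T^[j] (s a)).getD p false := by
    intro i j hij p
    have := congrArg (p ∈ ·) hij
    simp only [hFmem, eq_iff_iff] at this
    exact Bool.eq_iff_iff.2 this
  have hst : F (B ^ xs.length) = F (B ^ xs.length + 1) := by
    refine stationary F (fun i => Finset.filter_subset _ _) ?_ ?_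
    · intro i p hp
      have hp' := Finset.mem_range.1 (Finset.mem_filter.1 hp).1
      obtain ⟨vs, hvs, rfl⟩ := exists_index_eq hp'
      rw [hFmem] at hp ⊢
      rw [Function.iterate_succ_apply']
      exact (hTholds _ vs hvs).2 (.inl hp)
    · intro i hi
      ext p
      by_cases hp : p < B ^ xs.length
      · obtain ⟨vs, hvs, rfl⟩ := exists_index_eq hp
        rw [hFmem, hFmem, Function.iterate_succ_apply', Function.iterate_succ_apply' T (i + 1)]
        change Holds B _ vs ↔ Holds B _ vs
        rw [hTholds _ vs hvs, hTholds _ vs hvs, Holds, hFeq _ _ hi, ← Holds]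
        refine or_congr Iff.rfl (Fml.sat_congr ?_ _ _)
        intro b q
        by_cases hb : b = a
        · subst hb
          rw [Function.update_self, Function.update_self, hFeq _ _ hi]
        · simp [hb]
      · simp only [hF, Finset.mem_filter, Finset.mem_range, hp, false_and]
  refine ⟨T^[B ^ xs.length] (s a), ?_, fun vs hvs => ⟨?_, ?_⟩⟩
  · rw [Prog.lfp, Prog.run_reps, hiter]
  · have : ∀ i vs, Valid B xs.length vs → Holds B (T^[i] (s a)) vs → S vs := by
      intro i
      induction i with
      | zero =>
        intro vs _ h
        rw [Function.iterate_zero, id, Holds, h0] at h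
        cases h
      | succ i ih =>
        intro vs hvs h
        rw [Function.iterate_succ_apply', hTholds _ vs hvs] at h
        rcases h with h | h
        · exact ih vs hvs h
        · exact sound _ ih vs hvs h
    exact this _ vs hvs
  · refine complete _ ?_ vs hvs
    intro vs hvs h
    rw [Holds, hFeq _ _ hst, ← Holds, Function.iterate_succ_apply', hTholds _ vs hvs]
    exact .inr h

theorem Prog.ok_lfp {V A : Type} {a : A} {xs : List V} {φ : Fml V A} :
    (Prog.lfp a xs φ).Ok ↔ xs.Nodup := Prog.ok_reps _ _

end StackCode

namespace IntervalOrder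

/-! ### An interval order from the adjacency relation -/

/-- Two distinct nonadjacent vertices of the graph `adj` on the vertices `0, …, n - 1`. -/
def NonAdj (n : ℕ) (adj : ℕ → ℕ → Prop) (a b : ℕ) : Prop := a < n ∧ b < n ∧ a ≠ b ∧ ¬ adj a b

/-- The forcing relation on ordered pairs of nonadjacent vertices, closed under composition: every
interval representation in which `a` lies to the left of `b` has `c` to the left of `d`. One
forcing step replaces one entry of the pair by a neighbour of it. -/
inductive Forces (n : ℕ) (adj : ℕ → ℕ → Prop) (a b : ℕ) : ℕ → ℕ → Prop
  | refl : NonAdj n adj a b → Forces n adj a b a b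
  | left {c d c' : ℕ} : Forces n adj a b c d → NonAdj n adj c' d → adj c c' → Forces n adj a b c' d
  | right {c d d' : ℕ} : Forces n adj a b c d → NonAdj n adj c d' → adj d d' → Forces n adj a b c d'

/-- The orientation `a < b` of a nonadjacent pair: among all pairs that are forced, in one or
the other direction, the lexicographically first increasing pair is forced in its increasing
direction. -/
def Before (n : ℕ) (adj : ℕ → ℕ → Prop) (a b : ℕ) : Prop :=
  ∃ i j, i < j ∧ Forces n adj a b i j ∧ ∀ k m, k < m →
    (Forces n adj a b k m ∨ Forces n adj a b m k) → i < k ∨ i = k ∧ j ≤ m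

/-- The vertices `0, …, n - 1` of the graph `adj` are represented by the intervals `[p v, q v]`. -/
structure Represents (n : ℕ) (adj : ℕ → ℕ → Prop) (p q : ℕ → ℝ) : Prop where
  le : ∀ v < n, p v ≤ q v
  adj_iff : ∀ u < n, ∀ v < n, adj u v ↔ u ≠ v ∧ p u ≤ q v ∧ p v ≤ q u

variable {n : ℕ} {adj : ℕ → ℕ → Prop}

theorem Forces.nonAdj {a b c d : ℕ} (h : Forces n adj a b c d) : NonAdj n adj c d := by
  cases h <;> assumption

theorem Forces.nonAdj_left {a b c d : ℕ} (h : Forces n adj a b c d) : NonAdj n adj a b := by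
  induction h <;> assumption

theorem Forces.trans {a b c d e f : ℕ} (h : Forces n adj a b c d) (h' : Forces n adj c d e f) :
    Forces n adj a b e f := by
  induction h' with
  | refl _ => exact h
  | left _ h₁ h₂ ih => exact .left ih h₁ h₂
  | right _ h₁ h₂ ih => exact .right ih h₁ h₂

section Symm

variable {p q : ℕ → ℝ} (hr : Represents n adj p q)
include hr

theorem Represents.symm {a b : ℕ} (ha : a < n) (hb : b < n) (h : adj a b) : adj b a := by
  rw [hr.adj_iff _ ha _ hb] at h
  exact (hr.adj_iff _ hb _ ha).2 ⟨h.1.symm, h.2.2, h.2.1⟩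

theorem NonAdj.symm {a b : ℕ} (h : NonAdj n adj a b) : NonAdj n adj b a :=
  ⟨h.2.1, h.1, h.2.2.1.symm, fun h' => h.2.2.2 (hr.symm h.2.1 h.1 h')⟩

theorem Forces.symm {a b c d : ℕ} (h : Forces n adj a b c d) : Forces n adj c d a b := by
  induction h with
  | refl h => exact .refl h
  | left h h₁ h₂ ih =>
    exact Forces.trans (.left (.refl h₁) h.nonAdj (hr.symm h.nonAdj.1 h₁.1 h₂)) ih
  | right h h₁ h₂ ih =>
    exact Forces.trans (.right (.refl h₁) h.nonAdj (hr.symm h.nonAdj.2.1 h₁.2.1 h₂)) ih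

theorem Forces.swap {a b c d : ℕ} (h : Forces n adj a b c d) : Forces n adj b a d c := by
  induction h with
  | refl h => exact .refl (h.symm hr)
  | left h h₁ h₂ ih => exact .right ih (h₁.symm hr) h₂
  | right h h₁ h₂ ih => exact .left ih (h₁.symm hr) h₂

/-- In an interval representation, forced pairs are in the same order. -/
theorem Forces.lt_of_lt {a b c d : ℕ} (h : Forces n adj a b c d) (hab : q a < p b) : q c < p d := by
  induction h with
  | refl _ => exact hab
  | @left c d c' h h₁ h₂ ih =>
    have h₃ := (hr.adj_iff _ h.nonAdj.1 _ h₁.1).1 h₂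
    by_contra! hlt
    refine h₁.2.2.2 ((hr.adj_iff _ h₁.1 _ h₁.2.1).2 ⟨h₁.2.2.1, ?_, hlt⟩)
    linarith [hr.le _ h.nonAdj.2.1]
  | @right c d d' h h₁ h₂ ih =>
    have h₃ := (hr.adj_iff _ h.nonAdj.2.1 _ h₁.2.1).1 h₂
    by_contra! hlt
    refine h₁.2.2.2 ((hr.adj_iff _ h₁.1 _ h₁.2.1).2 ⟨h₁.2.2.1, ?_, hlt⟩)
    linarith [hr.le _ h.nonAdj.1]

theorem not_forces_swap {a b : ℕ} : ¬ Forces n adj a b b a := by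
  intro h
  obtain ⟨ha, hb, hne, hadj⟩ := h.nonAdj_left
  rw [hr.adj_iff _ ha _ hb] at hadj
  have h₁ := hr.le _ ha
  have h₂ := hr.le _ hb
  by_cases hlt : q a < p b
  · have := h.lt_of_lt hr hlt
    linarith
  · have : q b < p a := by
      by_contra! h'
      exact hadj ⟨hne, h', not_lt.1 hlt⟩
    have := (h.symm hr).lt_of_lt hr this
    linarith

/-- Golumbic's triangle lemma: if the orientation of the edge `bc` of a triangle of nonadjacent
vertices forces neither of the other two edges at its ends, then every pair forced by `bc` forms
with `a` a triangle of the same kind. -/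
theorem triangle {a b c : ℕ} (hab : NonAdj n adj a b) (hac : NonAdj n adj a c)
    (h₁ : ¬ Forces n adj b c a c) (h₂ : ¬ Forces n adj b c b a) {b' c' : ℕ}
    (h : Forces n adj b c b' c') : Forces n adj a b a b' ∧ Forces n adj a c a c' := by
  induction h with
  | refl h => exact ⟨.refl hab, .refl hac⟩
  | @left b' c' b'' h h₃ h₄ ih =>
    refine ⟨.right ih.1 ?_ h₄, ih.2⟩
    refine ⟨hab.1, h₃.1, ?_, fun h₅ => ?_⟩
    · rintro rfl
      exact h₁ ((Forces.left h h₃ h₄).trans (ih.2.symm hr))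
    · exact h₁ ((Forces.left (.left h h₃ h₄) ih.2.nonAdj (hr.symm hab.1 h₃.1 h₅)).trans
        (ih.2.symm hr))
  | @right b' c' c'' h h₃ h₄ ih =>
    refine ⟨ih.1, .right ih.2 ?_ h₄⟩
    refine ⟨hab.1, h₃.2.1, ?_, fun h₅ => ?_⟩
    · rintro rfl
      exact h₂ ((Forces.right h h₃ h₄).trans ((ih.1.symm hr).swap hr))
    · exact h₂ ((Forces.right (.right h h₃ h₄) (ih.1.nonAdj.symm hr)
        (hr.symm hab.1 h₃.2.1 h₅)).trans ((ih.1.symm hr).swap hr))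

omit hr in
theorem Before.nonAdj {a b : ℕ} (h : Before n adj a b) : NonAdj n adj a b :=
  let ⟨_, _, _, h, _⟩ := h
  h.nonAdj_left

theorem Before.of_forces {a b c d : ℕ} (h : Before n adj a b) (h' : Forces n adj a b c d) :
    Before n adj c d := by
  obtain ⟨i, j, hij, h₁, h₂⟩ := h
  exact ⟨i, j, hij, (h'.symm hr).trans h₁,
    fun k m hkm h₃ => h₂ k m hkm (h₃.imp h'.trans h'.trans)⟩

theorem Before.asymm {a b : ℕ} (h : Before n adj a b) : ¬ Before n adj b a := by
  obtain ⟨i, j, hij, h₁, h₂⟩ := h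
  rintro ⟨i', j', hij', h₁', h₂'⟩
  have e₁ := h₂ i' j' hij' (.inr (h₁'.swap hr))
  have e₂ := h₂' i j hij (.inr (h₁.swap hr))
  obtain ⟨rfl, rfl⟩ : i = i' ∧ j = j' := by lia
  exact not_forces_swap hr (h₁.trans (h₁'.symm hr))

theorem before_or_before {a b : ℕ} (h : NonAdj n adj a b) :
    Before n adj a b ∨ Before n adj b a := by
  classical
  have hex : ∃ k, ∃ m, k < m ∧ (Forces n adj a b k m ∨ Forces n adj a b m k) := by
    rcases lt_or_gt_of_ne h.2.2.1 with hlt | hlt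
    · exact ⟨a, b, hlt, .inl (.refl h)⟩
    · exact ⟨b, a, hlt, .inr (.refl h)⟩
  have hex' := Nat.find_spec hex
  set i := Nat.find hex with hi
  obtain ⟨hij, h₁⟩ := Nat.find_spec hex'
  set j := Nat.find hex' with hj
  have hmin : ∀ k m, k < m → (Forces n adj a b k m ∨ Forces n adj a b m k) →
      i < k ∨ i = k ∧ j ≤ m := by
    intro k m hkm hf
    rcases (Nat.find_min' hex ⟨m, hkm, hf⟩ : i ≤ k).lt_or_eq with hlt | rfl
    · exact .inl hlt
    · exact .inr ⟨rfl, Nat.find_min' hex' ⟨hkm, hf⟩⟩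
  rcases h₁ with h₁ | h₁
  · exact .inl ⟨i, j, hij, h₁, hmin⟩
  · refine .inr ⟨i, j, hij, h₁.swap hr, fun k m hkm hf => hmin k m hkm ?_⟩
    rcases hf with hf | hf
    · exact .inr (hf.swap hr)
    · exact .inl (hf.swap hr)

/-- The orientation is transitive. A cyclic triangle would satisfy the hypotheses of the triangle
lemma at each of its corners, so that the lexicographically first pairs of the three
classes would start at the same vertex, which the triangle lemma excludes. -/
theorem Before.trans {a b c : ℕ} (hab : Before n adj a b) (hbc : Before n adj b c) :
    Before n adj a c := by
  have nab := hab.nonAdj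
  have nbc := hbc.nonAdj
  have hne : a ≠ c := by
    rintro rfl
    exact hab.asymm hr hbc
  have nac : NonAdj n adj a c := by
    refine ⟨nab.1, nbc.2.1, hne, fun hadj => ?_⟩
    exact hbc.asymm hr (hab.of_forces hr (.left (.refl nab) (nbc.symm hr) hadj))
  refine (before_or_before hr nac).resolve_right fun hca => ?_
  have nca := hca.nonAdj
  -- the triangle lemma for the corners `a`, `b` and `c`
  have ta := @triangle n adj p q hr a b c nab nac
    (fun h => hca.asymm hr (hbc.of_forces hr h)) (fun h => hab.asymm hr (hbc.of_forces hr h))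
  have tb := @triangle n adj p q hr b c a nbc (nab.symm hr)
    (fun h => hab.asymm hr (hca.of_forces hr h)) (fun h => hbc.asymm hr (hca.of_forces hr h))
  have tc := @triangle n adj p q hr c a b nca (nbc.symm hr)
    (fun h => hbc.asymm hr (hab.of_forces hr h)) (fun h => hca.asymm hr (hab.of_forces hr h))
  obtain ⟨i₁, j₁, h₁, f₁, m₁⟩ := id hab
  obtain ⟨i₂, j₂, h₂, f₂, m₂⟩ := id hbc
  obtain ⟨i₃, j₃, h₃, f₃, m₃⟩ := hca
  -- a vertex in two of the classes bounds the first vertices of both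
  have key : ∀ {x y u w i j : ℕ}, (∀ k m, k < m → (Forces n adj x y k m ∨ Forces n adj x y m k) →
      i < k ∨ i = k ∧ j ≤ m) → Forces n adj x y u w → i ≤ u ∧ i ≤ w := by
    intro x y u w i j hm hf
    rcases lt_or_gt_of_ne hf.nonAdj.2.2.1 with hlt | hlt
    · have := hm _ _ hlt (.inl hf)
      lia
    · have := hm _ _ hlt (.inr hf)
      lia
  have e₁ := (key m₁ ((ta f₂).1)).2
  have e₂ := (key m₂ ((tb f₃).1)).2
  have e₃ := (key m₃ ((tc f₁).1)).2
  obtain ⟨rfl, rfl⟩ : i₁ = i₂ ∧ i₂ = i₃ := by lia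
  -- now `i₁` is the end of a pair forced by `ca` and the start of another one
  have g := (tb ((tc f₁).1)).2
  have g' := (tb f₃).1
  exact hab.asymm hr (hbc.of_forces hr (g'.trans (g.symm hr)))

end Symm

end IntervalOrder

namespace IntervalOrder

variable {n : ℕ} {adj : ℕ → ℕ → Prop}

/-! ### Integral interval representations -/

open Classical in
/-- The left end of the interval of `v`: the number of vertices that lie before `v`. -/
noncomputable def left (n : ℕ) (adj : ℕ → ℕ → Prop) (v : ℕ) : ℕ :=
  Nat.count (fun u => Before n adj u v) n

/-- The point `p` belongs to the interval of `v`, which extends up to the first left end of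
an interval that lies after `v`. -/
def Occ (n : ℕ) (adj : ℕ → ℕ → Prop) (v p : ℕ) : Prop :=
  v < n ∧ left n adj v ≤ p ∧ p < n ∧ ∀ w < n, Before n adj v w → p < left n adj w

open Classical in
/-- The right end of the interval of `v`. -/
noncomputable def right (n : ℕ) (adj : ℕ → ℕ → Prop) (v : ℕ) : ℕ :=
  Nat.findGreatest (Occ n adj v) n

section

variable {p q : ℕ → ℝ} (hr : Represents n adj p q)
include hr

theorem eq_or_adj_of_incomparable {a b : ℕ} (ha : a < n) (hb : b < n) (h₁ : ¬ Before n adj a b)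
    (h₂ : ¬ Before n adj b a) : a = b ∨ adj a b := by
  by_contra! h
  rcases before_or_before hr ⟨ha, hb, h.1, h.2⟩ with h' | h'
  exacts [h₁ h', h₂ h']

/-- There is no induced subposet `2 + 2`, since interval graphs have no induced four-cycle. -/
theorem before_or_before_of_before {u v w z : ℕ} (huw : Before n adj u w) (hzv : Before n adj z v) :
    Before n adj u v ∨ Before n adj z w := by
  by_contra! ⟨h₁, h₂⟩
  have nuw := huw.nonAdj
  have nzv := hzv.nonAdj
  have a₁ : adj u z := (eq_or_adj_of_incomparable hr nuw.1 nzv.1 (fun h => h₁ (h.trans hr hzv))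
    (fun h => h₂ (h.trans hr huw))).resolve_left (by rintro rfl; exact h₁ hzv)
  have a₂ : adj w v := (eq_or_adj_of_incomparable hr nuw.2.1 nzv.2.1
    (fun h => h₁ (huw.trans hr h)) (fun h => h₂ (hzv.trans hr h))).resolve_left
    (by rintro rfl; exact h₁ huw)
  have a₃ : adj u v := (eq_or_adj_of_incomparable hr nuw.1 nzv.2.1 h₁
    (fun h => h₂ ((hzv.trans hr h).trans hr huw))).resolve_left
    (by rintro rfl; exact h₂ (hzv.trans hr huw))
  have a₄ : adj z w := (eq_or_adj_of_incomparable hr nzv.1 nuw.2.1 h₂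
    (fun h => h₁ ((huw.trans hr h).trans hr hzv))).resolve_left
    (by rintro rfl; exact h₁ (huw.trans hr hzv))
  have b₁ := nuw.2.2.2
  have b₂ := nzv.2.2.2
  rw [hr.adj_iff _ nuw.1 _ nuw.2.1] at b₁
  rw [hr.adj_iff _ nzv.1 _ nzv.2.1] at b₂
  rw [hr.adj_iff _ nuw.1 _ nzv.1] at a₁
  rw [hr.adj_iff _ nuw.2.1 _ nzv.2.1] at a₂
  rw [hr.adj_iff _ nuw.1 _ nzv.2.1] at a₃
  rw [hr.adj_iff _ nzv.1 _ nuw.2.1] at a₄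
  simp only [nuw.2.2.1, nzv.2.2.1, ne_eq, not_false_eq_true, true_and, not_and_or, not_le]
    at b₁ b₂
  rcases b₁ with b₁ | b₁ <;> rcases b₂ with b₂ | b₂ <;> linarith [a₁.2.1, a₁.2.2, a₂.2.1, a₂.2.2,
    a₃.2.1, a₃.2.2, a₄.2.1, a₄.2.2]

theorem left_lt_of_before {u v : ℕ} (h : Before n adj u v) : left n adj u < left n adj v := by
  classical
  rw [left, left, Nat.count_eq_card_filter_range, Nat.count_eq_card_filter_range]
  refine Finset.card_lt_card (Finset.ssubset_iff_of_subset ?_ |>.2 ⟨u, ?_, ?_⟩)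
  · intro w hw
    simp only [Finset.mem_filter] at hw ⊢
    exact ⟨hw.1, hw.2.trans hr h⟩
  · simpa using ⟨h.nonAdj.1, h⟩
  · simp only [Finset.mem_filter, not_and]
    exact fun _ h' => h'.nonAdj.2.2.1 rfl

/-- The sets of vertices before given vertices form a chain. -/
theorem before_of_left_le {u v w : ℕ} (h : Before n adj u w)
    (hle : left n adj w ≤ left n adj v) : Before n adj u v := by
  classical
  by_contra huv
  refine absurd hle (not_le.2 ?_)
  rw [left, left, Nat.count_eq_card_filter_range, Nat.count_eq_card_filter_range]
  refine Finset.card_lt_card (Finset.ssubset_iff_of_subset ?_ |>.2 ⟨u, ?_, ?_⟩)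
  · intro z hz
    simp only [Finset.mem_filter] at hz ⊢
    exact ⟨hz.1, (before_or_before_of_before hr h hz.2).resolve_left huv⟩
  · simpa using ⟨h.nonAdj.1, h⟩
  · simp [huv]

omit hr in
theorem left_lt {v : ℕ} (hv : v < n) : left n adj v < n := by
  classical
  rw [left, Nat.count_eq_card_filter_range]
  refine lt_of_lt_of_eq (Finset.card_lt_card (t := Finset.range n) ?_) (Finset.card_range n)
  refine Finset.filter_ssubset.2 ⟨v, by simpa, fun h => h.nonAdj.2.2.1 rfl⟩

theorem occ_left {v : ℕ} (hv : v < n) : Occ n adj v (left n adj v) :=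
  ⟨hv, le_rfl, left_lt hv, fun _ _ h => left_lt_of_before hr h⟩

theorem occ_iff {v p : ℕ} :
    Occ n adj v p ↔ v < n ∧ left n adj v ≤ p ∧ p ≤ right n adj v := by
  classical
  constructor
  · intro h
    exact ⟨h.1, h.2.1, Nat.le_findGreatest h.2.2.1.le h⟩
  · rintro ⟨hv, h₁, h₂⟩
    have h := Nat.findGreatest_spec (left_lt (adj := adj) hv).le (occ_left hr hv)
    exact ⟨hv, h₁, h₂.trans_lt h.2.2.1, fun w hw hb => h₂.trans_lt (h.2.2.2 w hw hb)⟩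

theorem left_le_right {v : ℕ} (hv : v < n) : left n adj v ≤ right n adj v :=
  ((occ_iff hr).1 (occ_left hr hv)).2.2

theorem right_lt {v : ℕ} (hv : v < n) : right n adj v < n :=
  ((occ_iff hr).2 ⟨hv, left_le_right hr hv, le_rfl⟩).2.2.1

/-- Two distinct vertices are adjacent if and only if their integral intervals intersect. -/
theorem eq_or_adj_iff {u v : ℕ} (hu : u < n) (hv : v < n) :
    (u = v ∨ adj u v) ↔ ∃ p, Occ n adj u p ∧ Occ n adj v p := by
  constructor
  · intro h
    have h' : ¬ Before n adj u v ∧ ¬ Before n adj v u := by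
      constructor <;> intro hb <;> have := hb.nonAdj
      · exact h.elim this.2.2.1 this.2.2.2
      · exact h.elim (fun e => this.2.2.1 e.symm) (fun e => this.2.2.2 (hr.symm hu hv e))
    refine ⟨max (left n adj u) (left n adj v), ⟨hu, le_max_left _ _, max_lt (left_lt hu)
      (left_lt hv), fun w hw hb => max_lt (left_lt_of_before hr hb) ?_⟩, ⟨hv, le_max_right _ _,
      max_lt (left_lt hu) (left_lt hv), fun w hw hb => max_lt ?_ (left_lt_of_before hr hb)⟩⟩
    · by_contra! hle
      exact h'.1 (before_of_left_le hr hb hle)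
    · by_contra! hle
      exact h'.2 (before_of_left_le hr hb hle)
  · rintro ⟨p, h₁, h₂⟩
    refine eq_or_adj_of_incomparable hr hu hv (fun hb => ?_) (fun hb => ?_)
    · exact absurd h₂.2.1 (not_le.2 (h₁.2.2.2 v hv hb))
    · exact absurd h₁.2.1 (not_le.2 (h₂.2.2.2 u hu hb))

end

end IntervalOrder

namespace ControllerPlacement

/-! ### Attacks as neighbourhoods -/

open Classical in
/-- The vertices outside `U` with a neighbour in `U`. -/
noncomputable def boundary {n : ℕ} (G : SimpleGraph (Fin n)) (U : Finset (Fin n)) :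
    Finset (Fin n) :=
  Finset.univ.filter fun v => v ∉ U ∧ ∃ u ∈ U, G.Adj u v

/-- An optimal attack consists of the boundary of a set of vertices without defenders, and of
arbitrary further vertices outside that set. -/
theorem Instance.isYes_iff (I : Instance) :
    I.IsYes ↔ I.α ≤ I.n ∧ ∃ U : Finset (Fin I.n), Disjoint U I.D ∧
      (boundary I.G U).card ≤ I.l ∧ I.α ≤ U.card + I.l := by
  classical
  constructor
  · rintro ⟨A, hA, hα⟩
    refine ⟨hα.trans ((Finset.card_le_univ _).trans (by simp)), ?_⟩
    set X := Finset.univ.filter fun v => ¬ Survives I.G I.D A v with hX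
    have hp : payoffAtt I.G I.D A = X.card := by
      rw [payoffAtt, hX]
    refine ⟨X \ A, ?_, (Finset.card_le_card ?_).trans hA, ?_⟩
    · rw [Finset.disjoint_left]
      intro v hv hD
      simp only [hX, Finset.mem_sdiff, Finset.mem_filter, Finset.mem_univ, true_and] at hv
      exact hv.1 ⟨hv.2, v, hv.2, hD, SimpleGraph.Reachable.refl _⟩
    · intro v hv
      simp only [boundary, hX, Finset.mem_sdiff, Finset.mem_filter, Finset.mem_univ, true_and,
        not_and, not_not] at hv
      obtain ⟨h₁, u, hu, hadj⟩ := hv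
      by_contra hvA
      have hs : Survives I.G I.D A v := by
        by_contra hs
        exact hvA (h₁ hs)
      obtain ⟨_, d, hd, hdD, hreach⟩ := hs
      refine hu.1 ⟨hu.2, d, hd, hdD, SimpleGraph.Reachable.trans (SimpleGraph.Adj.reachable ?_)
        hreach⟩
      simpa using hadj
    · have h₁ := Finset.card_le_card_sdiff_add_card (s := X) (t := A)
      rw [hp] at hα
      lia
  · rintro ⟨hα, U, hD, hl, hα'⟩
    have hcompl : (Uᶜ).card = I.n - U.card := by
      rw [Finset.card_compl, Fintype.card_fin]
    have hUn : U.card ≤ I.n := by simpa using Finset.card_le_univ U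
    have hsub : boundary I.G U ⊆ Uᶜ := by
      intro v hv
      simp only [boundary, Finset.mem_filter] at hv
      simpa using hv.2.1
    obtain ⟨A, hA₁, hA₂, hA⟩ := Finset.exists_subsuperset_card_eq hsub
      (n := min I.l (I.n - U.card)) (le_min hl (by rw [← hcompl]; exact Finset.card_le_card hsub))
      (by rw [hcompl]; exact min_le_right _ _)
    refine ⟨A, by lia, ?_⟩
    have hdis : Disjoint U A := by
      rw [Finset.disjoint_left]
      intro v hv hvA
      have := hA₂ hvA
      simp only [Finset.mem_compl] at this
      exact this hv
    have hsubset : U ∪ A ⊆ Finset.univ.filter fun v => ¬ Survives I.G I.D A v := by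
      intro v hv
      simp only [Finset.mem_filter, Finset.mem_univ, true_and]
      rintro ⟨hvA, d, hd, hdD, ⟨p⟩⟩
      have hvU : v ∈ U := (Finset.mem_union.1 hv).resolve_right hvA
      have : ∀ (x y : {w : Fin I.n | w ∉ A}), (I.G.induce {w | w ∉ A}).Walk x y →
          x.1 ∈ U → y.1 ∈ U := by
        intro x y p
        induction p with
        | nil => exact id
        | @cons x z y h p ih =>
          intro hx
          refine ih ?_
          by_contra hz
          refine z.2 (hA₁ ?_)
          simp only [boundary, Finset.mem_filter, Finset.mem_univ, true_and]
          exact ⟨hz, x, hx, by simpa using h⟩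
      exact Finset.disjoint_left.1 hD (this _ _ p hvU) hdD
    have := Finset.card_le_card hsubset
    rw [Finset.card_union_of_disjoint hdis] at this
    rw [payoffAtt]
    lia

end ControllerPlacement

namespace ControllerPlacement

/-! ### The sweep over the points -/

open Classical in
/-- The successor of the last point below `p` that satisfies `t`, and `0` if there is none. -/
noncomputable def last (t : ℕ → Prop) : ℕ → ℕ
  | 0 => 0
  | p + 1 => if t p then p + 1 else last t p

theorem last_le (t : ℕ → Prop) (p : ℕ) : last t p ≤ p := by
  induction p with
  | zero => simp [last]
  | succ p ih => rw [last]; split_ifs <;> lia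

theorem lt_last_iff {t : ℕ → Prop} {i p : ℕ} : i < last t p ↔ ∃ q, i ≤ q ∧ q < p ∧ t q := by
  induction p with
  | zero => simp [last]
  | succ p ih =>
    rw [last]
    split_ifs with h
    · exact ⟨fun hi => ⟨p, by lia, by lia, h⟩, fun ⟨q, hq⟩ => by lia⟩
    · rw [ih]
      refine exists_congr fun q => and_congr_right fun _ => ⟨fun hq => ⟨by lia, hq.2⟩, ?_⟩
      rintro ⟨hq, ht⟩
      have : q ≠ p := by rintro rfl; exact h ht
      exact ⟨by lia, ht⟩

theorem last_congr {t t' : ℕ → Prop} {p : ℕ} (h : ∀ q < p, t q ↔ t' q) : last t p = last t' p := by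
  induction p with
  | zero => rfl
  | succ p ih =>
    have := h p (by lia)
    rw [last, last, ih fun q hq => h q (by lia)]
    split_ifs <;> tauto

open Classical in
/-- The number of vertices with property `P` that the sweep has passed when it is about to treat
the vertex `v` at the point `p`: a vertex `w` with right end `r w` is treated at `r w + 1`. -/
noncomputable def passed (n : ℕ) (r : ℕ → ℕ) (P : ℕ → Prop) (p v : ℕ) : ℕ :=
  ((Finset.range n).filter fun w => (r w + 1 < p ∨ r w + 1 = p ∧ w < v) ∧ P w).card

section passed

variable {n : ℕ} {r : ℕ → ℕ} {P P' : ℕ → Prop} {p v : ℕ}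

theorem passed_le : passed n r P p v ≤ n := by
  classical
  exact (Finset.card_filter_le _ _).trans (Finset.card_range n).le

theorem passed_congr (h : ∀ w < n, r w + 1 ≤ p → (P w ↔ P' w)) :
    passed n r P p v = passed n r P' p v := by
  classical
  refine congrArg _ (Finset.filter_congr fun w hw => and_congr_right fun h' => h w ?_ ?_)
  · exact Finset.mem_range.1 hw
  · lia

theorem passed_zero : passed n r P 0 v = 0 := by
  simp [passed]

theorem passed_succ_zero : passed n r P (p + 1) 0 = passed n r P p n := by
  classical
  refine congrArg _ (Finset.filter_congr fun w hw => and_congr_left fun _ => ?_)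
  have := Finset.mem_range.1 hw
  lia

theorem passed_of_ne (h : r v + 1 ≠ p) : passed n r P p (v + 1) = passed n r P p v := by
  classical
  rw [passed, passed]
  refine congrArg _ (Finset.filter_congr fun w _ => and_congr_left fun _ => ?_)
  have : w = v → r w + 1 ≠ p := by rintro rfl; exact h
  lia

theorem passed_of_not (h : ¬ P v) : passed n r P p (v + 1) = passed n r P p v := by
  classical
  rw [passed, passed]
  refine congrArg _ (Finset.filter_congr fun w _ => and_congr_left fun hw => ?_)
  have : w ≠ v := by rintro rfl; exact h hw
  lia

theorem passed_of_pos (hv : v < n) (h : r v + 1 = p) (h' : P v) :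
    passed n r P p (v + 1) = passed n r P p v + 1 := by
  classical
  rw [passed, passed, ← Finset.card_insert_of_notMem (a := v)]
  · congr 1
    ext w
    simp only [Finset.mem_filter, Finset.mem_range, Finset.mem_insert]
    constructor
    · rintro ⟨h₁, h₂, h₃⟩
      by_cases hw : w = v
      · exact .inl hw
      · exact .inr ⟨h₁, by lia, h₃⟩
    · rintro (rfl | ⟨h₁, h₂, h₃⟩)
      · exact ⟨hv, by lia, h'⟩
      · exact ⟨h₁, by lia, h₃⟩
  · simp [h]

end passed

/-- For the intervals `[l v, r v]` and a set `t` of points, the interval of `v` contains a point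
of `t`, and `v` is a defender or its interval contains a point outside `t`. -/
def Attacked (l r : ℕ → ℕ) (D t : ℕ → Prop) (v : ℕ) : Prop :=
  l v < last t (r v + 1) ∧ (D v ∨ l v < last (fun p => ¬ t p) (r v + 1))

/-- The interval of `v` consists of points of `t`, and `v` is not a defender. -/
def Gained (l r : ℕ → ℕ) (D t : ℕ → Prop) (v : ℕ) : Prop :=
  ¬ D v ∧ ¬ l v < last (fun p => ¬ t p) (r v + 1)

/-- The state of the sweep before it treats the vertex `v` at the point `p`, for some choice `t` of
points below `p`: the successors `x` and `y` of the last points in and outside `t`, and the numbers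
`c` and `g` of attacked and of gained vertices so far. -/
inductive Sweep (n : ℕ) (l r : ℕ → ℕ) (D : ℕ → Prop) : ℕ → ℕ → ℕ → ℕ → ℕ → ℕ → Prop
  | base : Sweep n l r D 0 n 0 0 0 0
  | inside {p x y c g} : Sweep n l r D p n x y c g → p < n → Sweep n l r D (p + 1) 0 (p + 1) y c g
  | outside {p x y c g} : Sweep n l r D p n x y c g → p < n → Sweep n l r D (p + 1) 0 x (p + 1) c g
  | skip {p v x y c g} : Sweep n l r D p v x y c g → v < n → r v + 1 ≠ p →
      Sweep n l r D p (v + 1) x y c g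
  | attacked {p v x y c g} : Sweep n l r D p v x y c g → v < n → r v + 1 = p → l v < x →
      (D v ∨ l v < y) → Sweep n l r D p (v + 1) x y (c + 1) g
  | gained {p v x y c g} : Sweep n l r D p v x y c g → v < n → r v + 1 = p → ¬ D v → ¬ l v < y →
      Sweep n l r D p (v + 1) x y c (g + 1)
  | lost {p v x y c g} : Sweep n l r D p v x y c g → v < n → r v + 1 = p → ¬ l v < x →
      (D v ∨ l v < y) → Sweep n l r D p (v + 1) x y c g

section Sweep

variable {n : ℕ} {l r : ℕ → ℕ} {D : ℕ → Prop}

/-- Every state of the sweep comes from some set `t` of points. -/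
theorem Sweep.exists_eq {p v x y c g : ℕ} (h : Sweep n l r D p v x y c g) :
    p ≤ n ∧ v ≤ n ∧ ∃ t, x = last t p ∧ y = last (fun q => ¬ t q) p ∧
      c = passed n r (Attacked l r D t) p v ∧ g = passed n r (Gained l r D t) p v := by
  -- The numbers in a state before the point `p` only depend on the points of `t` below `p`.
  have extend : ∀ {p : ℕ} {t t' : ℕ → Prop}, (∀ q < p, t q ↔ t' q) →
      last t' p = last t p ∧ last (fun q => ¬ t' q) p = last (fun q => ¬ t q) p ∧
      passed n r (Attacked l r D t') p n = passed n r (Attacked l r D t) p n ∧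
      passed n r (Gained l r D t') p n = passed n r (Gained l r D t) p n := by
    intro p t t' ht
    have h₁ : ∀ i ≤ p, last t' i = last t i := fun i hi =>
      last_congr fun q hq => (ht q (by lia)).symm
    have h₂ : ∀ i ≤ p, last (fun q => ¬ t' q) i = last (fun q => ¬ t q) i := fun i hi =>
      last_congr fun q hq => not_congr (ht q (by lia)).symm
    refine ⟨h₁ _ le_rfl, h₂ _ le_rfl, passed_congr fun w _ hw => ?_, passed_congr fun w _ hw => ?_⟩
    · rw [Attacked, Attacked, h₁ _ hw, h₂ _ hw]
    · rw [Gained, Gained, h₂ _ hw]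
  induction h with
  | base => exact ⟨by lia, le_rfl, fun _ => True, rfl, rfl, by simp [passed_zero], by
      simp [passed_zero]⟩
  | @inside p x y c g _ hp ih =>
    obtain ⟨-, -, t, rfl, rfl, rfl, rfl⟩ := ih
    obtain ⟨h₁, h₂, h₃, h₄⟩ := extend (p := p) (t := t) (t' := fun q => t q ∨ q = p)
      fun q hq => by simp [hq.ne]
    refine ⟨hp, by lia, fun q => t q ∨ q = p, by simp [last], ?_, ?_, ?_⟩
    · rw [last, if_neg (by simp), h₂]
    · rw [passed_succ_zero, h₃]
    · rw [passed_succ_zero, h₄]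
  | @outside p x y c g _ hp ih =>
    obtain ⟨-, -, t, rfl, rfl, rfl, rfl⟩ := ih
    obtain ⟨h₁, h₂, h₃, h₄⟩ := extend (p := p) (t := t) (t' := fun q => t q ∧ q ≠ p)
      fun q hq => by simp [hq.ne]
    refine ⟨hp, by lia, fun q => t q ∧ q ≠ p, ?_, by simp [last], ?_, ?_⟩
    · rw [last, if_neg (by simp), h₁]
    · rw [passed_succ_zero, h₃]
    · rw [passed_succ_zero, h₄]
  | skip _ hv hne ih =>
    obtain ⟨hp, -, t, rfl, rfl, rfl, rfl⟩ := ih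
    exact ⟨hp, hv, t, rfl, rfl, (passed_of_ne hne).symm, (passed_of_ne hne).symm⟩
  | attacked _ hv he h₁ h₂ ih =>
    obtain ⟨hp, -, t, rfl, rfl, rfl, rfl⟩ := ih
    subst he
    exact ⟨hp, hv, t, rfl, rfl, (passed_of_pos hv rfl ⟨h₁, h₂⟩).symm,
      (passed_of_not fun h => h₂.elim h.1 h.2).symm⟩
  | gained _ hv he h₁ h₂ ih =>
    obtain ⟨hp, -, t, rfl, rfl, rfl, rfl⟩ := ih
    subst he
    exact ⟨hp, hv, t, rfl, rfl, (passed_of_not fun h => h.2.elim h₁ h₂).symm,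
      (passed_of_pos hv rfl ⟨h₁, h₂⟩).symm⟩
  | lost _ hv he h₁ h₂ ih =>
    obtain ⟨hp, -, t, rfl, rfl, rfl, rfl⟩ := ih
    subst he
    exact ⟨hp, hv, t, rfl, rfl, (passed_of_not fun h => h₁ h.1).symm,
      (passed_of_not fun h => h₂.elim h.1 h.2).symm⟩

theorem Sweep.le {p v x y c g : ℕ} (h : Sweep n l r D p v x y c g) :
    p ≤ n ∧ v ≤ n ∧ x ≤ n ∧ y ≤ n ∧ c ≤ n ∧ g ≤ n := by
  obtain ⟨hp, hv, t, rfl, rfl, rfl, rfl⟩ := h.exists_eq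
  exact ⟨hp, hv, (last_le _ _).trans hp, (last_le _ _).trans hp, passed_le, passed_le⟩

/-- Every set `t` of points yields a state of the sweep. -/
theorem sweep_last (t : ℕ → Prop) {p : ℕ} (hp : p ≤ n) : Sweep n l r D p n (last t p)
    (last (fun q => ¬ t q) p) (passed n r (Attacked l r D t) p n)
    (passed n r (Gained l r D t) p n) := by
  induction p with
  | zero =>
    rw [passed_zero, passed_zero]
    exact .base
  | succ p ih =>
    have aux : ∀ v ≤ n, Sweep n l r D (p + 1) v (last t (p + 1)) (last (fun q => ¬ t q) (p + 1))
        (passed n r (Attacked l r D t) (p + 1) v) (passed n r (Gained l r D t) (p + 1) v) := by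
      intro v
      induction v with
      | zero =>
        intro _
        rw [passed_succ_zero, passed_succ_zero]
        by_cases ht : t p
        · have := (ih (by lia)).inside hp
          simpa [last, ht] using this
        · have := (ih (by lia)).outside hp
          simpa [last, ht] using this
      | succ v ihv =>
        intro hv
        have hs := ihv (by lia)
        by_cases he : r v + 1 = p + 1
        · by_cases h₂ : D v ∨ l v < last (fun q => ¬ t q) (p + 1)
          · rw [passed_of_not (P := Gained l r D t) fun h => h₂.elim h.1 (he ▸ h.2)]
            by_cases h₁ : l v < last t (p + 1)
            · rw [passed_of_pos hv he ⟨he ▸ h₁, he ▸ h₂⟩]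
              exact hs.attacked hv he h₁ h₂
            · rw [passed_of_not fun h => h₁ (he ▸ h.1)]
              exact hs.lost hv he h₁ h₂
          · rw [passed_of_not (P := Attacked l r D t) fun h => h₂ (he ▸ h.2)]
            rw [not_or] at h₂
            rw [passed_of_pos hv he ⟨h₂.1, he ▸ h₂.2⟩]
            exact hs.gained hv he h₂.1 h₂.2
        · rw [passed_of_ne he, passed_of_ne he]
          exact hs.skip hv he
    exact aux n le_rfl

end Sweep

open Classical in
theorem passed_self {n : ℕ} {r : ℕ → ℕ} {P : ℕ → Prop} (hr : ∀ v < n, r v < n) :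
    passed n r P n n = (Finset.univ.filter fun v : Fin n => P v).card := by
  rw [passed, ← Finset.card_map Fin.valEmbedding]
  congr 1
  ext w
  simp only [Finset.mem_filter, Finset.mem_range, Finset.mem_map, Finset.mem_univ, true_and,
    Fin.valEmbedding_apply]
  constructor
  · rintro ⟨h₁, -, h₂⟩
    exact ⟨⟨w, h₁⟩, h₂, rfl⟩
  · rintro ⟨v, h, rfl⟩
    have := hr v v.2
    exact ⟨v.2, by lia, h⟩

namespace Instance

/-- Adjacency in the graph of an instance, as a relation between natural numbers. -/
def adj (I : Instance) (u v : ℕ) : Prop := ∃ hu hv, I.G.Adj ⟨u, hu⟩ ⟨v, hv⟩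

/-- The defenders of an instance, as a set of natural numbers. -/
def IsDefender (I : Instance) (v : ℕ) : Prop := ∃ hv, ⟨v, hv⟩ ∈ I.D

/-- The left end of the interval of a vertex. -/
noncomputable def left (I : Instance) : ℕ → ℕ := IntervalOrder.left I.n I.adj

/-- The right end of the interval of a vertex. -/
noncomputable def right (I : Instance) : ℕ → ℕ := IntervalOrder.right I.n I.adj

theorem exists_represents {I : Instance} (h : IsIntervalGraph I.G) :
    ∃ p q, IntervalOrder.Represents I.n I.adj p q := by
  obtain ⟨a, b, hab, h⟩ := h
  refine ⟨fun v => if hv : v < I.n then a ⟨v, hv⟩ else 0,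
    fun v => if hv : v < I.n then b ⟨v, hv⟩ else 0, fun v hv => by simpa [hv] using hab _, ?_⟩
  intro u hu v hv
  simp only [hu, hv, dif_pos, adj, exists_true_left]
  by_cases huv : u = v
  · subst huv
    simp
  · rw [h _ _ (by simpa using huv), Set.Icc_inter_Icc, Set.nonempty_Icc]
    simp [huv, hab, and_comm]

/-- The answer to an instance can be read off from the final states of the sweep. -/
theorem isYes_iff_sweep {I : Instance} (hI : IsIntervalGraph I.G) :
    I.IsYes ↔ I.α ≤ I.n ∧ ∃ x y c g, Sweep I.n I.left I.right I.IsDefender I.n I.n x y c g ∧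
      c ≤ I.l ∧ I.α ≤ g + I.l := by
  classical
  obtain ⟨p, q, hr⟩ := exists_represents hI
  have hlt : ∀ v < I.n, I.right v < I.n := fun v hv => IntervalOrder.right_lt hr hv
  have hocc : ∀ (t : ℕ → Prop) (v : Fin I.n), I.left v < last t (I.right v + 1) ↔
      ∃ p, IntervalOrder.Occ I.n I.adj v p ∧ t p := by
    intro t v
    simp only [lt_last_iff, IntervalOrder.occ_iff hr, v.2, true_and, Nat.lt_succ_iff, and_assoc]
    rfl
  have hadj : ∀ u v : Fin I.n, (u = v ∨ I.G.Adj u v) ↔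
      ∃ p, IntervalOrder.Occ I.n I.adj u p ∧ IntervalOrder.Occ I.n I.adj v p := by
    intro u v
    rw [← IntervalOrder.eq_or_adj_iff hr u.2 v.2]
    simp [adj, Fin.ext_iff]
  have hD : ∀ v : Fin I.n, I.IsDefender v ↔ v ∈ I.D := fun v => by simp [IsDefender]
  rw [isYes_iff]
  refine and_congr_right fun _ => ⟨?_, ?_⟩
  · rintro ⟨U, hU, hl, hα⟩
    -- The points that are covered by the intervals of `U`.
    set t : ℕ → Prop := fun p => ∃ u ∈ U, IntervalOrder.Occ I.n I.adj u p with ht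
    refine ⟨_, _, _, _, sweep_last t le_rfl, ?_, ?_⟩
    · rw [passed_self hlt]
      refine (Finset.card_le_card fun v hv => ?_).trans hl
      simp only [Attacked, Finset.mem_filter, Finset.mem_univ, true_and, hocc, hD] at hv
      obtain ⟨⟨p, hp, u, hu, hup⟩, hv⟩ := hv
      have hvU : v ∉ U := by
        intro hvU
        rcases hv with hv | ⟨p', hp', hn⟩
        · exact Finset.disjoint_left.1 hU hvU hv
        · exact hn ⟨v, hvU, hp'⟩
      simp only [boundary, Finset.mem_filter, Finset.mem_univ, true_and]
      refine ⟨hvU, u, hu, ((hadj u v).2 ⟨p, hup, hp⟩).resolve_left ?_⟩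
      rintro rfl
      exact hvU hu
    · rw [passed_self hlt (P := Gained _ _ _ _)]
      refine hα.trans (Nat.add_le_add_right (Finset.card_le_card fun v hv => ?_) _)
      simp only [Gained, Finset.mem_filter, Finset.mem_univ, true_and, hocc, hD]
      exact ⟨Finset.disjoint_left.1 hU hv, fun ⟨p, hp, hn⟩ => hn ⟨v, hv, hp⟩⟩
  · rintro ⟨x, y, c, g, h, hl, hα⟩
    obtain ⟨-, -, t, rfl, rfl, rfl, rfl⟩ := h.exists_eq
    rw [passed_self hlt] at hl hα
    -- The set `U` consists of the gained vertices.
    refine ⟨_, ?_, (Finset.card_le_card fun v hv => ?_).trans hl, hα⟩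
    · rw [Finset.disjoint_left]
      intro v hv
      simp only [Gained, Finset.mem_filter, Finset.mem_univ, true_and, hD] at hv
      exact hv.1
    · simp only [boundary, Gained, Finset.mem_filter, Finset.mem_univ, true_and, hocc, hD,
        not_and_or, not_not] at hv
      simp only [Attacked, Finset.mem_filter, Finset.mem_univ, true_and, hocc, hD]
      obtain ⟨h₁, u, hu, huv⟩ := hv
      obtain ⟨p, hp, hp'⟩ := (hadj u v).1 (.inr huv)
      refine ⟨⟨p, hp', ?_⟩, h₁⟩
      by_contra hn
      exact hu.2 ⟨p, hp, hn⟩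

end Instance

end ControllerPlacement

namespace ControllerPlacement

open Computability (Γ' encodeNat encodeNum encodePosNum)

/-! ### Positions in the input string -/

/-- The number whose binary digits, least significant first, form the initial segment of bits. -/
def readBits : List Γ' → ℕ
  | Γ'.bit b :: l => 2 * readBits l + b.toNat
  | _ => 0

theorem readBits_map_append (m : ℕ) {l : List Γ'} (hl : readBits l = 0) :
    readBits ((encodeNat m).map Γ'.bit ++ l) = m := by
  have pos : ∀ k : PosNum, readBits ((encodePosNum k).map Γ'.bit ++ l) = k := by
    intro k
    induction k with
    | one => simp [encodePosNum, readBits, hl]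
    | bit1 k ih => simp [encodePosNum, readBits, ih]; lia
    | bit0 k ih => simp [encodePosNum, readBits, ih]; lia
  have num : ∀ k : Num, readBits ((encodeNum k).map Γ'.bit ++ l) = k := by
    rintro (_ | k)
    · simpa [encodeNum] using hl
    · exact pos k
  exact (num m).trans (Num.to_of_nat m)

theorem length_encodeNat_pos {m : ℕ} (hm : 0 < m) : 0 < (encodeNat m).length := by
  rw [List.length_pos_iff]
  rintro h
  have := readBits_map_append m (l := []) rfl
  rw [h] at this
  simp [readBits] at this
  lia

theorem getElem?_flatten {β : Type*} {k : ℕ} {L : List (List β)} (h : ∀ l ∈ L, l.length = k)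
    {u j : ℕ} (hj : j < k) : L.flatten[u * k + j]? = L[u]?.bind (·[j]?) := by
  induction L generalizing u with
  | nil => simp
  | cons l L ih =>
    have hl := h l (by simp)
    rw [List.flatten_cons]
    cases u with
    | zero => simp [List.getElem?_append, hl, hj]
    | succ u =>
      rw [List.getElem?_append_right (by rw [hl, Nat.succ_mul]; lia), hl,
        List.getElem?_cons_succ, ← ih fun l hl => h l (by simp [hl])]
      congr 1
      rw [Nat.succ_mul]
      lia

namespace Instance

variable {I : Instance}

theorem length_row (I : Instance) (v : Fin I.n) : (I.row v).length = I.n + 2 := by simp [row]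

theorem length_flatten_row (I : Instance) :
    (List.ofFn I.row).flatten.length = I.n * (I.n + 2) := by
  simp [List.map_ofFn, Function.comp_def, length_row]

theorem le_length_encode (I : Instance) : I.n * (I.n + 2) + 4 ≤ I.encode.length := by
  have h₁ := length_encodeNat_pos I.l_pos
  have h₂ := length_encodeNat_pos I.α_pos
  rw [encode, List.length_append, length_flatten_row]
  simp only [List.length_cons, List.length_append, List.length_map]
  lia

theorem encode_mul_add {u j : ℕ} (hu : u < I.n) (hj : j < I.n + 2) :
    I.encode[u * (I.n + 2) + j]? = (I.row ⟨u, hu⟩)[j]? := by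
  rw [encode, List.getElem?_append_left, getElem?_flatten _ hj]
  · simp [hu]
  · simp [List.mem_ofFn, length_row]
  · rw [length_flatten_row]
    have := Nat.mul_le_mul_right (I.n + 2) (Nat.succ_le_of_lt hu)
    rw [Nat.succ_mul] at this
    lia

theorem encode_bra {p : ℕ} : I.encode[p]? = some Γ'.bra ↔ ∃ u < I.n, p = u * (I.n + 2) := by
  by_cases hp : p < I.n * (I.n + 2)
  · obtain ⟨u, j, hj, rfl⟩ : ∃ u j, j < I.n + 2 ∧ p = u * (I.n + 2) + j :=
      ⟨p / (I.n + 2), p % (I.n + 2), Nat.mod_lt _ (by lia), (Nat.div_add_mod' _ _).symm⟩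
    have hu : u < I.n := by
      by_contra! hu
      have := Nat.mul_le_mul_right (I.n + 2) hu
      lia
    rw [encode_mul_add hu hj]
    constructor
    · rcases j with _ | _ | j
      · exact fun _ => ⟨u, hu, rfl⟩
      · simp [row]
      · simp [row]
    · rintro ⟨u', hu', h⟩
      have : j = 0 := by
        have := congrArg (· % (I.n + 2)) h
        simpa [Nat.mod_eq_of_lt hj] using this
      subst this
      rfl
  · constructor
    · intro h
      rw [encode, List.getElem?_append_right (by rw [length_flatten_row]; lia)] at h
      have := List.mem_of_getElem? h
      simp at this
    · rintro ⟨u, hu, rfl⟩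
      exact absurd (Nat.mul_lt_mul_of_pos_right hu (by lia)) hp

theorem encode_defender {u : ℕ} (hu : u < I.n) :
    I.encode[u * (I.n + 2) + 1]? = some (Γ'.bit true) ↔ I.IsDefender u := by
  rw [encode_mul_add hu (by lia)]
  simp [row, IsDefender, hu]

theorem encode_adj {u v : ℕ} (hu : u < I.n) (hv : v < I.n) :
    I.encode[u * (I.n + 2) + v + 2]? = some (Γ'.bit true) ↔ I.adj u v := by
  rw [add_assoc, encode_mul_add hu (by lia)]
  simp [row, adj, hu, hv]

/-- There are exactly two commas in the input string, each followed by a binary number. -/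
theorem encode_comma (I : Instance) : ∃ e, I.n * (I.n + 2) < e ∧ e < I.encode.length ∧
    (∀ p, I.encode[p]? = some Γ'.comma ↔ p = I.n * (I.n + 2) ∨ p = e) ∧
    readBits (I.encode.drop (I.n * (I.n + 2) + 1)) = I.l ∧
    readBits (I.encode.drop (e + 1)) = I.α := by
  have hlen := length_flatten_row I
  refine ⟨I.n * (I.n + 2) + 1 + (encodeNat I.l).length, by lia, ?_, ?_, ?_, ?_⟩
  · rw [encode, List.length_append, hlen]
    simp only [List.length_cons, List.length_append, List.length_map]
    lia
  · intro p
    rw [encode]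
    by_cases hp : p < I.n * (I.n + 2)
    · rw [List.getElem?_append_left (by lia)]
      refine iff_of_false (fun h => ?_) (by lia)
      have := List.mem_of_getElem? h
      simp [row, List.mem_ofFn] at this
    · obtain ⟨q, rfl⟩ := Nat.exists_eq_add_of_le (not_lt.1 hp)
      rw [List.getElem?_append_right (by lia), hlen, Nat.add_sub_cancel_left]
      rcases q with _ | q
      · simp
      · rw [List.getElem?_cons_succ]
        by_cases hq : q < (encodeNat I.l).length
        · rw [List.getElem?_append_left (by simpa)]
          refine iff_of_false (fun h => ?_) (by lia)
          have := List.mem_of_getElem? h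
          simp at this
        · obtain ⟨j, rfl⟩ := Nat.exists_eq_add_of_le (not_lt.1 hq)
          rw [List.getElem?_append_right (by simp), List.length_map, Nat.add_sub_cancel_left]
          rcases j with _ | j
          · simp; lia
          · rw [List.getElem?_cons_succ]
            refine iff_of_false (fun h => ?_) (by lia)
            have := List.mem_of_getElem? h
            simp at this
  · rw [encode, List.drop_append, hlen, List.drop_eq_nil_of_le (by lia),
      show I.n * (I.n + 2) + 1 - I.n * (I.n + 2) = 1 by lia, List.nil_append, List.drop_succ_cons,
      List.drop_zero]
    exact readBits_map_append _ rfl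
  · rw [encode, List.drop_append, hlen, List.drop_eq_nil_of_le (by lia),
      show I.n * (I.n + 2) + 1 + (encodeNat I.l).length + 1 - I.n * (I.n + 2) =
        (encodeNat I.l).length + 1 + 1 by lia, List.nil_append, List.drop_succ_cons,
      List.drop_append, List.drop_eq_nil_of_le (by simp), List.length_map,
      Nat.add_sub_cancel_left, List.nil_append, List.drop_succ_cons, List.drop_zero]
    simpa using readBits_map_append I.α (l := []) rfl

end Instance

end ControllerPlacement

namespace ControllerPlacement

open Computability (Γ')
open StackCode

/-! ### A program for interval graphs -/

/-- The variables of the program. The variable `o` is never bound and has the value `0`. -/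
inductive Var
  | o | p | q | u | v | w | x | y | z | m | i | c | g
  deriving DecidableEq

instance : Fintype Var :=
  .ofList [.o, .p, .q, .u, .v, .w, .x, .y, .z, .m, .i, .c, .g] fun a => by cases a <;> decide

/-- The tables of the program. -/
inductive Tab
  | bra | comma | bit | size | row | value | loss | goal | edge | defender | nonadj | forces
  | before | count | left | occ | right | sweep
  deriving DecidableEq

instance : Fintype Tab :=
  .ofList [.bra, .comma, .bit, .size, .row, .value, .loss, .goal, .edge, .defender, .nonadj,
    .forces, .before, .count, .left, .occ, .right, .sweep] fun a => by cases a <;> decide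

namespace Tab

open Fml

/-- The symbols at the positions of the input string. -/
noncomputable def input : Tab → Γ' → Bool
  | bra, a => a = Γ'.bra
  | comma, a => a = Γ'.comma
  | bit, a => a = Γ'.bit true
  | _, _ => false

/-- The variables that stand for the arguments of a table. -/
def vars : Tab → List Var
  | bra | comma | bit => [.p]
  | size => [.m]
  | row => [.u, .p]
  | value => [.p, .x]
  | loss | goal => [.x]
  | edge | nonadj | before => [.u, .v]
  | defender => [.u]
  | forces => [.u, .v, .w, .z]
  | count => [.v, .u, .c]
  | left | occ | right => [.v, .p]
  | sweep => [.p, .v, .x, .y, .c, .g]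

/-- The formulas that define the tables. Those of `row`, `value`, `forces`, `count` and `sweep` refer
to the table itself and are read as inductive definitions; `row` relates `u` to the position at which
the block of the vertex `u` starts, and `value` relates a position to the number that starts there.
The formula `¬ ∃ z, x < z` in the definition of `value` says that `x` is the greatest element of the
domain. -/
def body : Tab → Fml Var Tab
  | bra | comma | bit => .lt 0 [] []
  | size => .or (.and (.rd comma [.o]) (.eq 0 [.m] []))
      (.and (.neg (.rd comma [.o])) (.ex .p (.and (.eq 2 [.m] [.p])
        (.and (.or (.rd bra [.p]) (.rd comma [.p]))
          (.all .q (.imp (.and (.lt 0 [] [.q]) (.lt 0 [.q] [.p]))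
            (.neg (.or (.rd bra [.q]) (.rd comma [.q])))))))))
  | row => .or (.and (.eq 0 [.u] []) (.eq 0 [.p] []))
      (exs [.v, .q, .m] (conj [.eq 1 [.v] [.u], .rd row [.v, .q], .rd size [.m],
        .eq 2 [.q, .m] [.p]]))
  | value => .or
      (.and (disj [.rd bra [.p], .rd comma [.p], .neg (.ex .q (.eq 1 [.p] [.q]))])
        (.eq 0 [.x] []))
      (conj [.neg (.rd bra [.p]), .neg (.rd comma [.p]),
        exs [.q, .y] (conj [.eq 1 [.p] [.q], .rd value [.q, .y],
          .or (.and (.rd bit [.p]) (.or (.eq 1 [.y, .y] [.x])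
              (.and (.neg (.lt 0 [.y, .y] [.x])) (.neg (.ex .z (.lt 0 [.x] [.z]))))))
            (.and (.neg (.rd bit [.p])) (.or (.eq 0 [.y, .y] [.x])
              (.and (.lt 0 [.x] [.y, .y]) (.neg (.ex .z (.lt 0 [.x] [.z]))))))])])
  | loss => exs [.p, .q] (conj [.rd comma [.p], .eq 1 [.p] [.q], .rd value [.q, .x],
      .neg (.ex .z (.and (.lt 0 [.z] [.p]) (.rd comma [.z])))])
  | goal => exs [.p, .q] (conj [.rd comma [.p], .eq 1 [.p] [.q], .rd value [.q, .x],
      .ex .z (.and (.lt 0 [.z] [.p]) (.rd comma [.z]))])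
  | edge => exs [.p, .q, .m] (conj [.rd row [.u, .p], .rd size [.m], .lt 0 [.u] [.m],
      .lt 0 [.v] [.m], .eq 2 [.p, .v] [.q], .rd bit [.q]])
  | defender => exs [.p, .q, .m] (conj [.rd row [.u, .p], .rd size [.m], .lt 0 [.u] [.m],
      .eq 1 [.p] [.q], .rd bit [.q]])
  | nonadj => .ex .m (conj [.rd size [.m], .lt 0 [.u] [.m], .lt 0 [.v] [.m],
      .neg (.eq 0 [.u] [.v]), .neg (.rd edge [.u, .v])])
  | forces => disj [conj [.eq 0 [.u] [.w], .eq 0 [.v] [.z], .rd nonadj [.u, .v]],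
      .and (.rd nonadj [.w, .z])
        (.ex .x (.and (.rd forces [.u, .v, .x, .z]) (.rd edge [.x, .w]))),
      .and (.rd nonadj [.w, .z])
        (.ex .x (.and (.rd forces [.u, .v, .w, .x]) (.rd edge [.x, .z])))]
  | before => exs [.w, .z] (conj [.lt 0 [.w] [.z], .rd forces [.u, .v, .w, .z],
      .all .x (.all .y (.imp (.and (.lt 0 [.x] [.y])
          (.or (.rd forces [.u, .v, .x, .y]) (.rd forces [.u, .v, .y, .x])))
        (.or (.lt 0 [.w] [.x]) (.and (.eq 0 [.w] [.x]) (.neg (.lt 0 [.y] [.z]))))))])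
  | count => .or (.and (.eq 0 [.u] []) (.eq 0 [.c] [])) (.ex .w (.and (.eq 1 [.w] [.u])
      (.or (.and (.rd before [.w, .v]) (.ex .y (.and (.eq 1 [.y] [.c]) (.rd count [.v, .w, .y]))))
        (.and (.neg (.rd before [.w, .v])) (.rd count [.v, .w, .c])))))
  | left => .ex .m (.and (.rd size [.m]) (.rd count [.v, .m, .p]))
  | occ => exs [.m, .q] (conj [.rd size [.m], .lt 0 [.v] [.m], .rd left [.v, .q],
      .neg (.lt 0 [.p] [.q]), .lt 0 [.p] [.m],
      .all .w (.all .z (.imp (conj [.lt 0 [.w] [.m], .rd before [.v, .w], .rd left [.w, .z]])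
        (.lt 0 [.p] [.z])))])
  | right => .and (.rd occ [.v, .p]) (.neg (.ex .q (.and (.eq 1 [.p] [.q]) (.rd occ [.v, .q]))))
  | sweep => disj [
      .ex .m (conj [.rd size [.m], .eq 0 [.p] [], .eq 0 [.v] [.m], .eq 0 [.x] [], .eq 0 [.y] [],
        .eq 0 [.c] [], .eq 0 [.g] []]),
      exs [.m, .q, .z] (conj [.rd size [.m], .eq 1 [.q] [.p], .lt 0 [.q] [.m], .eq 0 [.v] [],
        .or (.and (.eq 0 [.x] [.p]) (.rd sweep [.q, .m, .z, .y, .c, .g]))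
          (.and (.eq 0 [.y] [.p]) (.rd sweep [.q, .m, .x, .z, .c, .g]))]),
      exs [.m, .w] (conj [.rd size [.m], .eq 1 [.w] [.v], .lt 0 [.w] [.m],
        .rd sweep [.p, .w, .x, .y, .c, .g],
        .neg (.ex .q (.and (.rd right [.w, .q]) (.eq 1 [.q] [.p])))]),
      exs [.m, .w, .q, .i, .z] (conj [.rd size [.m], .eq 1 [.w] [.v], .lt 0 [.w] [.m],
        .rd right [.w, .q], .eq 1 [.q] [.p], .rd left [.w, .i],
        disj [
          conj [.eq 1 [.z] [.c], .rd sweep [.p, .w, .x, .y, .z, .g], .lt 0 [.i] [.x],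
            .or (.rd defender [.w]) (.lt 0 [.i] [.y])],
          conj [.eq 1 [.z] [.g], .rd sweep [.p, .w, .x, .y, .c, .z], .neg (.rd defender [.w]),
            .neg (.lt 0 [.i] [.y])],
          conj [.rd sweep [.p, .w, .x, .y, .c, .g], .neg (.lt 0 [.i] [.x]),
            .or (.rd defender [.w]) (.lt 0 [.i] [.y])]]])]

/-- The formula for the answer in terms of the tables. -/
def answer : Fml Var Tab :=
  exs [.m, .x, .y, .c, .g, .u, .v] (conj [.rd size [.m], .rd sweep [.m, .m, .x, .y, .c, .g],
    .rd loss [.u], .rd goal [.v], .neg (.lt 0 [.m] [.v]), .neg (.lt 0 [.u] [.c]),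
    .neg (.lt 0 [.g, .u] [.v])])

/-- A table that is defined without reference to itself. -/
def define (a : Tab) : Prog Var Tab := .defn a a.vars a.body

/-- A table that is defined by induction. -/
def induct (a : Tab) : Prog Var Tab := .lfp a a.vars a.body

/-- The program: each table is computed from the preceding ones. -/
def prog : Prog Var Tab :=
  .seq size.define <| .seq row.induct <| .seq value.induct <| .seq loss.define <|
  .seq goal.define <| .seq edge.define <| .seq defender.define <| .seq nonadj.define <|
  .seq forces.induct <| .seq before.define <| .seq count.induct <| .seq left.define <|
  .seq occ.define <| .seq right.define sweep.induct

theorem prog_ok : prog.Ok := by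
  simp [prog, Prog.Ok, define, induct, Prog.ok_lfp, vars]

/-- The intended contents of the tables. The domain consists of the numbers up to the length of the
input string; binary numbers in the input are cut off at this length. -/
noncomputable def meaning (I : Instance) : Tab → List ℕ → Prop
  | bra, [p] => I.encode[p]? = some Γ'.bra
  | comma, [p] => I.encode[p]? = some Γ'.comma
  | bit, [p] => I.encode[p]? = some (Γ'.bit true)
  | size, [m] => m = I.n
  | row, [u, p] => p = u * (I.n + 2)
  | value, [p, x] => x = min (readBits (I.encode.drop p)) I.encode.length
  | loss, [x] => x = min I.l I.encode.length
  | goal, [x] => x = min I.α I.encode.length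
  | edge, [u, v] => I.adj u v
  | defender, [u] => I.IsDefender u
  | nonadj, [u, v] => IntervalOrder.NonAdj I.n I.adj u v
  | forces, [u, v, w, z] => IntervalOrder.Forces I.n I.adj u v w z
  | before, [u, v] => IntervalOrder.Before I.n I.adj u v
  | count, [v, u, c] => c = @Nat.count (fun w => IntervalOrder.Before I.n I.adj w v)
      (Classical.decPred _) u
  | left, [v, p] => p = I.left v
  | occ, [v, p] => IntervalOrder.Occ I.n I.adj v p
  | right, [v, p] => v < I.n ∧ p = I.right v
  | sweep, [p, v, x, y, c, g] => Sweep I.n I.left I.right I.IsDefender p v x y c g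
  | _, _ => False

/-- The table `a` has the intended contents in `s`. -/
def Correct (I : Instance) (s : Tab → List Bool) (a : Tab) : Prop :=
  ∀ vs, Valid (I.encode.length + 1) a.vars.length vs →
    (Holds (I.encode.length + 1) (s a) vs ↔ meaning I a vs)

/-- The tables in `as` have the intended contents, and the other tables are empty. -/
def Done (I : Instance) (as : List Tab) (s : Tab → List Bool) : Prop :=
  (∀ a ∈ as, Correct I s a) ∧ ∀ a ∉ as, ∀ p, (s a).getD p false = false

/-- The formula for the table `a` describes the intended contents. -/
def Defined (I : Instance) (s : Tab → List Bool) (a : Tab) : Prop :=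
  ∀ vs, Valid (I.encode.length + 1) a.vars.length vs →
    (a.body.Sat (I.encode.length + 1) s (assign (fun _ => 0) a.vars vs) ↔ meaning I a vs)

/-- The formula for the table `a` leads from intended entries of `a` to intended entries only. -/
def Sound (I : Instance) (s : Tab → List Bool) (a : Tab) : Prop :=
  (∀ vs, Valid (I.encode.length + 1) a.vars.length vs →
    Holds (I.encode.length + 1) (s a) vs → meaning I a vs) →
  ∀ vs, Valid (I.encode.length + 1) a.vars.length vs →
    a.body.Sat (I.encode.length + 1) s (assign (fun _ => 0) a.vars vs) → meaning I a vs

/-- If the table `a` is closed under the formula for it, then it has all intended entries. -/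
def Complete (I : Instance) (s : Tab → List Bool) (a : Tab) : Prop :=
  (∀ vs, Valid (I.encode.length + 1) a.vars.length vs →
    a.body.Sat (I.encode.length + 1) s (assign (fun _ => 0) a.vars vs) →
    Holds (I.encode.length + 1) (s a) vs) →
  ∀ vs, Valid (I.encode.length + 1) a.vars.length vs → meaning I a vs →
    Holds (I.encode.length + 1) (s a) vs

variable {I : Instance} {as : List Tab} {s : Tab → List Bool} {a : Tab}

theorem Done.update (h : Done I as s) (ha : a ∉ as) {l : List Bool}
    (hl : ∀ vs, Valid (I.encode.length + 1) a.vars.length vs →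
      (Holds (I.encode.length + 1) l vs ↔ meaning I a vs)) :
    Done I (a :: as) (Function.update s a l) := by
  refine ⟨fun b hb => ?_, fun b hb => ?_⟩
  · rcases List.mem_cons.1 hb with rfl | hb'
    · simpa [Correct] using hl
    · have : b ≠ a := by rintro rfl; exact ha hb'
      simpa [Correct, this] using h.1 b hb'
  · rw [List.mem_cons, not_or] at hb
    simpa [Function.update_of_ne hb.1] using h.2 b hb.2

/-- The effect of computing a table by an explicit definition. -/
theorem Done.define (h : Done I as s) (ha : a ∉ as)
    (hφ : (∀ b ∈ as, Correct I s b) → Defined I s a) :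
    Done I (a :: as) (a.define.run (I.encode.length + 1) s) := by
  obtain ⟨l, hl, hl'⟩ := Prog.exists_run_defn (I.encode.length + 1) s a a.vars a.body
  rw [Tab.define, hl]
  exact h.update ha fun vs hvs => (hl' vs hvs).trans (hφ h.1 vs hvs)

/-- The effect of computing a table by an inductive definition. -/
theorem Done.induct (h : Done I as s) (ha : a ∉ as)
    (sound : ∀ s, (∀ b ∈ as, Correct I s b) → Sound I s a)
    (complete : ∀ s, (∀ b ∈ as, Correct I s b) → Complete I s a) :
    Done I (a :: as) (a.induct.run (I.encode.length + 1) s) := by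
  have hc : ∀ l, ∀ b ∈ as, Correct I (Function.update s a l) b := by
    intro l b hb
    have : b ≠ a := by rintro rfl; exact ha hb
    simpa [Correct, this] using h.1 b hb
  obtain ⟨l, hl, hl'⟩ := Prog.exists_run_lfp (I.encode.length + 1) s a a.vars a.body
    (by cases a <;> simp [vars]) (h.2 a ha) (meaning I a)
    (fun l hs => sound _ (hc l) (by simpa using hs))
    (fun l hs => by simpa using complete _ (hc l) (by simpa using hs))
  rw [Tab.induct, hl]
  exact h.update ha hl'

end Tab

end ControllerPlacement

namespace ControllerPlacement

open Computability (Γ')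
open StackCode

namespace Tab

/-! ### The contents of the tables -/

/-- The first member of a conjunction may be assumed when the second one is simplified. -/
theorem and_congr_of_imp {a b c d : Prop} (h₁ : a = c) (h₂ : c → b = d) : (a ∧ b) = (c ∧ d) := by
  subst h₁
  exact propext (and_congr_right fun h => (h₂ h).to_iff)

attribute [local congr] and_congr_of_imp

variable {I : Instance} {s : Tab → List Bool}

theorem sat_size (h₁ : Correct I s bra) (h₂ : Correct I s comma) : Defined I s size := by
  have hle := I.le_length_encode
  obtain ⟨e, he, heN, hcomma, -, -⟩ := I.encode_comma
  simp only [Correct, Defined, vars, List.length_cons, List.length_nil, forall_valid_succ,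
    forall_valid_zero, meaning, Order.lt_add_one_iff, Instance.encode_bra, hcomma] at *
  generalize I.encode.length = N at *
  intro m hm
  simp [body, assign]
  simp +contextual only [h₁, h₂, Nat.zero_le]
  -- Apart from the position `0`, the first bracket or comma is at the position `n + 2`.
  have hmin : 0 < I.n → ∀ i, 0 < i → ((∃ u < I.n, i = u * (I.n + 2)) ∨ i = I.n * (I.n + 2) ∨ i = e) →
      I.n + 2 ≤ i := by
    intro hn i hi h
    have h₀ : I.n + 2 ≤ I.n * (I.n + 2) := Nat.le_mul_of_pos_left _ hn
    rcases h with ⟨u, -, rfl⟩ | rfl | rfl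
    · exact Nat.le_mul_of_pos_left _ (Nat.pos_of_mul_pos_right hi)
    · exact h₀
    · lia
  have hex : 0 < I.n → (∃ u < I.n, 2 + I.n = u * (I.n + 2)) ∨ 2 + I.n = I.n * (I.n + 2) ∨
      2 + I.n = e := by
    intro hn
    rcases Nat.lt_or_ge 1 I.n with h | h
    · exact .inl ⟨1, h, by lia⟩
    · have : I.n = 1 := by lia
      rw [this]
      simp
  have h0 : (0 = I.n * (I.n + 2) ∨ 0 = e) ↔ I.n = 0 := by
    constructor
    · rintro (h | h)
      · simpa using h.symm
      · lia
    · intro h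
      simp [h]
  rw [h0]
  constructor
  · rintro (⟨h, rfl⟩ | ⟨h, hm, h₃, h₄⟩)
    · exact h.symm
    · have h₅ := hmin (by lia) _ (by lia) h₃
      by_contra hne
      have h₆ := h₄ (2 + I.n) (by lia) (by lia) (by lia)
      rcases hex (by lia) with h₇ | h₇
      exacts [h₆.1 h₇, h₆.2 h₇]
  · rintro rfl
    rcases Nat.eq_zero_or_pos I.n with hn | hn
    · exact .inl ⟨hn, hn⟩
    · have h₀ : I.n + 2 ≤ I.n * (I.n + 2) := Nat.le_mul_of_pos_left _ hn
      refine .inr ⟨by lia, by lia, hex hn, fun i _ hi hi' => ?_⟩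
      rw [← not_or]
      intro h
      have := hmin hn i hi h
      lia

theorem n_lt_length (I : Instance) : I.n < I.encode.length := by
  have := I.le_length_encode
  have := Nat.le_mul_of_pos_right I.n (show 0 < I.n + 2 by lia)
  lia

theorem row_sound (h₁ : Correct I s size) : Sound I s row := by
  intro h
  simp only [Correct, vars, List.length_cons, List.length_nil, forall_valid_succ,
    forall_valid_zero, meaning, Order.lt_add_one_iff] at *
  intro u hu p hp
  simp [body, assign, Fml.exs]
  simp +contextual only [h₁]
  rintro (⟨rfl, rfl⟩ | ⟨v, hv, q, hq, _, _, rfl, hr, rfl, rfl⟩)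
  · simp
  · rw [h v hv q hq hr]
    ring

theorem row_complete (h₁ : Correct I s size) : Complete I s row := by
  intro h
  have hn := (n_lt_length I).le
  simp only [Correct, vars, List.length_cons, List.length_nil, forall_valid_succ,
    forall_valid_zero, meaning, Order.lt_add_one_iff] at *
  intro u
  induction u with
  | zero =>
    rintro hu p hp rfl
    refine h 0 hu _ hp ?_
    simp [body, assign]
  | succ u ih =>
    rintro hu p hp rfl
    rw [Nat.succ_mul] at hp ⊢
    refine h _ hu _ hp ?_
    have := ih (by lia) _ (by lia) rfl
    simp [body, assign, Fml.exs]
    exact ⟨u, by lia, u * (I.n + 2), by lia, I.n, hn, by lia, this, (h₁ _ hn).2 rfl, by lia⟩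

/-- The recursion for the numbers that start at the positions of the input string. -/
theorem readBits_drop {p : ℕ} (hp : p ≤ I.encode.length) :
    ((I.encode[p]? = some Γ'.bra ∨ I.encode[p]? = some Γ'.comma ∨ I.encode.length < 1 + p) ∧
      readBits (I.encode.drop p) = 0) ∨
    (¬ I.encode[p]? = some Γ'.bra ∧ ¬ I.encode[p]? = some Γ'.comma ∧ 1 + p ≤ I.encode.length ∧
      (I.encode[p]? = some (Γ'.bit true) ∧
        readBits (I.encode.drop p) = 2 * readBits (I.encode.drop (1 + p)) + 1 ∨
      ¬ I.encode[p]? = some (Γ'.bit true) ∧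
        readBits (I.encode.drop p) = 2 * readBits (I.encode.drop (1 + p)))) := by
  rcases hp.eq_or_lt with rfl | hp
  · exact .inl ⟨by simp, by simp [readBits]⟩
  · have hmem : I.encode[p] = Γ'.bra ∨ I.encode[p] = Γ'.comma ∨ ∃ b, I.encode[p] = Γ'.bit b := by
      have := List.getElem_mem hp
      generalize I.encode[p] = a at *
      simp [Instance.encode, Instance.row, List.mem_ofFn] at this
      grind
    rw [List.drop_eq_getElem_cons hp, List.getElem?_eq_getElem hp, add_comm 1 p]
    rcases hmem with h | h | ⟨b, h⟩ <;> rw [h]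
    · exact .inl ⟨.inl rfl, rfl⟩
    · exact .inl ⟨.inr (.inl rfl), rfl⟩
    · cases b
      · exact .inr ⟨by simp, by simp, hp, .inr ⟨by simp, by simp [readBits]⟩⟩
      · exact .inr ⟨by simp, by simp, hp, .inl ⟨rfl, by simp [readBits]⟩⟩

theorem value_sound (h₁ : Correct I s bra) (h₂ : Correct I s comma) (h₃ : Correct I s bit) :
    Sound I s value := by
  intro h
  simp only [Correct, vars, List.length_cons, List.length_nil, forall_valid_succ,
    forall_valid_zero, meaning, Order.lt_add_one_iff] at *
  intro p hp x hx
  simp [body, assign, Fml.exs]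
  simp +contextual only [h₁, h₂, h₃, hp]
  have hrec := readBits_drop hp
  rintro (⟨h₄, rfl⟩ | ⟨h₄, h₅, h₆, y, hy, hv, h₇⟩)
  · rcases hrec with hrec | hrec
    · simp [hrec.2]
    · rcases h₄ with h₄ | h₄ | h₄
      exacts [absurd h₄ hrec.1, absurd h₄ hrec.2.1, absurd hrec.2.2.1 (not_le.2 h₄)]
  · have hy' := h _ h₆ y hy hv
    rcases hrec with ⟨hrec, -⟩ | ⟨-, -, -, hrec⟩
    · rcases hrec with h₈ | h₈ | h₈
      exacts [absurd h₈ h₄, absurd h₈ h₅, absurd h₆ (not_le.2 h₈)]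
    · rcases h₇ with ⟨hb, h₇⟩ | ⟨hb, h₇⟩
      · have := (hrec.resolve_right fun h => h.1 hb).2
        rcases h₇ with h₇ | ⟨h₇, h₈⟩
        · lia
        · have := h₈ _ le_rfl
          lia
      · have := (hrec.resolve_left fun h => hb h.1).2
        rcases h₇ with h₇ | ⟨h₇, h₈⟩
        · lia
        · have := h₈ _ le_rfl
          lia

theorem value_complete (h₁ : Correct I s bra) (h₂ : Correct I s comma) (h₃ : Correct I s bit) :
    Complete I s value := by
  intro h
  simp only [Correct, vars, List.length_cons, List.length_nil, forall_valid_succ,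
    forall_valid_zero, meaning, Order.lt_add_one_iff] at *
  -- Induction on the distance to the end of the input string.
  suffices ∀ k p, p + k = I.encode.length → Holds (I.encode.length + 1) (s value)
      [p, min (readBits (I.encode.drop p)) I.encode.length] by
    rintro p hp _ _ rfl
    exact this (I.encode.length - p) p (by lia)
  intro k
  induction k with
  | zero =>
    rintro p hp
    refine h p (by lia) _ (by lia) ?_
    simp [body, assign, Fml.exs]
    refine .inl ⟨.inr (.inr (by lia)), ?_⟩
    rw [List.drop_eq_nil_of_le (by lia)]
    exact .inl rfl
  | succ k ih =>
    intro p hp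
    have hs := ih (1 + p) (by lia)
    refine h p (by lia) _ (by lia) ?_
    simp only [body, assign, Fml.exs, Fml.sat_or, Fml.sat_and, Fml.sat_disj, Fml.sat_conj]
    simp [-le_inf_iff, -inf_lt_iff, -lt_inf_iff, -inf_le_iff]
    simp +contextual only [h₁, h₂, h₃, show p ≤ I.encode.length by lia]
    rcases readBits_drop (show p ≤ I.encode.length by lia) with hr | ⟨h₄, h₅, h₆, hr⟩
    · refine .inl ⟨hr.1, by simp [hr.2]⟩
    · refine .inr ⟨h₄, h₅, h₆, _, min_le_right _ _, hs, ?_⟩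
      rcases hr with ⟨hb, hr⟩ | ⟨hb, hr⟩
      · refine .inl ⟨hb, ?_⟩
        generalize readBits (I.encode.drop (1 + p)) = r at *
        rw [hr]
        by_cases hr' : 2 * r + 1 ≤ I.encode.length
        · left; lia
        · right; exact ⟨by lia, fun z hz => by lia⟩
      · refine .inr ⟨hb, ?_⟩
        generalize readBits (I.encode.drop (1 + p)) = r at *
        rw [hr]
        by_cases hr' : 2 * r ≤ I.encode.length
        · left; lia
        · right; exact ⟨by lia, fun z hz => by lia⟩

theorem sat_loss (h₁ : Correct I s comma) (h₂ : Correct I s value) : Defined I s loss := by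
  obtain ⟨e, he, heN, hcomma, hl, -⟩ := I.encode_comma
  simp only [Correct, Defined, vars, List.length_cons, List.length_nil, forall_valid_succ,
    forall_valid_zero, meaning, Order.lt_add_one_iff, hcomma] at *
  intro x hx
  simp [body, assign, Fml.exs]
  simp +contextual only [h₁, h₂, hx]
  constructor
  · rintro ⟨p, -, -, hp | hp, rfl, h⟩
    · rw [hp, add_comm 1, hl]
    · exact absurd (.inl rfl) (h _ (by lia) (hp ▸ he))
  · rintro rfl
    exact ⟨_, by lia, by lia, .inl rfl, by rw [add_comm 1, hl], fun z _ hz => by lia⟩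

theorem sat_goal (h₁ : Correct I s comma) (h₂ : Correct I s value) : Defined I s goal := by
  obtain ⟨e, he, heN, hcomma, -, hα⟩ := I.encode_comma
  simp only [Correct, Defined, vars, List.length_cons, List.length_nil, forall_valid_succ,
    forall_valid_zero, meaning, Order.lt_add_one_iff, hcomma] at *
  intro x hx
  simp [body, assign, Fml.exs]
  simp +contextual only [h₁, h₂, hx]
  constructor
  · rintro ⟨p, -, -, hp | hp, rfl, z, -, hz, h⟩
    · lia
    · rw [hp, add_comm 1, hα]
  · rintro rfl
    exact ⟨_, heN.le, by lia, .inr rfl, by rw [add_comm 1, hα], _, by lia, he, .inl rfl⟩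

theorem row_add_lt {u v : ℕ} (hu : u < I.n) (hv : v < I.n) :
    u * (I.n + 2) + v + 2 < I.encode.length := by
  have := I.le_length_encode
  have := Nat.mul_le_mul_right (I.n + 2) (Nat.succ_le_of_lt hu)
  rw [Nat.succ_mul] at this
  lia

theorem sat_edge (h₁ : Correct I s row) (h₂ : Correct I s size) (h₃ : Correct I s bit) :
    Defined I s edge := by
  have hn := (n_lt_length I).le
  simp only [Correct, Defined, vars, List.length_cons, List.length_nil, forall_valid_succ,
    forall_valid_zero, meaning, Order.lt_add_one_iff] at *
  intro u hu v hv
  simp [body, assign, Fml.exs]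
  simp +contextual only [h₁, h₂, hu]
  constructor
  · rintro ⟨p, -, hp, m, -, rfl, rfl, hu, hv, h⟩
    rw [h₃ _ hp] at h
    rw [← Instance.encode_adj hu hv, ← h]
    congr 1
    lia
  · rintro h
    obtain ⟨hu, hv, -⟩ := id h
    have := row_add_lt hu hv
    refine ⟨u * (I.n + 2), by lia, by lia, I.n, hn, rfl, rfl, hu, hv, ?_⟩
    rw [h₃ _ (by lia), show 2 + (u * (I.n + 2) + v) = u * (I.n + 2) + v + 2 by lia]
    exact (Instance.encode_adj hu hv).2 h

theorem sat_defender (h₁ : Correct I s row) (h₂ : Correct I s size) (h₃ : Correct I s bit) :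
    Defined I s defender := by
  have hn := (n_lt_length I).le
  simp only [Correct, Defined, vars, List.length_cons, List.length_nil, forall_valid_succ,
    forall_valid_zero, meaning, Order.lt_add_one_iff] at *
  intro u hu
  simp [body, assign, Fml.exs]
  simp +contextual only [h₁, h₂, hu]
  constructor
  · rintro ⟨p, -, hp, m, -, rfl, rfl, hu, h⟩
    rw [h₃ _ hp] at h
    rw [← Instance.encode_defender hu, ← h, add_comm]
  · rintro h
    obtain ⟨hu, -⟩ := id h
    have := row_add_lt hu hu
    refine ⟨u * (I.n + 2), by lia, by lia, I.n, hn, rfl, rfl, hu, ?_⟩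
    rw [h₃ _ (by lia), add_comm]
    exact (Instance.encode_defender hu).2 h

theorem sat_nonadj (h₁ : Correct I s size) (h₂ : Correct I s edge) : Defined I s nonadj := by
  have hn := (n_lt_length I).le
  simp only [Correct, Defined, vars, List.length_cons, List.length_nil, forall_valid_succ,
    forall_valid_zero, meaning, Order.lt_add_one_iff] at *
  intro u hu v hv
  simp [body, assign]
  simp +contextual only [h₁, h₂, hu, hv]
  exact ⟨fun ⟨m, _, _, h⟩ => h, fun h => ⟨_, hn, rfl, h⟩⟩

end Tab

end ControllerPlacement

namespace ControllerPlacement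

open StackCode

namespace Tab

attribute [local congr] and_congr_of_imp

variable {I : Instance} {s : Tab → List Bool}

/-! ### The tables of the interval order and of the sweep -/

theorem forces_sound (h₁ : Correct I s nonadj) (h₂ : Correct I s edge) : Sound I s forces := by
  intro h
  simp only [Correct, vars, List.length_cons, List.length_nil, forall_valid_succ,
    forall_valid_zero, meaning, Order.lt_add_one_iff] at *
  intro u hu v hv w hw z hz
  simp [body, assign]
  simp +contextual only [h₁, h₂, hw, hz]
  rintro (⟨rfl, rfl, h₃⟩ | ⟨h₃, x, hx, h₄, h₅⟩ | ⟨h₃, x, hx, h₄, h₅⟩)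
  · exact .refl h₃
  · exact .left (h _ hu _ hv _ hx _ hz h₄) h₃ h₅
  · exact .right (h _ hu _ hv _ hw _ hx h₄) h₃ h₅

theorem forces_complete (h₁ : Correct I s nonadj) (h₂ : Correct I s edge) :
    Complete I s forces := by
  intro h
  have hn := (n_lt_length I).le
  simp only [Correct, vars, List.length_cons, List.length_nil, forall_valid_succ,
    forall_valid_zero, meaning, Order.lt_add_one_iff] at *
  intro u hu v hv w hw z hz hf
  induction hf with
  | refl h₃ =>
    refine h u hu v hv u hu v hv ?_
    simp [body, assign]
    exact .inl ((h₁ _ hu _ hv).2 h₃)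
  | @left c d c' hf h₃ h₄ ih =>
    have hc : c ≤ I.encode.length := hf.nonAdj.1.le.trans hn
    refine h u hu v hv c' hw d hz ?_
    simp [body, assign]
    exact .inr (.inl ⟨(h₁ _ hw _ hz).2 h₃, c, hc, ih hc hz, (h₂ _ hc _ hw).2 h₄⟩)
  | @right c d d' hf h₃ h₄ ih =>
    have hd : d ≤ I.encode.length := hf.nonAdj.2.1.le.trans hn
    refine h u hu v hv c hw d' hz ?_
    simp [body, assign]
    exact .inr (.inr ⟨(h₁ _ hw _ hz).2 h₃, d, hd, ih hw hd, (h₂ _ hd _ hz).2 h₄⟩)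

theorem sat_before (h₁ : Correct I s forces) : Defined I s before := by
  have hn := (n_lt_length I).le
  simp only [Correct, Defined, vars, List.length_cons, List.length_nil, forall_valid_succ,
    forall_valid_zero, meaning, Order.lt_add_one_iff] at *
  intro u hu v hv
  simp [body, assign, Fml.exs]
  simp +contextual only [h₁, hu, hv]
  constructor
  · rintro ⟨i, -, j, -, hij, hf, h⟩
    refine ⟨i, j, hij, hf, fun k m hkm hf' => h k ?_ m ?_ hkm hf'⟩
    · rcases hf' with hf' | hf'
      exacts [hf'.nonAdj.1.le.trans hn, hf'.nonAdj.2.1.le.trans hn]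
    · rcases hf' with hf' | hf'
      exacts [hf'.nonAdj.2.1.le.trans hn, hf'.nonAdj.1.le.trans hn]
  · rintro ⟨i, j, hij, hf, h⟩
    exact ⟨i, hf.nonAdj.1.le.trans hn, j, hf.nonAdj.2.1.le.trans hn, hij, hf,
      fun k _ m _ => h k m⟩

theorem count_sound (h₁ : Correct I s before) : Sound I s count := by
  classical
  intro h
  simp only [Correct, vars, List.length_cons, List.length_nil, forall_valid_succ,
    forall_valid_zero, meaning, Order.lt_add_one_iff] at *
  intro v hv u hu c hc
  simp [body, assign]
  simp +contextual only [h₁, hv]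
  rintro (⟨rfl, rfl⟩ | ⟨w, hw, rfl, ⟨hb, y, hy, rfl, h₂⟩ | ⟨hb, h₂⟩⟩)
  · simp
  · rw [h v hv w hw y hy h₂, add_comm 1 w, Nat.count_succ, if_pos hb, add_comm]
  · rw [h v hv w hw c hc h₂, add_comm 1 w, Nat.count_succ, if_neg hb, add_zero]

theorem count_complete (h₁ : Correct I s before) : Complete I s count := by
  classical
  intro h
  simp only [Correct, vars, List.length_cons, List.length_nil, forall_valid_succ,
    forall_valid_zero, meaning, Order.lt_add_one_iff] at *
  intro v hv u
  induction u with
  | zero =>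
    rintro hu c hc rfl
    refine h v hv 0 hu _ hc ?_
    simp [body, assign]
  | succ u ih =>
    rintro hu c hc rfl
    refine h v hv _ hu _ hc ?_
    by_cases hb : IntervalOrder.Before I.n I.adj u v
    · rw [Nat.count_succ, if_pos hb] at hc ⊢
      simp [body, assign]
      exact ⟨u, by lia, by lia, .inl ⟨(h₁ _ (by lia) _ hv).2 hb, _, by lia, by lia,
        ih (by lia) _ (by lia) rfl⟩⟩
    · rw [Nat.count_succ, if_neg hb] at hc ⊢
      simp [body, assign]
      exact ⟨u, by lia, by lia, .inr ⟨mt (h₁ _ (by lia) _ hv).1 hb,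
        ih (by lia) _ (by lia) rfl⟩⟩

theorem sat_left (h₁ : Correct I s size) (h₂ : Correct I s count) : Defined I s left := by
  have hn := (n_lt_length I).le
  simp only [Correct, Defined, vars, List.length_cons, List.length_nil, forall_valid_succ,
    forall_valid_zero, meaning, Order.lt_add_one_iff] at *
  intro v hv p hp
  simp [body, assign]
  constructor
  · rintro ⟨m, hm, h₃, h₄⟩
    rw [h₁ _ hm] at h₃
    subst h₃
    exact (h₂ _ hv _ hm _ hp).1 h₄
  · intro h
    exact ⟨_, hn, (h₁ _ hn).2 rfl, (h₂ _ hv _ hn _ hp).2 h⟩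

theorem left_le_length (I : Instance) (v : ℕ) : I.left v ≤ I.encode.length := by
  classical
  exact (Nat.count_le (p := fun u => IntervalOrder.Before I.n I.adj u v)).trans (n_lt_length I).le

theorem sat_occ (h₁ : Correct I s size) (h₂ : Correct I s left) (h₃ : Correct I s before) :
    Defined I s occ := by
  have hn := (n_lt_length I).le
  simp only [Correct, Defined, vars, List.length_cons, List.length_nil, forall_valid_succ,
    forall_valid_zero, meaning, Order.lt_add_one_iff] at *
  intro v hv p hp
  simp [body, assign, Fml.exs]
  simp +contextual only [h₁, h₂, h₃, hv]
  constructor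
  · rintro ⟨m, -, i, -, rfl, hvn, rfl, hl, hpn, h⟩
    exact ⟨hvn, hl, hpn, fun w hw hb => h w (by lia) _ (left_le_length I w) hw hb rfl⟩
  · rintro ⟨hvn, hl, hpn, h⟩
    exact ⟨_, hn, _, left_le_length I v, rfl, hvn, rfl, hl, hpn, fun w _ _ _ hw hb _ => h w hw hb⟩

theorem sat_right (hI : IsIntervalGraph I.G) (h₁ : Correct I s occ) : Defined I s right := by
  obtain ⟨a, b, hr⟩ := Instance.exists_represents hI
  have hn := (n_lt_length I).le
  simp only [Correct, Defined, vars, List.length_cons, List.length_nil, forall_valid_succ,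
    forall_valid_zero, meaning, Order.lt_add_one_iff] at *
  intro v hv p hp
  simp [body, assign]
  simp +contextual only [h₁, hv, hp]
  simp only [IntervalOrder.occ_iff hr]
  constructor
  · rintro ⟨⟨hvn, h₂, h₃⟩, h₄⟩
    refine ⟨hvn, h₃.antisymm (not_lt.1 fun hlt => ?_)⟩
    have := IntervalOrder.right_lt hr hvn
    exact h₄ (by lia) ⟨hvn, by lia, by rw [add_comm]; exact hlt⟩
  · rintro ⟨hvn, rfl⟩
    refine ⟨⟨hvn, IntervalOrder.left_le_right hr hvn, le_rfl⟩, fun _ h => ?_⟩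
    have : 1 + I.right v ≤ I.right v := h.2.2
    lia

theorem sweep_sound (h₁ : Correct I s size) (h₂ : Correct I s left) (h₃ : Correct I s right)
    (h₄ : Correct I s defender) : Sound I s sweep := by
  intro h
  simp only [Correct, vars, List.length_cons, List.length_nil, forall_valid_succ,
    forall_valid_zero, meaning, Order.lt_add_one_iff] at *
  intro p hp v hv x hx y hy c hc g hg
  simp [body, assign, Fml.exs]
  rintro (⟨-, hm, rfl, rfl, rfl, rfl, rfl⟩ | ⟨m, hm', q, hq, z, hz, hm, rfl, hqn, rfl, hs⟩ |
    ⟨m, hm', w, hw, hm, rfl, hwn, hs, hne⟩ |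
    ⟨m, hm', w, hw, q, hq, i, hi, z, hz, hm, rfl, hwn, hr, rfl, hl, hs⟩)
  · rw [h₁ _ hv] at hm
    subst hm
    exact .base
  · rw [h₁ _ hm'] at hm
    subst hm
    rw [add_comm 1 q]
    rcases hs with ⟨rfl, hs⟩ | ⟨rfl, hs⟩
    · rw [add_comm 1 q]
      exact (h _ hq _ hm' _ hz _ hy _ hc _ hg hs).inside hqn
    · rw [add_comm 1 q]
      exact (h _ hq _ hm' _ hx _ hz _ hc _ hg hs).outside hqn
  · rw [h₁ _ hm'] at hm
    subst hm
    rw [add_comm 1 w]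
    refine (h _ hp _ hw _ hx _ hy _ hc _ hg hs).skip hwn fun he => ?_
    exact hne (I.right w) (by lia) ((h₃ _ hw _ (by lia)).2 ⟨hwn, rfl⟩) (by lia)
  · rw [h₁ _ hm'] at hm
    rw [h₂ _ hw _ hi] at hl
    rw [h₃ _ hw _ hq] at hr
    rw [h₄ _ hw] at hs
    obtain ⟨-, rfl⟩ := hr
    subst hm hl
    rw [add_comm 1 w]
    rcases hs with ⟨rfl, hs, h₅, h₆⟩ | ⟨rfl, hs, h₅, h₆⟩ | ⟨hs, h₅, h₆⟩
    · rw [add_comm 1 z]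
      exact (h _ hp _ hw _ hx _ hy _ hz _ hg hs).attacked hwn (add_comm _ _) h₅ h₆
    · rw [add_comm 1 z]
      exact (h _ hp _ hw _ hx _ hy _ hc _ hz hs).gained hwn (add_comm _ _) h₅ (not_lt.2 h₆)
    · exact (h _ hp _ hw _ hx _ hy _ hc _ hg hs).lost hwn (add_comm _ _) (not_lt.2 h₅) h₆

theorem sweep_complete (h₁ : Correct I s size) (h₂ : Correct I s left) (h₃ : Correct I s right)
    (h₄ : Correct I s defender) : Complete I s sweep := by
  intro h
  have hn := (n_lt_length I).le
  simp only [Correct, vars, List.length_cons, List.length_nil, forall_valid_succ,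
    forall_valid_zero, meaning, Order.lt_add_one_iff] at *
  suffices ∀ p v x y c g, Sweep I.n I.left I.right I.IsDefender p v x y c g →
      Holds (I.encode.length + 1) (s sweep) [p, v, x, y, c, g] from
    fun p _ v _ x _ y _ c _ g _ => this p v x y c g
  intro p v x y c g hs
  have size_n := (h₁ _ hn).2 rfl
  have closed : ∀ p v x y c g, Sweep I.n I.left I.right I.IsDefender p v x y c g →
      sweep.body.Sat (I.encode.length + 1) s (assign (fun _ => 0) [.p, .v, .x, .y, .c, .g]
        [p, v, x, y, c, g]) →
      Holds (I.encode.length + 1) (s sweep) [p, v, x, y, c, g] := by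
    intro p v x y c g hs
    have := hs.le
    exact h p (by lia) v (by lia) x (by lia) y (by lia) c (by lia) g (by lia)
  induction hs with
  | base =>
    refine closed _ _ _ _ _ _ .base ?_
    simp [body, assign, Fml.exs]
    exact .inl ⟨hn, size_n⟩
  | @inside p x y c g hs hp ih =>
    refine closed _ _ _ _ _ _ (hs.inside hp) ?_
    have := hs.le
    simp [body, assign, Fml.exs]
    exact ⟨_, hn, p, by lia, x, by lia, size_n, by lia, hp, .inl ih⟩
  | @outside p x y c g hs hp ih =>
    refine closed _ _ _ _ _ _ (hs.outside hp) ?_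
    have := hs.le
    simp [body, assign, Fml.exs]
    exact ⟨_, hn, p, by lia, y, by lia, size_n, by lia, hp, .inr ih⟩
  | @skip p v x y c g hs hv he ih =>
    refine closed _ _ _ _ _ _ (hs.skip hv he) ?_
    simp [body, assign, Fml.exs]
    refine .inr (.inl ⟨_, hn, v, by lia, size_n, by lia, hv, ih, fun q hq hr => ?_⟩)
    rw [h₃ _ (by lia) _ hq] at hr
    lia
  | @attacked p v x y c g hs hv he h₅ h₆ ih =>
    refine closed _ _ _ _ _ _ (hs.attacked hv he h₅ h₆) ?_
    have := hs.le
    simp [body, assign, Fml.exs]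
    exact .inr ⟨_, hn, v, by lia, I.right v, by lia, I.left v, left_le_length I v, c, by lia,
      size_n, by lia, hv, (h₃ _ (by lia) _ (by lia)).2 ⟨hv, rfl⟩, by lia,
      (h₂ _ (by lia) _ (left_le_length I v)).2 rfl,
      .inl ⟨by lia, ih, h₅, by rwa [h₄ _ (by lia)]⟩⟩
  | @gained p v x y c g hs hv he h₅ h₆ ih =>
    refine closed _ _ _ _ _ _ (hs.gained hv he h₅ h₆) ?_
    have := hs.le
    simp [body, assign, Fml.exs]
    exact .inr ⟨_, hn, v, by lia, I.right v, by lia, I.left v, left_le_length I v, g, by lia,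
      size_n, by lia, hv, (h₃ _ (by lia) _ (by lia)).2 ⟨hv, rfl⟩, by lia,
      (h₂ _ (by lia) _ (left_le_length I v)).2 rfl,
      .inr (.inl ⟨by lia, ih, by rwa [h₄ _ (by lia)], not_lt.1 h₆⟩)⟩
  | @lost p v x y c g hs hv he h₅ h₆ ih =>
    refine closed _ _ _ _ _ _ (hs.lost hv he h₅ h₆) ?_
    have := hs.le
    simp [body, assign, Fml.exs]
    exact .inr (.inr ⟨_, hn, v, by lia, I.right v, by lia, I.left v, left_le_length I v, g, by lia,
      size_n, by lia, hv, (h₃ _ (by lia) _ (by lia)).2 ⟨hv, rfl⟩, by lia,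
      (h₂ _ (by lia) _ (left_le_length I v)).2 rfl,
      .inr (.inr ⟨ih, not_lt.1 h₅, by rwa [h₄ _ (by lia)]⟩)⟩)

/-- The program computes the intended contents of all tables. -/
theorem done_prog (hI : IsIntervalGraph I.G) :
    ∀ a, Correct I (prog.run (I.encode.length + 1) fun a => I.encode.map a.input) a := by
  have read : ∀ (a : Tab) (p : ℕ), (I.encode.map a.input).getD p false = true ↔
      ∃ b, I.encode[p]? = some b ∧ a.input b = true := by
    intro a p
    rw [List.getD_eq_getElem?_getD, List.getElem?_map]
    cases I.encode[p]? <;> simp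
  have h : Done I [bra, comma, bit] fun a => I.encode.map a.input := by
    constructor
    · simp only [List.forall_mem_cons, Correct, vars, List.length_cons, List.length_nil,
        forall_valid_succ, forall_valid_zero, meaning, Holds, read]
      simp [input, index]
    · intro a ha p
      rw [← Bool.not_eq_true, read]
      cases a <;> first | exact absurd (by decide) ha | simp [input]
  replace h := h.define (a := size) (by decide)
    fun h => sat_size (h _ (by decide)) (h _ (by decide))
  replace h := h.induct (a := row) (by decide) (fun s h => row_sound (h _ (by decide)))
    (fun s h => row_complete (h _ (by decide)))
  replace h := h.induct (a := value) (by decide)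
    (fun s h => value_sound (h _ (by decide)) (h _ (by decide)) (h _ (by decide)))
    (fun s h => value_complete (h _ (by decide)) (h _ (by decide)) (h _ (by decide)))
  replace h := h.define (a := loss) (by decide)
    fun h => sat_loss (h _ (by decide)) (h _ (by decide))
  replace h := h.define (a := goal) (by decide)
    fun h => sat_goal (h _ (by decide)) (h _ (by decide))
  replace h := h.define (a := edge) (by decide)
    fun h => sat_edge (h _ (by decide)) (h _ (by decide)) (h _ (by decide))
  replace h := h.define (a := defender) (by decide)
    fun h => sat_defender (h _ (by decide)) (h _ (by decide)) (h _ (by decide))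
  replace h := h.define (a := nonadj) (by decide)
    fun h => sat_nonadj (h _ (by decide)) (h _ (by decide))
  replace h := h.induct (a := forces) (by decide)
    (fun s h => forces_sound (h _ (by decide)) (h _ (by decide)))
    (fun s h => forces_complete (h _ (by decide)) (h _ (by decide)))
  replace h := h.define (a := before) (by decide) fun h => sat_before (h _ (by decide))
  replace h := h.induct (a := count) (by decide) (fun s h => count_sound (h _ (by decide)))
    (fun s h => count_complete (h _ (by decide)))
  replace h := h.define (a := left) (by decide)
    fun h => sat_left (h _ (by decide)) (h _ (by decide))
  replace h := h.define (a := occ) (by decide)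
    fun h => sat_occ (h _ (by decide)) (h _ (by decide)) (h _ (by decide))
  replace h := h.define (a := right) (by decide) fun h => sat_right hI (h _ (by decide))
  replace h := h.induct (a := sweep) (by decide)
    (fun s h => sweep_sound (h _ (by decide)) (h _ (by decide)) (h _ (by decide)) (h _ (by decide)))
    (fun s h => sweep_complete (h _ (by decide)) (h _ (by decide)) (h _ (by decide))
      (h _ (by decide)))
  intro a
  exact h.1 a (by cases a <;> decide)

/-- The formula `answer` decides the instances on interval graphs. Cutting off `ℓ` and `α` does no harm,
since the length of the input string exceeds the number of vertices. -/
theorem sat_answer (hI : IsIntervalGraph I.G) :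
    answer.Sat (I.encode.length + 1)
      (prog.run (I.encode.length + 1) fun a => I.encode.map a.input) (fun _ => 0) ↔ I.IsYes := by
  have h := done_prog hI
  have hlt := n_lt_length I
  have hn := hlt.le
  generalize prog.run (I.encode.length + 1) (fun a => I.encode.map a.input) = s at *
  have h₁ := h size
  have h₂ := h sweep
  have h₃ := h loss
  have h₄ := h goal
  simp only [Correct, vars, List.length_cons, List.length_nil, forall_valid_succ,
    forall_valid_zero, meaning, Order.lt_add_one_iff] at h₁ h₂ h₃ h₄
  rw [Instance.isYes_iff_sweep hI]
  simp [answer, Fml.exs]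
  constructor
  · rintro ⟨m, hm, x, hx, y, hy, c, hc, g, hg, u, hu, v, hv, h₅, h₆, h₇, h₈, h₉, h₁₀, h₁₁⟩
    rw [h₁ _ hm] at h₅
    rw [h₂ _ hm _ hm _ hx _ hy _ hc _ hg] at h₆
    rw [h₃ _ hu] at h₇
    rw [h₄ _ hv] at h₈
    subst h₅
    exact ⟨by lia, x, y, c, g, h₆, by lia, by lia⟩
  · rintro ⟨hα, x, y, c, g, hs, hc, hg⟩
    have := hs.le
    refine ⟨_, hn, x, by lia, y, by lia, c, by lia, g, by lia, _, min_le_right I.l _, _,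
      min_le_right I.α _, (h₁ _ hn).2 rfl,
      (h₂ _ hn _ hn _ (by lia) _ (by lia) _ (by lia) _ (by lia)).2 hs,
      (h₃ _ (min_le_right _ _)).2 rfl, (h₄ _ (min_le_right _ _)).2 rfl, ?_, ?_, ?_⟩ <;> lia

end Tab

end ControllerPlacement

theorem theorem5p2 :
    ControllerPlacement.PolyTimeSolvableOn ControllerPlacement.Instance.encode
      ControllerPlacement.Instance.IsYes
      (fun I => ControllerPlacement.IsIntervalGraph I.G) :=
  StackCode.polyTimeSolvableOn_of_prog _ _ _ ControllerPlacement.Tab.input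
    ControllerPlacement.Tab.prog ControllerPlacement.Tab.prog_ok ControllerPlacement.Tab.answer
    fun _ hI => ControllerPlacement.Tab.sat_answer hI
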